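/- Let $c\in\mathbb R$ with $0<|c|<0.1$ and put $\gamma=\sqrt{1-8c^2}$. There exist constants $\xi_0\ge 1$ and $0<C_1\le C_2$, depending only on $c$, such that the following holds. Let $k_0\ge 2$ be an integer, let $\eta>0$ with $\xi:=\eta/k_0^2\ge\xi_0$, and put $$t_0=-\frac{k_0}{2(k_0+1)},\qquad t_1=\frac{k_0}{2(k_0-1)},\qquad a(k)=a(k,t)=\frac{c}{\eta^{-2}k_0^2k^2+\left(k_0-k-\frac{k}{k_0}t\right)^2}\quad(k\in\mathbb Z),$$ so that in particular $a(k_0)=\dfrac{c}{\xi^{-2}+t^2}$. Let $u=(u(t,k))_{k\in\mathbb Z}$ be a complex-valued solution, continuous in $t$ on $[t_0,t_1]$ for each $k$ and bounded uniformly in $t\in[t_0,t_1]$ and $k\in\mathbb Z$, of the full nearest-neighbour system $$\partial_t u(k)+a(k+1)u(k+1)-a(k-1)u(k-1)=0,\qquad k\in\mathbb Z,\ t\in(t_0,t_1).$$ Put $\theta=\sup_k|u(t_0,k)|$ and suppose that $|u(t_0,k_0)|\ge\frac12\theta$. Then there is a constant $C\in[C_1,C_2]$ (which may depend on $u$, $k_0$,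 $\eta$ within this range) such that $$|u(t_1,k)|\le C\,\xi^{\gamma}\,\theta\quad\text{for all }k\in\mathbb Z,\qquad\text{and}\qquad |u(t_1,k_0-1)|\ge\frac C2\,\xi^{\gamma}\,\theta .$$ In particular $|u(t_1,k_0-1)|\ge\frac12\sup_k|u(t_1,k)|$ and $\eta/(k_0-1)^2\ge\xi_0$: the hypotheses hold again with $k_0$ replaced by $k_0-1$ and with $u(t_1,\cdot)$ as the new initial state, so the theorem can be iterated. -/

import Mathlib

open Set

namespace EchoChain

noncomputable section

/-- Left end `t₀ = -k₀ / (2 (k₀ + 1))` of the resonant interval around `k₀`, in the rescaled time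
`t = k₀² (τ - 1 / k₀)`. -/
def startTime (k₀ : ℕ) : ℝ := -((k₀ : ℝ) / (2 * ((k₀ : ℝ) + 1)))

/-- Right end `t₁ = k₀ / (2 (k₀ - 1))` of the resonant interval around `k₀` (for `k₀ ≥ 2`). In the
variable `τ` it is the same time as the left end of the interval around `k₀ - 1`. -/
def endTime (k₀ : ℕ) : ℝ := (k₀ : ℝ) / (2 * ((k₀ : ℝ) - 1))

/-- The coefficient `a(k)` at time `t`, that is
`c / (η⁻² k₀² k² + (k₀ - k - (k / k₀) t)²)`.
For `k = k₀` the denominator is `ξ⁻² + t²` with `ξ = η / k₀²`. -/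
def coeff (c η : ℝ) (k₀ : ℕ) (k : ℤ) (t : ℝ) : ℝ :=
  c / ((η ^ 2)⁻¹ * (k₀ : ℝ) ^ 2 * (k : ℝ) ^ 2
    + ((k₀ : ℝ) - (k : ℝ) - (k : ℝ) / (k₀ : ℝ) * t) ^ 2)

/-- `u` solves the full nearest-neighbour system
`∂ₜ u(k) + a(k+1) u(k+1) - a(k-1) u(k-1) = 0`, `k ∈ ℤ`, on the resonant interval around `k₀`,
is continuous up to the end points, and stays bounded in `ℓ^∞(ℤ)`. -/
structure IsSolution (c η : ℝ) (k₀ : ℕ) (u : ℝ → ℤ → ℂ) : Prop where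
  bounded : ∃ B : ℝ, ∀ t ∈ Icc (startTime k₀) (endTime k₀), ∀ k : ℤ, ‖u t k‖ ≤ B
  continuousOn : ∀ k : ℤ, ContinuousOn (fun t => u t k) (Icc (startTime k₀) (endTime k₀))
  hasDerivAt : ∀ t ∈ Ioo (startTime k₀) (endTime k₀), ∀ k : ℤ,
    HasDerivAt (fun s => u s k)
      ((coeff c η k₀ (k - 1) t : ℂ) * u t (k - 1) - (coeff c η k₀ (k + 1) t : ℂ) * u t (k + 1)) t

/-- The maximum `max_k |v(k)|` of a (bounded) state, as a supremum. -/
def maxMode (v : ℤ → ℂ) : ℝ := ⨆ k : ℤ, ‖v k‖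

/-- The mode `k` of the state `v` is at least half of the maximum. -/
def ModeDominates (k : ℤ) (v : ℤ → ℂ) : Prop := (1 / 2) * maxMode v ≤ ‖v k‖

end

end EchoChain

namespace EchoChain

/-- Mean value inequality with a real majorant. -/
theorem norm_sub_le_of_norm_deriv_le {f f' : ℝ → ℂ} {B B' : ℝ → ℝ} {a b : ℝ} (hab : a ≤ b)
    (hf : ContinuousOn f (Icc a b)) (hf' : ∀ t ∈ Ioo a b, HasDerivAt f (f' t) t)
    (hB : ∀ t, HasDerivAt B (B' t) t) (bound : ∀ t ∈ Ioo a b, ‖f' t‖ ≤ B' t) :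
    ‖f b - f a‖ ≤ B b - B a := by
  obtain ⟨z, hz, hzf⟩ : ∃ z : ℂ, ‖z‖ = 1 ∧ (z * (f b - f a)).re = ‖f b - f a‖ := by
    by_cases h0 : f b - f a = 0
    · exact ⟨1, by simp, by simp [h0]⟩
    · refine ⟨(starRingEnd ℂ) (f b - f a) / ‖f b - f a‖, ?_, ?_⟩
      · rw [norm_div, Complex.norm_conj, Complex.norm_real, norm_norm,
          div_self (norm_ne_zero_iff.2 h0)]
      · rw [div_mul_eq_mul_div, Complex.conj_mul', ← Complex.ofReal_pow, ← Complex.ofReal_div,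
          Complex.ofReal_re]
        field_simp
  have hd : ∀ t ∈ Ioo a b, HasDerivAt (fun s => (z * f s).re - B s) ((z * f' t).re - B' t) t := by
    intro t ht
    have h1 : HasDerivAt (fun s => z * f s) (z * f' t) t := (hf' t ht).const_mul z
    have h2 : HasDerivAt (fun s => (z * f s).re) (z * f' t).re t :=
      (Complex.reCLM.hasFDerivAt.comp_hasDerivAt t h1)
    exact h2.sub (hB t)
  have hcont : ContinuousOn (fun s => (z * f s).re - B s) (Icc a b) := by
    refine ContinuousOn.sub ?_ (fun t _ => (hB t).continuousAt.continuousWithinAt)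
    exact Complex.continuous_re.comp_continuousOn (continuousOn_const.mul hf)
  have hanti : AntitoneOn (fun s => (z * f s).re - B s) (Icc a b) := by
    refine antitoneOn_of_deriv_nonpos (convex_Icc a b) hcont ?_ ?_
    · intro t ht
      rw [interior_Icc] at ht
      exact (hd t ht).differentiableAt.differentiableWithinAt
    · intro t ht
      rw [interior_Icc] at ht
      rw [(hd t ht).deriv]
      have h1 : (z * f' t).re ≤ ‖z * f' t‖ := Complex.re_le_norm _
      rw [norm_mul, hz, one_mul] at h1
      linarith [bound t ht]
  have h := hanti (left_mem_Icc.2 hab) (right_mem_Icc.2 hab) hab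
  simp only at h
  rw [← hzf, mul_sub, Complex.sub_re]
  linarith

/-- The regularised distance `√(t² + ε²)` to the resonance. -/
noncomputable def radius (ε t : ℝ) : ℝ := √(t ^ 2 + ε ^ 2)

section radius

variable {ε t : ℝ}

theorem radius_sq (ε t : ℝ) : radius ε t ^ 2 = t ^ 2 + ε ^ 2 :=
  Real.sq_sqrt (by positivity)

theorem radius_pos (hε : 0 < ε) (t : ℝ) : 0 < radius ε t := Real.sqrt_pos.2 (by positivity)

theorem radius_neg (ε t : ℝ) : radius ε (-t) = radius ε t := by simp [radius]

theorem radius_zero (hε : 0 < ε) : radius ε 0 = ε := by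
  simp [radius, Real.sqrt_sq hε.le]

theorem abs_le_radius (ε t : ℝ) : |t| ≤ radius ε t := by
  rw [radius, ← Real.sqrt_sq_eq_abs]
  exact Real.sqrt_le_sqrt (by nlinarith [sq_nonneg ε])

theorem le_radius (ε t : ℝ) : t ≤ radius ε t := (le_abs_self t).trans (abs_le_radius ε t)

theorem neg_le_radius (ε t : ℝ) : -t ≤ radius ε t := (neg_le_abs t).trans (abs_le_radius ε t)

theorem eps_le_radius (ε t : ℝ) : ε ≤ radius ε t :=
  Real.le_sqrt_of_sq_le (by nlinarith [sq_nonneg t])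

theorem radius_sub_pos (hε : 0 < ε) (t : ℝ) : 0 < radius ε t - t := by
  nlinarith [radius_sq ε t, le_radius ε t, radius_pos hε t, pow_pos hε 2]

theorem hasDerivAt_radius (hε : 0 < ε) (t : ℝ) :
    HasDerivAt (radius ε) (t / radius ε t) t := by
  have h1 : HasDerivAt (fun s : ℝ => s ^ 2 + ε ^ 2) (2 * t) t := by
    simpa using (hasDerivAt_pow 2 t).add_const (ε ^ 2)
  have h2 := h1.sqrt (by positivity)
  refine h2.congr_deriv ?_
  simp only [radius]
  field_simp

theorem radius_rpow_sub_one (hε : 0 < ε) (t x : ℝ) :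
    radius ε t ^ (x - 1) = radius ε t ^ x / radius ε t :=
  Real.rpow_sub_one (radius_pos hε t).ne' x

theorem radius_rpow_sub_two (hε : 0 < ε) (t x : ℝ) :
    radius ε t ^ (x - 2) = radius ε t ^ x / radius ε t ^ 2 := by
  rw [Real.rpow_sub (radius_pos hε t)]; norm_cast

theorem radius_rpow_sub_four (hε : 0 < ε) (t x : ℝ) :
    radius ε t ^ (x - 4) = radius ε t ^ x / radius ε t ^ 4 := by
  rw [Real.rpow_sub (radius_pos hε t)]; norm_cast

theorem hasDerivAt_radius_rpow (hε : 0 < ε) (x t : ℝ) :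
    HasDerivAt (fun s => radius ε s ^ x) (x * t * radius ε t ^ (x - 2)) t := by
  have h := (hasDerivAt_radius hε t).rpow_const (p := x) (Or.inl (radius_pos hε t).ne')
  convert h using 1
  rw [radius_rpow_sub_one hε, radius_rpow_sub_two hε]
  have := radius_pos hε t
  field_simp

theorem hasDerivAt_mul_radius_rpow (hε : 0 < ε) (x t : ℝ) :
    HasDerivAt (fun s => s * radius ε s ^ x)
      (radius ε t ^ x * (1 + x * t ^ 2 / radius ε t ^ 2)) t := by
  have h := (hasDerivAt_id t).mul (hasDerivAt_radius_rpow hε x t)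
  refine h.congr_deriv ?_
  simp only [id]
  rw [radius_rpow_sub_two hε]
  have := radius_pos hε t
  field_simp

theorem hasDerivAt_div_radius (hε : 0 < ε) (t : ℝ) :
    HasDerivAt (fun s => s / radius ε s) (ε ^ 2 / radius ε t ^ 3) t := by
  have h := (hasDerivAt_id t).div (hasDerivAt_radius hε t) (radius_pos hε t).ne'
  refine h.congr_deriv ?_
  simp only [id]
  have := radius_pos hε t
  field_simp
  linarith [radius_sq ε t]

theorem sq_div_radius_sq_le_one (hε : 0 < ε) (t : ℝ) : t ^ 2 / radius ε t ^ 2 ≤ 1 := by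
  rw [div_le_one (pow_pos (radius_pos hε t) 2), radius_sq]
  nlinarith [sq_nonneg ε]

theorem continuous_radius (ε : ℝ) : Continuous (radius ε) := by
  unfold radius; fun_prop

end radius

/-- The function `x ↦ t ρ^(-x)` grows at least like `(1 - x) ∫ ρ^(-x)`. -/
theorem mul_radius_rpow_deriv_ge {ε x : ℝ} (hε : 0 < ε) (hx : 0 ≤ x) (t : ℝ) :
    (1 - x) * radius ε t ^ (-x) ≤ radius ε t ^ (-x) * (1 + -x * t ^ 2 / radius ε t ^ 2) := by
  have h := sq_div_radius_sq_le_one hε t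
  have h1 : (0 : ℝ) < radius ε t ^ (-x) := Real.rpow_pos_of_pos (radius_pos hε t) _
  have h2 : 1 - x ≤ 1 + -x * t ^ 2 / radius ε t ^ 2 := by
    rw [mul_div_assoc]; nlinarith
  nlinarith

theorem mul_radius_rpow_neg_le {ε t x : ℝ} (ht : 0 ≤ t) (hx : 0 ≤ x) :
    t * radius ε t ^ (-x) ≤ t ^ (1 - x) := by
  rcases ht.eq_or_lt with rfl | ht
  · simp only [zero_mul]; positivity
  · have h : radius ε t ^ (-x) ≤ t ^ (-x) :=
      Real.rpow_le_rpow_of_nonpos ht (le_radius ε t) (by linarith)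
    calc t * radius ε t ^ (-x) ≤ t * t ^ (-x) := by gcongr
      _ = t ^ (1 - x) := by rw [sub_eq_add_neg, Real.rpow_add ht, Real.rpow_one]

theorem rpow_one_sub_le {t x : ℝ} (ht : 0 ≤ t) (hx : 0 ≤ x) (hx1 : x ≤ 1) :
    t ^ (1 - x) ≤ (1 - x) * t + x := by
  have h := Real.geom_mean_le_arith_mean2_weighted (by linarith : 0 ≤ 1 - x) hx ht
    (zero_le_one) (by ring)
  simpa using h

end EchoChain

namespace EchoChain

/-- The normalised coefficient of the mode `k₀ - 1`, with `h = 1 / k₀`. -/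
noncomputable def lowerCoeff (ε h t : ℝ) : ℝ :=
  1 / (ε ^ 2 * (1 - h) ^ 2 + (1 - (1 - h) * t) ^ 2)

/-- The normalised coefficient of the mode `k₀ + 1`, with `h = 1 / k₀`. -/
noncomputable def upperCoeff (ε h t : ℝ) : ℝ :=
  1 / (ε ^ 2 * (1 + h) ^ 2 + (1 + (1 + h) * t) ^ 2)

theorem abs_one_div_sub_one_le_of_le_half {e y : ℝ} (he : 0 ≤ e) (hy : 0 ≤ y) (hy' : y ≤ 1 / 2) :
    |1 / (e + (1 - y) ^ 2) - 1| ≤ 2 * y + 8 * y ^ 2 + e ∧ |1 / (e + (1 - y) ^ 2) - 1| ≤ 3 + e ∧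
      |1 / (e + (1 - y) ^ 2)| ≤ 4 := by
  have hD : (1 / 4 : ℝ) ≤ (1 - y) ^ 2 := by nlinarith
  have hpos : 0 < e + (1 - y) ^ 2 := by linarith
  have h4 : 1 / (e + (1 - y) ^ 2) ≤ 4 := by
    rw [div_le_iff₀ hpos]; linarith
  have hlow : -e ≤ 1 / (e + (1 - y) ^ 2) - 1 := by
    rw [le_sub_iff_add_le, le_div_iff₀ hpos]
    nlinarith [mul_nonneg he he, mul_nonneg he hy, mul_nonneg hy (by linarith : 0 ≤ 1 / 2 - y)]
  have hup : 1 / (e + (1 - y) ^ 2) ≤ 1 + (2 * y + 8 * y ^ 2) := by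
    rw [div_le_iff₀ hpos]
    have h1 : 1 ≤ (1 + (2 * y + 8 * y ^ 2)) * (1 - y) ^ 2 := by
      have : (1 + (2 * y + 8 * y ^ 2)) * (1 - y) ^ 2 - 1 = y ^ 2 * (1 - 2 * y) * (5 - 4 * y) := by
        ring
      have : 0 ≤ y ^ 2 * (1 - 2 * y) * (5 - 4 * y) :=
        mul_nonneg (mul_nonneg (sq_nonneg y) (by linarith)) (by linarith)
      linarith
    nlinarith [mul_nonneg he hy, mul_nonneg he (sq_nonneg y)]
  refine ⟨abs_le.2 ⟨by nlinarith, by linarith⟩, abs_le.2 ⟨by linarith, by linarith⟩, ?_⟩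
  rw [abs_of_pos (by positivity)]
  exact h4

theorem abs_one_div_sub_one_le_of_nonneg {e y : ℝ} (he : 0 ≤ e) (hy : 0 ≤ y) :
    |1 / (e + (1 + y) ^ 2) - 1| ≤ 2 * y + e ∧ |1 / (e + (1 + y) ^ 2) - 1| ≤ 1 ∧
      |1 / (e + (1 + y) ^ 2)| ≤ 1 := by
  have hD : (1 : ℝ) ≤ (1 + y) ^ 2 := by nlinarith
  have hpos : 0 < e + (1 + y) ^ 2 := by linarith
  have h1 : 1 / (e + (1 + y) ^ 2) ≤ 1 := by
    rw [div_le_iff₀ hpos]; linarith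
  have h0 : 0 < 1 / (e + (1 + y) ^ 2) := by positivity
  have hlow : 1 - (2 * y + e) ≤ 1 / (e + (1 + y) ^ 2) := by
    rw [le_div_iff₀ hpos]
    by_cases h : 2 * y + e ≤ 1
    · nlinarith [mul_nonneg he hy, mul_nonneg he he, mul_nonneg hy hy,
        mul_nonneg (mul_nonneg hy hy) hy, mul_nonneg (mul_nonneg hy hy) he]
    · nlinarith
  refine ⟨abs_le.2 ⟨by linarith, by linarith⟩, abs_le.2 ⟨by linarith, by linarith⟩, ?_⟩
  rw [abs_of_pos h0]
  exact h1

/-- Bounds on the coefficients next to the resonance, before the resonant time. -/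
theorem coeff_bounds_before {ε h r : ℝ} (hh : 0 < h) (hh' : h ≤ 1 / 2) (hr : 0 ≤ r)
    (hr' : (1 + h) * r ≤ 1 / 2) :
    |lowerCoeff ε h (-r) - 1| + |upperCoeff ε h (-r) - 1|
        ≤ 4 * r + 8 * (1 + h) ^ 2 * r ^ 2 + 9 / 2 * ε ^ 2 ∧
      |lowerCoeff ε h (-r)| ≤ 4 ∧ |upperCoeff ε h (-r)| ≤ 4 := by
  obtain ⟨a1, a2, a3⟩ := abs_one_div_sub_one_le_of_le_half
    (e := ε ^ 2 * (1 + h) ^ 2) (y := (1 + h) * r) (by positivity) (by positivity) hr'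
  obtain ⟨b1, b2, b3⟩ := abs_one_div_sub_one_le_of_nonneg
    (e := ε ^ 2 * (1 - h) ^ 2) (y := (1 - h) * r) (by positivity)
    (mul_nonneg (by linarith) hr)
  have e1 : lowerCoeff ε h (-r) = 1 / (ε ^ 2 * (1 - h) ^ 2 + (1 + (1 - h) * r) ^ 2) := by
    rw [lowerCoeff]; ring_nf
  have e2 : upperCoeff ε h (-r) = 1 / (ε ^ 2 * (1 + h) ^ 2 + (1 - (1 + h) * r) ^ 2) := by
    rw [upperCoeff]; ring_nf
  rw [e1, e2]
  refine ⟨?_, by linarith, a3⟩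
  have : (1 + h) ^ 2 + (1 - h) ^ 2 ≤ 9 / 2 := by nlinarith
  nlinarith [sq_nonneg ε]

/-- Bounds on the coefficients next to the resonance, after the resonant time. -/
theorem coeff_bounds_after {ε h t : ℝ} (hh : 0 < h) (hh' : h ≤ 1 / 2) (ht : 0 ≤ t)
    (ht' : (1 - h) * t ≤ 1 / 2) :
    |lowerCoeff ε h t - 1| + |upperCoeff ε h t - 1|
        ≤ 4 * t + 8 * (1 - h) ^ 2 * t ^ 2 + 9 / 2 * ε ^ 2 ∧
      |lowerCoeff ε h t - 1| + |upperCoeff ε h t - 1| ≤ 4 + 9 / 2 * ε ^ 2 ∧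
      |lowerCoeff ε h t| ≤ 4 ∧ |upperCoeff ε h t| ≤ 4 := by
  obtain ⟨a1, a2, a3⟩ := abs_one_div_sub_one_le_of_le_half
    (e := ε ^ 2 * (1 - h) ^ 2) (y := (1 - h) * t) (by positivity)
    (mul_nonneg (by linarith) ht) ht'
  obtain ⟨b1, b2, b3⟩ := abs_one_div_sub_one_le_of_nonneg
    (e := ε ^ 2 * (1 + h) ^ 2) (y := (1 + h) * t) (by positivity)
    (mul_nonneg (by linarith) ht)
  have e1 : lowerCoeff ε h t = 1 / (ε ^ 2 * (1 - h) ^ 2 + (1 - (1 - h) * t) ^ 2) := rfl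
  have e2 : upperCoeff ε h t = 1 / (ε ^ 2 * (1 + h) ^ 2 + (1 + (1 + h) * t) ^ 2) := rfl
  rw [e1, e2]
  have : (1 + h) ^ 2 + (1 - h) ^ 2 ≤ 9 / 2 := by nlinarith
  have h3 : (1 - h) ^ 2 ≤ 9 / 2 := by nlinarith
  refine ⟨?_, ?_, a3, by linarith⟩
  · nlinarith [sq_nonneg ε]
  · nlinarith [sq_nonneg ε]

/-- The parameters: coupling `c`, exponent `α`, inverse frequency `ε`, inverse mode `h`. -/
structure Params (c α ε h : ℝ) : Prop where
  c_pos : 0 < |c|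
  c_lt : |c| < 1 / 10
  α_pos : 0 < α
  α_lt : α < 41 / 2000
  root : α * (1 - α) = 2 * c ^ 2
  ε_pos : 0 < ε
  ε_le : ε ≤ 1 / 10000
  h_pos : 0 < h
  h_le : h ≤ 1 / 2

/-- The resonant mode `U`, its two neighbours `um`, `up`, and all other modes `v`, on an interval
`[a, b]`; `fm` and `fp` are the forces of the other modes on the neighbours. -/
structure ResonantSystem {ι : Type*} (c ε h a b : ℝ) (U um up fm fp : ℝ → ℂ) (v : ι → ℝ → ℂ) :
    Prop where
  cont : ContinuousOn U (Icc a b)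
  cont_um : ContinuousOn um (Icc a b)
  cont_up : ContinuousOn up (Icc a b)
  cont_v : ∀ i, ContinuousOn (v i) (Icc a b)
  deriv : ∀ t ∈ Ioo a b, HasDerivAt U
    (c * (lowerCoeff ε h t * um t - upperCoeff ε h t * up t)) t
  deriv_um : ∀ t ∈ Ioo a b, HasDerivAt um (fm t - c / ((t : ℂ) ^ 2 + ε ^ 2) * U t) t
  deriv_up : ∀ t ∈ Ioo a b, HasDerivAt up (c / ((t : ℂ) ^ 2 + ε ^ 2) * U t - fp t) t
  deriv_v : ∀ t ∈ Ioo a b, ∀ i, ∃ d, HasDerivAt (v i) d t ∧ ∀ w V, ‖um t‖ ≤ w → ‖up t‖ ≤ w →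
    (∀ j, ‖v j t‖ ≤ V) → ‖d‖ ≤ 4 * |c| * w + 9 / 8 * |c| * V
  fm_le : ∀ t ∈ Ioo a b, ∀ V, (∀ j, ‖v j t‖ ≤ V) → ‖fm t‖ ≤ 9 / 16 * |c| * V
  fp_le : ∀ t ∈ Ioo a b, ∀ V, (∀ j, ‖v j t‖ ≤ V) → ‖fp t‖ ≤ 9 / 16 * |c| * V
  bounded : ∃ B, ∀ t ∈ Icc a b, ∀ i, ‖v i t‖ ≤ B

/-- The resonant mode, rescaled by the slowly varying profile `ρ ^ α`. -/
noncomputable def amplitude (α ε : ℝ) (U : ℝ → ℂ) (t : ℝ) : ℂ :=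
  ((radius ε t ^ (-α) : ℝ) : ℂ) * U t

/-- The Wronskian of the resonant pair with the profile `ρ ^ α`. -/
noncomputable def wronskian (c α ε : ℝ) (U um up : ℝ → ℂ) (t : ℝ) : ℂ :=
  ((radius ε t ^ α : ℝ) : ℂ) * (c * (um t - up t)) - ((α * t * radius ε t ^ (α - 2) : ℝ) : ℂ) * U t

/-- The part of the equation of the resonant mode that comes from non-constant coefficients. -/
noncomputable def defect (c ε h : ℝ) (um up : ℝ → ℂ) (t : ℝ) : ℂ :=
  c * (((lowerCoeff ε h t - 1 : ℝ) : ℂ) * um t - ((upperCoeff ε h t - 1 : ℝ) : ℂ) * up t)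

/-- The density that couples the amplitude to the Wronskian near the resonant time. -/
noncomputable def couplingDensity (α ε t : ℝ) : ℝ :=
  α * (2 - α) * ε ^ 2 * radius ε t ^ (2 * α - 4)

theorem radius_rpow_neg (ε t x : ℝ) : radius ε t ^ (-x) = (radius ε t ^ x)⁻¹ :=
  Real.rpow_neg (Real.sqrt_nonneg _) x

theorem radius_rpow_two_mul (ε t x : ℝ) : radius ε t ^ (2 * x) = (radius ε t ^ x) ^ 2 := by
  rw [mul_comm, Real.rpow_mul (show 0 ≤ radius ε t from Real.sqrt_nonneg _)]; norm_cast

namespace ResonantSystem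

variable {ι : Type*} {c α ε h a b t : ℝ} {U um up fm fp : ℝ → ℂ} {v : ι → ℝ → ℂ}

theorem eq_rpow_mul_amplitude (hε : 0 < ε) (U : ℝ → ℂ) (t : ℝ) :
    U t = ((radius ε t ^ α : ℝ) : ℂ) * amplitude α ε U t := by
  have h1 : ((radius ε t ^ α : ℝ) : ℂ) ≠ 0 :=
    Complex.ofReal_ne_zero.2 (Real.rpow_pos_of_pos (radius_pos hε t) α).ne'
  rw [amplitude, radius_rpow_neg]
  push_cast
  field_simp

theorem hasDerivAt_amplitude (hε : 0 < ε) (H : ResonantSystem c ε h a b U um up fm fp v)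
    (ht : t ∈ Ioo a b) :
    HasDerivAt (amplitude α ε U)
      (((radius ε t ^ (-(2 * α)) : ℝ) : ℂ) * wronskian c α ε U um up t
        + ((radius ε t ^ (-α) : ℝ) : ℂ) * defect c ε h um up t) t := by
  have h1 := ((hasDerivAt_radius_rpow hε (-α) t).ofReal_comp).mul (H.deriv t ht)
  refine h1.congr_deriv ?_
  have hw : ((radius ε t ^ α : ℝ) : ℂ) ≠ 0 :=
    Complex.ofReal_ne_zero.2 (Real.rpow_pos_of_pos (radius_pos hε t) α).ne'
  have hr : ((radius ε t : ℝ) : ℂ) ≠ 0 := Complex.ofReal_ne_zero.2 (radius_pos hε t).ne'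
  rw [wronskian, defect, radius_rpow_sub_two hε, radius_rpow_sub_two hε, radius_rpow_neg,
    radius_rpow_neg, radius_rpow_two_mul]
  push_cast
  field_simp
  ring

theorem hasDerivAt_wronskian (hε : 0 < ε) (hα : α * (1 - α) = 2 * c ^ 2)
    (H : ResonantSystem c ε h a b U um up fm fp v) (ht : t ∈ Ioo a b) :
    HasDerivAt (wronskian c α ε U um up)
      (-((couplingDensity α ε t : ℝ) : ℂ) * amplitude α ε U t
        + (c * (radius ε t ^ α : ℝ) : ℂ) * (fm t + fp t)
        - ((α * t * radius ε t ^ (α - 2) : ℝ) : ℂ) * defect c ε h um up t) t := by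
  have h1 := ((hasDerivAt_radius_rpow hε α t).ofReal_comp).mul
    (((H.deriv_um t ht).sub (H.deriv_up t ht)).const_mul (c : ℂ))
  have h2 : HasDerivAt (fun s => α * s * radius ε s ^ (α - 2))
      (α * (radius ε t ^ (α - 2) * (1 + (α - 2) * t ^ 2 / radius ε t ^ 2))) t := by
    have := (hasDerivAt_mul_radius_rpow hε (α - 2) t).const_mul α
    simpa only [mul_assoc] using this
  have h3 := h1.sub (h2.ofReal_comp.mul (H.deriv t ht))
  refine h3.congr_deriv ?_
  have hw : ((radius ε t ^ α : ℝ) : ℂ) ≠ 0 :=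
    Complex.ofReal_ne_zero.2 (Real.rpow_pos_of_pos (radius_pos hε t) α).ne'
  have hr : ((radius ε t : ℝ) : ℂ) ≠ 0 := Complex.ofReal_ne_zero.2 (radius_pos hε t).ne'
  have hsq : (radius ε t : ℂ) ^ 2 = (t : ℂ) ^ 2 + (ε : ℂ) ^ 2 := by
    exact_mod_cast radius_sq ε t
  have hα' : (α : ℂ) * (1 - α) = 2 * (c : ℂ) ^ 2 := by exact_mod_cast hα
  rw [← hsq, couplingDensity, defect, amplitude, radius_rpow_sub_two hε, radius_rpow_sub_four hε,
    radius_rpow_neg, radius_rpow_two_mul]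
  push_cast
  have he : (ε : ℂ) ^ 2 = (radius ε t : ℂ) ^ 2 - (t : ℂ) ^ 2 := by rw [hsq]; ring
  rw [he]
  simp only [Pi.sub_apply]
  field_simp
  linear_combination (U t) * (radius ε t : ℂ) ^ 2 * hα'

end ResonantSystem

end EchoChain

namespace EchoChain

theorem hasDerivAt_rpow_div_radius_sub {ε : ℝ} (hε : 0 < ε) (α t : ℝ) :
    HasDerivAt (fun s => radius ε s ^ α / (radius ε s - s))
      (radius ε t ^ α / radius ε t ^ 2 * ((radius ε t + α * t) / (radius ε t - t))) t := by
  have hr := radius_pos hε t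
  have hs := radius_sub_pos hε t
  have h := (hasDerivAt_radius_rpow hε α t).div
    ((hasDerivAt_radius hε t).sub (hasDerivAt_id t)) hs.ne'
  refine h.congr_deriv ?_
  simp only [Pi.sub_apply, id]
  rw [radius_rpow_sub_two hε]
  field_simp
  ring

theorem radius_le_one {ε t : ℝ} (hε : 0 < ε) (hε' : ε ≤ 1 / 10000) (ht : |t| ≤ 1 / 2) :
    radius ε t ≤ 1 := by
  have h1 := radius_sq ε t
  have h2 : t ^ 2 ≤ 1 / 4 := by
    rw [← sq_abs]; nlinarith [abs_nonneg t]
  have h3 := radius_pos hε t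
  nlinarith

namespace ResonantSystem

variable {ι : Type*} {c α ε h T θ P V A ν t : ℝ} {U um up fm fp : ℝ → ℂ} {v : ι → ℝ → ℂ}

theorem norm_eq_rpow_mul (hε : 0 < ε) (U : ℝ → ℂ) (t : ℝ) :
    ‖U t‖ = radius ε t ^ α * ‖amplitude α ε U t‖ := by
  conv_lhs => rw [eq_rpow_mul_amplitude (α := α) hε U t]
  rw [norm_mul, Complex.norm_real, Real.norm_of_nonneg (Real.rpow_nonneg (radius_pos hε t).le _)]

theorem norm_resonant_force_le (hε : 0 < ε) (hP : ‖amplitude α ε U t‖ ≤ P) :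
    ‖(c : ℂ) / ((t : ℂ) ^ 2 + ε ^ 2) * U t‖ ≤ |c| * P * (radius ε t ^ α / radius ε t ^ 2) := by
  have h1 : ((t : ℂ) ^ 2 + (ε : ℂ) ^ 2) = ((radius ε t ^ 2 : ℝ) : ℂ) := by
    rw [radius_sq]; push_cast; ring
  have hr := radius_pos hε t
  have hw := Real.rpow_pos_of_pos hr α
  rw [h1, norm_mul, norm_div, Complex.norm_real, Complex.norm_real, Real.norm_eq_abs,
    Real.norm_of_nonneg (sq_nonneg _), norm_eq_rpow_mul (α := α) hε]
  calc |c| / radius ε t ^ 2 * (radius ε t ^ α * ‖amplitude α ε U t‖)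
      ≤ |c| / radius ε t ^ 2 * (radius ε t ^ α * P) := by gcongr
    _ = _ := by ring

/-- The neighbours of the resonant mode grow at most like `ρ ^ (α - 1)`. -/
theorem neighbour_bound_before (hp : Params c α ε h)
    (H : ResonantSystem c ε h (-T) 0 U um up fm fp v) (hT : T ≤ 1 / 2)
    (hP : ∀ t ∈ Icc (-T) 0, ‖amplitude α ε U t‖ ≤ P) (hV : ∀ t ∈ Icc (-T) 0, ∀ i, ‖v i t‖ ≤ V)
    (hP0 : 0 ≤ P) (hV0 : 0 ≤ V)
    (hm : ‖um (-T)‖ ≤ θ) (hu : ‖up (-T)‖ ≤ θ) (ht : t ∈ Icc (-T) 0) :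
    ‖um t‖ ≤ θ + 9 / 32 * |c| * V + α / |c| * P * (radius ε t ^ α / (radius ε t - t)) ∧
    ‖up t‖ ≤ θ + 9 / 32 * |c| * V + α / |c| * P * (radius ε t ^ α / (radius ε t - t)) := by
  have hc := hp.c_pos
  have hα := hp.α_pos
  have hε := hp.ε_pos
  have hB : ∀ s, HasDerivAt (fun s => 9 / 16 * |c| * V * s
      + α / |c| * P * (radius ε s ^ α / (radius ε s - s)))
      (9 / 16 * |c| * V + α / |c| * P * (radius ε s ^ α / radius ε s ^ 2
        * ((radius ε s + α * s) / (radius ε s - s)))) s := by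
    intro s
    have h1 := ((hasDerivAt_id s).const_mul (9 / 16 * |c| * V)).add
      ((hasDerivAt_rpow_div_radius_sub hε α s).const_mul (α / |c| * P))
    exact h1.congr_deriv (by simp)
  have hforce : ∀ s ∈ Icc (-T) 0, |c| * P * (radius ε s ^ α / radius ε s ^ 2) ≤
      α / |c| * P * (radius ε s ^ α / radius ε s ^ 2
        * ((radius ε s + α * s) / (radius ε s - s))) := by
    intro s hs
    have hr := radius_pos hε s
    have hw := Real.rpow_pos_of_pos hr α
    have hd := radius_sub_pos hε s
    have h2 : |c| * |c| * (radius ε s - s) ≤ α * (radius ε s + α * s) := by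
      have h3 := hp.root
      rw [← sq_abs] at h3
      have h4 : 0 ≤ α * (1 + α) * (radius ε s + s) := by
        have := neg_le_radius ε s
        exact mul_nonneg (by positivity) (by linarith)
      nlinarith
    have h5 : |c| ≤ α / |c| * ((radius ε s + α * s) / (radius ε s - s)) := by
      rw [div_mul_div_comm, le_div_iff₀ (by positivity)]
      linarith
    calc |c| * P * (radius ε s ^ α / radius ε s ^ 2)
        = |c| * (P * (radius ε s ^ α / radius ε s ^ 2)) := by ring
      _ ≤ α / |c| * ((radius ε s + α * s) / (radius ε s - s))
          * (P * (radius ε s ^ α / radius ε s ^ 2)) := by gcongr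
      _ = _ := by ring
  have hend : ∀ x y : ℝ, x ≤ y + (9 / 16 * |c| * V * t
      + α / |c| * P * (radius ε t ^ α / (radius ε t - t)) - (9 / 16 * |c| * V * (-T)
      + α / |c| * P * (radius ε (-T) ^ α / (radius ε (-T) - -T)))) → y ≤ θ →
      x ≤ θ + 9 / 32 * |c| * V + α / |c| * P * (radius ε t ^ α / (radius ε t - t)) := by
    intro x y hx hy
    have hr := radius_pos hε (-T)
    have hw := Real.rpow_pos_of_pos hr α
    have hd := radius_sub_pos hε (-T)
    have h6 : 0 ≤ α / |c| * P * (radius ε (-T) ^ α / (radius ε (-T) - -T)) := by positivity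
    have h7 : |c| * V * (t + T) ≤ |c| * V * (1 / 2) :=
      mul_le_mul_of_nonneg_left (by linarith [ht.2]) (by positivity)
    linarith
  have hsub : Icc (-T) t ⊆ Icc (-T) 0 := Icc_subset_Icc le_rfl ht.2
  have hsub' : Ioo (-T) t ⊆ Ioo (-T) 0 := Ioo_subset_Ioo le_rfl ht.2
  constructor
  · have h := norm_sub_le_of_norm_deriv_le ht.1 (H.cont_um.mono hsub)
      (fun s hs => H.deriv_um s (hsub' hs)) hB (by
        intro s hs
        have hs' := hsub' hs
        have hs'' := Ioo_subset_Icc_self hs'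
        refine (norm_sub_le _ _).trans (add_le_add (H.fm_le s hs' V (hV s hs'')) ?_)
        exact (norm_resonant_force_le hε (hP s hs'')).trans (hforce s hs''))
    refine hend _ _ ?_ hm
    have := norm_sub_norm_le (um t) (um (-T))
    linarith
  · have h := norm_sub_le_of_norm_deriv_le ht.1 (H.cont_up.mono hsub)
      (fun s hs => H.deriv_up s (hsub' hs)) hB (by
        intro s hs
        have hs' := hsub' hs
        have hs'' := Ioo_subset_Icc_self hs'
        have h1 := (norm_resonant_force_le (c := c) hε (hP s hs'')).trans (hforce s hs'')
        have h2 := H.fp_le s hs' V (hV s hs'')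
        exact (norm_sub_le _ _).trans ((add_le_add h1 h2).trans_eq (add_comm _ _)))
    refine hend _ _ ?_ hu
    have := norm_sub_norm_le (up t) (up (-T))
    linarith

theorem norm_defect_le {w : ℝ} (c ε h t : ℝ) (hm : ‖um t‖ ≤ w) (hu : ‖up t‖ ≤ w) :
    ‖defect c ε h um up t‖
      ≤ |c| * ((|lowerCoeff ε h t - 1| + |upperCoeff ε h t - 1|) * w) := by
  rw [defect, norm_mul, Complex.norm_real, Real.norm_eq_abs]
  refine mul_le_mul_of_nonneg_left ?_ (abs_nonneg c)
  refine (norm_sub_le _ _).trans ?_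
  rw [norm_mul, norm_mul, Complex.norm_real, Complex.norm_real, Real.norm_eq_abs,
    Real.norm_eq_abs, add_mul]
  gcongr

theorem defect_bound_before (hp : Params c α ε h) (hA : 0 ≤ A) (hP : 0 ≤ P) (hTm : (1 + h) * T = 1 / 2)
    (hT : T ≤ 1 / 2) (ht : t ∈ Icc (-T) 0)
    (hm : ‖um t‖ ≤ A + α / |c| * P * (radius ε t ^ α / (radius ε t - t)))
    (hu : ‖up t‖ ≤ A + α / |c| * P * (radius ε t ^ α / (radius ε t - t))) :
    ‖defect c ε h um up t‖ ≤
      (4 - 8 * (1 + h) ^ 2 * t) * (|c| * A * (-t) + 1 / 2 * α * P * radius ε t ^ α)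
        + 9 / 2 * ε * (|c| * A + α * P) := by
  have hc := hp.c_pos
  have hα := hp.α_pos
  have hε := hp.ε_pos
  have hh := hp.h_pos
  have hr := radius_pos hε t
  have hw := Real.rpow_pos_of_pos hr α
  have hd := radius_sub_pos hε t
  have hr1 : radius ε t ≤ 1 := radius_le_one hε hp.ε_le (abs_le.2 ⟨by linarith [ht.1], by linarith [ht.2]⟩)
  have hw1 : radius ε t ^ α ≤ 1 := Real.rpow_le_one hr.le hr1 hα.le
  have ht0 : 0 ≤ -t := by linarith [ht.2]
  obtain ⟨hb, -, -⟩ := coeff_bounds_before (ε := ε) hh hp.h_le ht0 (by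
    calc (1 + h) * -t ≤ (1 + h) * T := by
          apply mul_le_mul_of_nonneg_left <;> linarith [ht.1]
      _ ≤ 1 / 2 := hTm.le)
  rw [neg_neg] at hb
  refine (norm_defect_le c ε h t hm hu).trans ?_
  set w := radius ε t ^ α with hwdef
  set q := w / (radius ε t - t) with hq
  have hq0 : 0 ≤ q := by positivity
  have hq1 : (-t) * q ≤ 1 / 2 * w := by
    rw [hq, ← mul_div_assoc, div_le_iff₀ hd]
    have := neg_le_radius ε t
    nlinarith
  have hq2 : ε ^ 2 * q ≤ ε := by
    rw [hq, ← mul_div_assoc, div_le_iff₀ hd]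
    have := eps_le_radius ε t
    nlinarith [mul_le_mul_of_nonneg_left hw1 (sq_nonneg ε)]
  have hε2 : ε ^ 2 ≤ ε := by nlinarith [hp.ε_le]
  have hcq : |c| * (α / |c| * P * q) = α * P * q := by field_simp
  have h1 : |c| * ((|lowerCoeff ε h t - 1| + |upperCoeff ε h t - 1|) * (A + α / |c| * P * q))
      ≤ (4 * -t + 8 * (1 + h) ^ 2 * (-t) ^ 2 + 9 / 2 * ε ^ 2) * (|c| * A + α * P * q) := by
    calc _ = (|lowerCoeff ε h t - 1| + |upperCoeff ε h t - 1|) * (|c| * A + α * P * q) := by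
          rw [← hcq]; ring
      _ ≤ _ := by gcongr
  refine h1.trans ?_
  have h2 : (4 + 8 * (1 + h) ^ 2 * (-t)) * (α * P) * ((-t) * q)
      ≤ (4 + 8 * (1 + h) ^ 2 * (-t)) * (α * P) * (1 / 2 * w) := by gcongr
  have h3 : 9 / 2 * (|c| * A) * ε ^ 2 ≤ 9 / 2 * (|c| * A) * ε := by gcongr
  have h4 : 9 / 2 * (α * P) * (ε ^ 2 * q) ≤ 9 / 2 * (α * P) * ε := by gcongr
  nlinarith

/-- The total forcing of the Wronskian by other modes and by non-constant coefficients. -/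
theorem forcing_bound_before (hp : Params c α ε h)
    (H : ResonantSystem c ε h (-T) 0 U um up fm fp v) (hTm : (1 + h) * T = 1 / 2)
    (hT : T ≤ 1 / 2) (ht : t ∈ Ioo (-T) 0) (hA : 0 ≤ A) (hP : 0 ≤ P)
    (hV : ∀ i, ‖v i t‖ ≤ V)
    (hd : ‖defect c ε h um up t‖ ≤
      (4 - 8 * (1 + h) ^ 2 * t) * (|c| * A * (-t) + 1 / 2 * α * P * radius ε t ^ α) + ν) :
    ‖(c * (radius ε t ^ α : ℝ) : ℂ) * (fm t + fp t)
        - ((α * t * radius ε t ^ (α - 2) : ℝ) : ℂ) * defect c ε h um up t‖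
      ≤ 9 / 8 * |c| ^ 2 * V + α * |c| * A * (4 - 8 * (1 + h) ^ 2 * t)
        + 10 * α ^ 2 * P * (-1 / 2 * t * radius ε t ^ (-1 / 2 - 2 : ℝ))
        - ν * (α * t * radius ε t ^ (α - 2)) := by
  have hc := hp.c_pos
  have hα := hp.α_pos
  have hα' := hp.α_lt
  have hε := hp.ε_pos
  have hh := hp.h_pos
  have hr := radius_pos hε t
  have hw := Real.rpow_pos_of_pos hr α
  have hr1 : radius ε t ≤ 1 := radius_le_one hε hp.ε_le (abs_le.2 ⟨by linarith [ht.1], by linarith [ht.2]⟩)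
  have hw1 : radius ε t ^ α ≤ 1 := Real.rpow_le_one hr.le hr1 hα.le
  have ht0 : 0 ≤ -t := by linarith [ht.2]
  set R := radius ε t with hR
  set w := R ^ α with hwdef
  have hf : ‖(c * (w : ℝ) : ℂ) * (fm t + fp t)‖ ≤ 9 / 8 * |c| ^ 2 * V := by
    rw [norm_mul, norm_mul, Complex.norm_real, Complex.norm_real, Real.norm_eq_abs,
      Real.norm_of_nonneg hw.le]
    have h1 : ‖fm t + fp t‖ ≤ 9 / 8 * |c| * V := by
      have := norm_add_le (fm t) (fp t)
      have := H.fm_le t ht V hV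
      have := H.fp_le t ht V hV
      linarith
    calc |c| * w * ‖fm t + fp t‖ ≤ |c| * 1 * (9 / 8 * |c| * V) := by gcongr
      _ = _ := by ring
  have e1 : R ^ (α - 2) = w / R ^ 2 := radius_rpow_sub_two hε t α
  have hg : ‖((α * t * R ^ (α - 2) : ℝ) : ℂ) * defect c ε h um up t‖
      ≤ α * |c| * A * (4 - 8 * (1 + h) ^ 2 * t)
        + 10 * α ^ 2 * P * (-1 / 2 * t * R ^ (-1 / 2 - 2 : ℝ)) - ν * (α * t * R ^ (α - 2)) := by
    have hn : ‖((α * t * R ^ (α - 2) : ℝ) : ℂ)‖ = α * (-t) * (w / R ^ 2) := by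
      rw [Complex.norm_real, e1, Real.norm_eq_abs, abs_mul, abs_mul, abs_of_pos hα,
        abs_of_nonpos ht.2.le, abs_of_pos (by positivity)]
    rw [norm_mul, hn]
    have hm5 : 4 - 8 * (1 + h) ^ 2 * t ≤ 10 := by
      have h1 : (1 + h) * -t ≤ 1 / 2 := by
        rw [← hTm]; apply mul_le_mul_of_nonneg_left <;> linarith [ht.1]
      nlinarith [hp.h_le]
    have hm0 : 0 ≤ 4 - 8 * (1 + h) ^ 2 * t := by nlinarith [sq_nonneg (1 + h)]
    have h2 : (-t) ^ 2 * (w / R ^ 2) ≤ 1 := by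
      rw [neg_sq]
      calc t ^ 2 * (w / R ^ 2) = (t ^ 2 / R ^ 2) * w := by ring
        _ ≤ 1 * 1 := by
          gcongr
          exact sq_div_radius_sq_le_one hε t
        _ = 1 := one_mul 1
    have h3 : (w / R ^ 2) * w ≤ R ^ (-1 / 2 - 2 : ℝ) := by
      have : (w / R ^ 2) * w = R ^ (α - 2 + α) := by rw [Real.rpow_add hr, e1]
      rw [this]
      exact Real.rpow_le_rpow_of_exponent_ge hr hr1 (by linarith)
    have h4 : 0 < R ^ (-1 / 2 - 2 : ℝ) := Real.rpow_pos_of_pos hr _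
    calc α * (-t) * (w / R ^ 2) * ‖defect c ε h um up t‖
        ≤ α * (-t) * (w / R ^ 2) * ((4 - 8 * (1 + h) ^ 2 * t) *
            (|c| * A * (-t) + 1 / 2 * α * P * w) + ν) := by gcongr
      _ = α * |c| * A * (4 - 8 * (1 + h) ^ 2 * t) * ((-t) ^ 2 * (w / R ^ 2))
          + 1 / 2 * α ^ 2 * P * (-t) * (4 - 8 * (1 + h) ^ 2 * t) * ((w / R ^ 2) * w)
          - ν * (α * t * (w / R ^ 2)) := by ring
      _ ≤ α * |c| * A * (4 - 8 * (1 + h) ^ 2 * t) * 1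
          + 1 / 2 * α ^ 2 * P * (-t) * 10 * R ^ (-1 / 2 - 2 : ℝ)
          - ν * (α * t * (w / R ^ 2)) := by gcongr
      _ = _ := by rw [e1]; ring
  have := norm_sub_le ((c * (w : ℝ) : ℂ) * (fm t + fp t))
    (((α * t * R ^ (α - 2) : ℝ) : ℂ) * defect c ε h um up t)
  linarith

end ResonantSystem

end EchoChain

namespace EchoChain

/-- Majorant of the Wronskian's forcing before the resonant time. -/
noncomputable def forcingMajorant (κ α ε m A P V ν t : ℝ) : ℝ :=
  9 / 8 * κ ^ 2 * V * t + α * κ * A * (4 * t - 4 * m ^ 2 * t ^ 2)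
    + 10 * α ^ 2 * P * radius ε t ^ (-1 / 2 : ℝ) - ν * radius ε t ^ α

theorem hasDerivAt_forcingMajorant {ε : ℝ} (hε : 0 < ε) (κ α m A P V ν t : ℝ) :
    HasDerivAt (forcingMajorant κ α ε m A P V ν)
      (9 / 8 * κ ^ 2 * V + α * κ * A * (4 - 8 * m ^ 2 * t)
        + 10 * α ^ 2 * P * (-1 / 2 * t * radius ε t ^ (-1 / 2 - 2 : ℝ))
        - ν * (α * t * radius ε t ^ (α - 2))) t := by
  have h1 := (hasDerivAt_id t).const_mul (9 / 8 * κ ^ 2 * V)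
  have h2 : HasDerivAt (fun s : ℝ => 4 * s - 4 * m ^ 2 * s ^ 2) (4 - 8 * m ^ 2 * t) t := by
    refine (((hasDerivAt_id t).const_mul 4).sub
      ((hasDerivAt_pow 2 t).const_mul (4 * m ^ 2))).congr_deriv ?_
    simp; ring
  refine (((h1.add (h2.const_mul (α * κ * A))).add
    ((hasDerivAt_radius_rpow hε (-1 / 2) t).const_mul (10 * α ^ 2 * P))).sub
    ((hasDerivAt_radius_rpow hε α t).const_mul ν)).congr_deriv ?_
  simp

theorem forcingMajorant_sub_le {κ α ε m A P V ν T t : ℝ} (hε : 0 < ε) (hκ : 0 ≤ κ) (hα : 0 ≤ α)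
    (hA : 0 ≤ A) (hP : 0 ≤ P) (hV : 0 ≤ V) (hν : 0 ≤ ν) (hT : T ≤ 1 / 2)
    (hm : m * T = 1 / 2) (hT1 : radius ε (-T) ≤ 1) (ht : t ≤ 0) :
    forcingMajorant κ α ε m A P V ν t - forcingMajorant κ α ε m A P V ν (-T)
      ≤ 9 / 16 * κ ^ 2 * V + 3 * α * κ * A + ν + 10 * α ^ 2 * P * radius ε t ^ (-1 / 2 : ℝ) := by
  have h1 : radius ε (-T) ^ α ≤ 1 := Real.rpow_le_one (radius_pos hε _).le hT1 hα
  have h2 : 0 ≤ radius ε (-T) ^ (-1 / 2 : ℝ) := Real.rpow_nonneg (radius_pos hε _).le _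
  have h3 : 0 ≤ radius ε t ^ α := Real.rpow_nonneg (radius_pos hε _).le _
  have h4 : 4 * T + 4 * m ^ 2 * T ^ 2 ≤ 3 := by
    have : m ^ 2 * T ^ 2 = 1 / 4 := by rw [← mul_pow, hm]; norm_num
    linarith
  have h5 : α * κ * A * (4 * T + 4 * m ^ 2 * T ^ 2) ≤ α * κ * A * 3 := by gcongr
  have h6 : 9 / 8 * κ ^ 2 * V * T ≤ 9 / 8 * κ ^ 2 * V * (1 / 2) := by gcongr
  have h7 : 9 / 8 * κ ^ 2 * V * t ≤ 0 := mul_nonpos_of_nonneg_of_nonpos (by positivity) ht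
  have h8 : α * κ * A * (4 * t - 4 * m ^ 2 * t ^ 2) ≤ 0 := by
    apply mul_nonpos_of_nonneg_of_nonpos (by positivity)
    have : 0 ≤ m ^ 2 * t ^ 2 := by positivity
    linarith
  have h9 : ν * radius ε (-T) ^ α ≤ ν * 1 := by gcongr
  have h10 : 0 ≤ ν * radius ε t ^ α := by positivity
  have h11 : 0 ≤ 10 * α ^ 2 * P * radius ε (-T) ^ (-1 / 2 : ℝ) := by positivity
  unfold forcingMajorant
  rw [neg_sq]
  linarith

theorem couplingDensity_nonneg {α ε : ℝ} (hε : 0 < ε) (hα : 0 ≤ α) (hα' : α ≤ 2) (t : ℝ) :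
    0 ≤ couplingDensity α ε t := by
  have := Real.rpow_nonneg (radius_pos hε t).le (2 * α - 4)
  unfold couplingDensity
  have : 0 ≤ 2 - α := by linarith
  positivity

theorem radius_rpow_two_mul_sub_four {ε : ℝ} (hε : 0 < ε) (α t : ℝ) :
    radius ε t ^ (2 * α - 4) = radius ε t ^ (2 * α - 1) / radius ε t ^ 3 := by
  rw [show 2 * α - 4 = 2 * α - 1 - (3 : ℕ) by push_cast; ring,
    Real.rpow_sub_natCast (radius_pos hε t).ne']

theorem couplingDensity_le {α ε : ℝ} (hε : 0 < ε) (hα : 0 ≤ α) (t : ℝ) :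
    couplingDensity α ε t ≤ 2 * α * (radius ε t ^ (2 * α - 1) * (ε ^ 2 / radius ε t ^ 3)) := by
  have hr := radius_pos hε t
  have h1 := Real.rpow_nonneg hr.le (2 * α - 1)
  rw [couplingDensity, radius_rpow_two_mul_sub_four hε]
  have h2 : 0 ≤ ε ^ 2 * (radius ε t ^ (2 * α - 1) / radius ε t ^ 3) := by positivity
  calc α * (2 - α) * ε ^ 2 * (radius ε t ^ (2 * α - 1) / radius ε t ^ 3)
      = α * (2 - α) * (ε ^ 2 * (radius ε t ^ (2 * α - 1) / radius ε t ^ 3)) := by ring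
    _ ≤ α * 2 * (ε ^ 2 * (radius ε t ^ (2 * α - 1) / radius ε t ^ 3)) := by gcongr; linarith
    _ = _ := by ring

theorem one_add_div_radius_nonneg {ε : ℝ} (hε : 0 < ε) (t : ℝ) : 0 ≤ 1 + t / radius ε t := by
  have h : -1 ≤ t / radius ε t := by
    rw [le_div_iff₀ (radius_pos hε t)]
    linarith [neg_le_radius ε t]
  linarith

/-- Majorant of the contribution of the amplitude to the Wronskian before the resonant time. -/
theorem hasDerivAt_couplingMajorant {ε : ℝ} (hε : 0 < ε) (α t : ℝ) :
    HasDerivAt (fun s => radius ε s ^ (2 * α - 1) * (1 + s / radius ε s))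
      ((2 * α - 1) * t * radius ε t ^ (2 * α - 1 - 2) * (1 + t / radius ε t)
        + radius ε t ^ (2 * α - 1) * (ε ^ 2 / radius ε t ^ 3)) t :=
  (hasDerivAt_radius_rpow hε (2 * α - 1) t).mul ((hasDerivAt_div_radius hε t).const_add 1)

namespace ResonantSystem

variable {ι : Type*} {c α ε h a b T θ P V A ν L t : ℝ} {U um up fm fp : ℝ → ℂ} {v : ι → ℝ → ℂ}

theorem continuousOn_amplitude (hε : 0 < ε) (H : ResonantSystem c ε h a b U um up fm fp v) :
    ContinuousOn (amplitude α ε U) (Icc a b) := by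
  refine ContinuousOn.mul (Continuous.continuousOn ?_) H.cont
  exact Complex.continuous_ofReal.comp
    ((continuous_radius ε).rpow_const fun t => Or.inl (radius_pos hε t).ne')

theorem continuousOn_wronskian (hε : 0 < ε) (H : ResonantSystem c ε h a b U um up fm fp v) :
    ContinuousOn (wronskian c α ε U um up) (Icc a b) := by
  have hc : ∀ x : ℝ, Continuous fun t => radius ε t ^ x := fun x =>
    (continuous_radius ε).rpow_const fun t => Or.inl (radius_pos hε t).ne'
  refine ContinuousOn.sub ?_ ?_
  · exact (Complex.continuous_ofReal.comp (hc α)).continuousOn.mul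
      (continuousOn_const.mul (H.cont_um.sub H.cont_up))
  · exact (Complex.continuous_ofReal.comp
      ((continuous_const.mul continuous_id).mul (hc (α - 2)))).continuousOn.mul H.cont

theorem wronskian_bound_before (hp : Params c α ε h)
    (H : ResonantSystem c ε h (-T) 0 U um up fm fp v) (hTm : (1 + h) * T = 1 / 2)
    (hT0 : 0 ≤ T) (hT : T ≤ 1 / 2) (hA : 0 ≤ A) (hP0 : 0 ≤ P) (hV0 : 0 ≤ V) (hν : 0 ≤ ν)
    (hP : ∀ t ∈ Icc (-T) 0, ‖amplitude α ε U t‖ ≤ P) (hV : ∀ t ∈ Icc (-T) 0, ∀ i, ‖v i t‖ ≤ V)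
    (hd : ∀ t ∈ Icc (-T) 0, ‖defect c ε h um up t‖ ≤
      (4 - 8 * (1 + h) ^ 2 * t) * (|c| * A * (-t) + 1 / 2 * α * P * radius ε t ^ α) + ν)
    (ht : t ∈ Icc (-T) 0) :
    ‖wronskian c α ε U um up t‖ ≤
      ‖wronskian c α ε U um up (-T)‖ + 9 / 16 * |c| ^ 2 * V + 3 * α * |c| * A + ν
      + 2 * α * P * (radius ε t ^ (2 * α - 1) * (1 + t / radius ε t))
      + 10 * α ^ 2 * P * radius ε t ^ (-1 / 2 : ℝ) := by
  have hα := hp.α_pos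
  have hα' := hp.α_lt
  have hε := hp.ε_pos
  have hB : ∀ s, HasDerivAt (fun s => forcingMajorant |c| α ε (1 + h) A P V ν s
      + 2 * α * P * (radius ε s ^ (2 * α - 1) * (1 + s / radius ε s))) _ s := fun s =>
    (hasDerivAt_forcingMajorant hε |c| α (1 + h) A P V ν s).add
      ((hasDerivAt_couplingMajorant hε α s).const_mul (2 * α * P))
  have key := norm_sub_le_of_norm_deriv_le ht.1
    ((H.continuousOn_wronskian (α := α) hε).mono (Icc_subset_Icc le_rfl ht.2))
    (fun s hs => H.hasDerivAt_wronskian hε hp.root (Ioo_subset_Ioo le_rfl ht.2 hs)) hB (by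
      intro s hs
      have hs' : s ∈ Ioo (-T) 0 := Ioo_subset_Ioo le_rfl ht.2 hs
      have hs'' := Ioo_subset_Icc_self hs'
      have h1 := H.forcing_bound_before hp hTm hT hs' hA hP0 (hV s hs'') (hd s hs'')
      have h2 : ‖-((couplingDensity α ε s : ℝ) : ℂ) * amplitude α ε U s‖ ≤
          2 * α * P * ((2 * α - 1) * s * radius ε s ^ (2 * α - 1 - 2) * (1 + s / radius ε s)
            + radius ε s ^ (2 * α - 1) * (ε ^ 2 / radius ε s ^ 3)) := by
        rw [norm_mul, norm_neg, Complex.norm_real,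
          Real.norm_of_nonneg (couplingDensity_nonneg hε hα.le (by linarith) s)]
        have h3 := couplingDensity_le hε hα.le s
        have h4 : 0 ≤ (2 * α - 1) * s * radius ε s ^ (2 * α - 1 - 2) * (1 + s / radius ε s) :=
          mul_nonneg (mul_nonneg (mul_nonneg_of_nonpos_of_nonpos (by linarith) hs'.2.le)
            (Real.rpow_nonneg (radius_pos hε s).le _)) (one_add_div_radius_nonneg hε s)
        calc couplingDensity α ε s * ‖amplitude α ε U s‖
            ≤ 2 * α * (radius ε s ^ (2 * α - 1) * (ε ^ 2 / radius ε s ^ 3)) * P :=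
              mul_le_mul h3 (hP s hs'') (norm_nonneg _)
                ((couplingDensity_nonneg hε hα.le (by linarith) s).trans h3)
          _ = 2 * α * P * (0 + radius ε s ^ (2 * α - 1) * (ε ^ 2 / radius ε s ^ 3)) := by ring
          _ ≤ _ := by gcongr
      rw [add_sub_assoc]
      refine (norm_add_le _ _).trans ?_
      rw [add_comm]
      exact add_le_add h1 h2)
  have h5 := forcingMajorant_sub_le (m := 1 + h) (t := t) hε (abs_nonneg c) hα.le hA hP0 hV0 hν
    hT hTm
    (radius_le_one hε hp.ε_le (by rw [abs_neg, abs_of_nonneg hT0]; exact hT)) ht.2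
  have h6 : 0 ≤ 2 * α * P * (radius ε (-T) ^ (2 * α - 1) * (1 + -T / radius ε (-T))) := by
    have := one_add_div_radius_nonneg hε (-T)
    have := Real.rpow_nonneg (radius_pos hε (-T)).le (2 * α - 1)
    positivity
  have h7 := norm_sub_norm_le (wronskian c α ε U um up t) (wronskian c α ε U um up (-T))
  linarith

end ResonantSystem

/-- Majorant of the variation of the amplitude before the resonant time. -/
noncomputable def amplitudeMajorant (κ α ε m A P ν L t : ℝ) : ℝ :=
  L / (1 - 2 * α) * (t * radius ε t ^ (-(2 * α)))
    + 2 * α * P * (Real.log (radius ε t) - Real.log (radius ε t - t))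
    + (10 * α ^ 2 * P + ν) * (20 / 9) * (t * radius ε t ^ (-(11 / 20) : ℝ))
    + κ * A * (-2 * t ^ 2 + 8 / 3 * m ^ 2 * t ^ 3)
    + (α * κ * A + 1 / 2 * α * P) * (4 * t - 4 * m ^ 2 * t ^ 2)

theorem hasDerivAt_amplitudeMajorant {ε : ℝ} (hε : 0 < ε) (κ α m A P ν L t : ℝ) :
    HasDerivAt (amplitudeMajorant κ α ε m A P ν L)
      (L / (1 - 2 * α) * (radius ε t ^ (-(2 * α)) * (1 + -(2 * α) * t ^ 2 / radius ε t ^ 2))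
        + 2 * α * P * (1 / radius ε t * (1 + t / radius ε t))
        + (10 * α ^ 2 * P + ν) * (20 / 9)
          * (radius ε t ^ (-(11 / 20) : ℝ) * (1 + -(11 / 20) * t ^ 2 / radius ε t ^ 2))
        + (4 - 8 * m ^ 2 * t) * (κ * A * (-t + α) + 1 / 2 * α * P)) t := by
  have hr := radius_pos hε t
  have hd := radius_sub_pos hε t
  have h1 : HasDerivAt (fun s => Real.log (radius ε s) - Real.log (radius ε s - s))
      (1 / radius ε t * (1 + t / radius ε t)) t := by
    refine (((hasDerivAt_radius hε t).log hr.ne').sub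
      (((hasDerivAt_radius hε t).sub (hasDerivAt_id t)).log hd.ne')).congr_deriv ?_
    simp only [Pi.sub_apply, id]
    field_simp
    ring
  have h2 : HasDerivAt (fun s : ℝ => 4 * s - 4 * m ^ 2 * s ^ 2) (4 - 8 * m ^ 2 * t) t := by
    refine (((hasDerivAt_id t).const_mul 4).sub
      ((hasDerivAt_pow 2 t).const_mul (4 * m ^ 2))).congr_deriv ?_
    simp; ring
  have h3 : HasDerivAt (fun s : ℝ => -2 * s ^ 2 + 8 / 3 * m ^ 2 * s ^ 3)
      (-4 * t + 8 * m ^ 2 * t ^ 2) t := by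
    refine (((hasDerivAt_pow 2 t).const_mul (-2)).add
      ((hasDerivAt_pow 3 t).const_mul (8 / 3 * m ^ 2))).congr_deriv ?_
    simp; ring
  refine ((((((hasDerivAt_mul_radius_rpow hε (-(2 * α)) t).const_mul (L / (1 - 2 * α))).add
    (h1.const_mul (2 * α * P))).add
    ((hasDerivAt_mul_radius_rpow hε (-(11 / 20)) t).const_mul
      ((10 * α ^ 2 * P + ν) * (20 / 9)))).add
    (h3.const_mul (κ * A))).add (h2.const_mul (α * κ * A + 1 / 2 * α * P))).congr_deriv ?_
  ring

theorem amplitudeMajorant_zero {ε : ℝ} (κ α m A P ν L : ℝ) :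
    amplitudeMajorant κ α ε m A P ν L 0 = 0 := by
  simp [amplitudeMajorant]

namespace ResonantSystem

variable {ι : Type*} {c α ε h a b T θ P V A ν L t : ℝ} {U um up fm fp : ℝ → ℂ} {v : ι → ℝ → ℂ}

theorem amplitude_deriv_bound_before (hp : Params c α ε h) (hT : T ≤ 1 / 2)
    (hA : 0 ≤ A) (hP0 : 0 ≤ P) (hν : 0 ≤ ν) (hL : 0 ≤ L) (ht : t ∈ Icc (-T) 0)
    (hd : ‖defect c ε h um up t‖ ≤
      (4 - 8 * (1 + h) ^ 2 * t) * (|c| * A * (-t) + 1 / 2 * α * P * radius ε t ^ α) + ν)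
    (hΛ : ‖wronskian c α ε U um up t‖ ≤ L
      + 2 * α * P * (radius ε t ^ (2 * α - 1) * (1 + t / radius ε t))
      + 10 * α ^ 2 * P * radius ε t ^ (-1 / 2 : ℝ)) :
    ‖((radius ε t ^ (-(2 * α)) : ℝ) : ℂ) * wronskian c α ε U um up t
        + ((radius ε t ^ (-α) : ℝ) : ℂ) * defect c ε h um up t‖ ≤
      L / (1 - 2 * α) * (radius ε t ^ (-(2 * α)) * (1 + -(2 * α) * t ^ 2 / radius ε t ^ 2))
        + 2 * α * P * (1 / radius ε t * (1 + t / radius ε t))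
        + (10 * α ^ 2 * P + ν) * (20 / 9)
          * (radius ε t ^ (-(11 / 20) : ℝ) * (1 + -(11 / 20) * t ^ 2 / radius ε t ^ 2))
        + (4 - 8 * (1 + h) ^ 2 * t) * (|c| * A * (-t + α) + 1 / 2 * α * P) := by
  have hα := hp.α_pos
  have hα' := hp.α_lt
  have hε := hp.ε_pos
  have hr := radius_pos hε t
  have hr1 : radius ε t ≤ 1 :=
    radius_le_one hε hp.ε_le (abs_le.2 ⟨by linarith [ht.1], by linarith [ht.2]⟩)
  have ht0 : 0 ≤ -t := by linarith [ht.2]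
  have hγ : 0 < 1 - 2 * α := by linarith
  have hx1 : 0 < radius ε t ^ (-(2 * α)) := Real.rpow_pos_of_pos hr _
  have hx2 : 0 < radius ε t ^ (-α) := Real.rpow_pos_of_pos hr _
  have hx3 : 0 < radius ε t ^ (-(11 / 20) : ℝ) := Real.rpow_pos_of_pos hr _
  have hm0 : 0 ≤ 4 - 8 * (1 + h) ^ 2 * t := by nlinarith [sq_nonneg (1 + h)]
  have e1 : radius ε t ^ (-(2 * α)) * radius ε t ^ (2 * α - 1) = 1 / radius ε t := by
    rw [← Real.rpow_add hr, show -(2 * α) + (2 * α - 1) = (-1 : ℝ) by ring, Real.rpow_neg_one,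
      one_div]
  have e2 : radius ε t ^ (-(2 * α)) * radius ε t ^ (-1 / 2 : ℝ) ≤ radius ε t ^ (-(11 / 20) : ℝ) := by
    rw [← Real.rpow_add hr]
    exact Real.rpow_le_rpow_of_exponent_ge hr hr1 (by linarith)
  have e3 : radius ε t ^ (-α) ≤ radius ε t ^ (-(11 / 20) : ℝ) :=
    Real.rpow_le_rpow_of_exponent_ge hr hr1 (by linarith)
  have e4 : radius ε t ^ (-α) * radius ε t ^ α = 1 := by
    rw [← Real.rpow_add hr, neg_add_cancel, Real.rpow_zero]
  have e5 : radius ε t ^ (-α) * (-t) ≤ -t + α := by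
    have h1 := mul_radius_rpow_neg_le (ε := ε) ht0 hα.le
    have h2 := rpow_one_sub_le ht0 hα.le (by linarith : α ≤ 1)
    rw [radius_neg] at h1
    nlinarith
  have f1 : L * radius ε t ^ (-(2 * α)) ≤
      L / (1 - 2 * α) * (radius ε t ^ (-(2 * α)) * (1 + -(2 * α) * t ^ 2 / radius ε t ^ 2)) := by
    calc L * radius ε t ^ (-(2 * α))
        = L / (1 - 2 * α) * ((1 - 2 * α) * radius ε t ^ (-(2 * α))) := by field_simp
      _ ≤ _ := by
        gcongr ?_ * ?_
        exact mul_radius_rpow_deriv_ge hε (by linarith) t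
  have f2 : (10 * α ^ 2 * P + ν) * radius ε t ^ (-(11 / 20) : ℝ) ≤ (10 * α ^ 2 * P + ν) * (20 / 9)
          * (radius ε t ^ (-(11 / 20) : ℝ) * (1 + -(11 / 20) * t ^ 2 / radius ε t ^ 2)) := by
    have := mul_radius_rpow_deriv_ge (x := 11 / 20) hε (by norm_num) t
    rw [mul_assoc _ (20 / 9 : ℝ)]
    apply mul_le_mul_of_nonneg_left _ (by positivity)
    linarith
  refine (norm_add_le _ _).trans ?_
  rw [norm_mul, norm_mul, Complex.norm_real, Complex.norm_real, Real.norm_of_nonneg hx1.le,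
    Real.norm_of_nonneg hx2.le]
  have g1 : radius ε t ^ (-(2 * α)) * ‖wronskian c α ε U um up t‖ ≤
      L * radius ε t ^ (-(2 * α)) + 2 * α * P * (1 / radius ε t * (1 + t / radius ε t))
        + 10 * α ^ 2 * P * radius ε t ^ (-(11 / 20) : ℝ) := by
    calc radius ε t ^ (-(2 * α)) * ‖wronskian c α ε U um up t‖
        ≤ radius ε t ^ (-(2 * α)) * (L
          + 2 * α * P * (radius ε t ^ (2 * α - 1) * (1 + t / radius ε t))
          + 10 * α ^ 2 * P * radius ε t ^ (-1 / 2 : ℝ)) := by gcongr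
      _ = L * radius ε t ^ (-(2 * α))
          + 2 * α * P * ((radius ε t ^ (-(2 * α)) * radius ε t ^ (2 * α - 1)) * (1 + t / radius ε t))
          + 10 * α ^ 2 * P * (radius ε t ^ (-(2 * α)) * radius ε t ^ (-1 / 2 : ℝ)) := by ring
      _ ≤ _ := by rw [e1]; gcongr
  have g2 : radius ε t ^ (-α) * ‖defect c ε h um up t‖ ≤
      (4 - 8 * (1 + h) ^ 2 * t) * (|c| * A * (-t + α) + 1 / 2 * α * P)
        + ν * radius ε t ^ (-(11 / 20) : ℝ) := by
    calc radius ε t ^ (-α) * ‖defect c ε h um up t‖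
        ≤ radius ε t ^ (-α) * ((4 - 8 * (1 + h) ^ 2 * t) *
            (|c| * A * (-t) + 1 / 2 * α * P * radius ε t ^ α) + ν) := by gcongr
      _ = (4 - 8 * (1 + h) ^ 2 * t) * (|c| * A * (radius ε t ^ (-α) * (-t))
            + 1 / 2 * α * P * (radius ε t ^ (-α) * radius ε t ^ α)) + ν * radius ε t ^ (-α) := by
          ring
      _ ≤ _ := by rw [e4, mul_one]; gcongr
  linarith

theorem amplitude_sub_bound_before (hp : Params c α ε h)
    (H : ResonantSystem c ε h (-T) 0 U um up fm fp v) (hT : T ≤ 1 / 2)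
    (hA : 0 ≤ A) (hP0 : 0 ≤ P) (hν : 0 ≤ ν) (hL : 0 ≤ L)
    (hd : ∀ t ∈ Icc (-T) 0, ‖defect c ε h um up t‖ ≤
      (4 - 8 * (1 + h) ^ 2 * t) * (|c| * A * (-t) + 1 / 2 * α * P * radius ε t ^ α) + ν)
    (hΛ : ∀ t ∈ Icc (-T) 0, ‖wronskian c α ε U um up t‖ ≤ L
      + 2 * α * P * (radius ε t ^ (2 * α - 1) * (1 + t / radius ε t))
      + 10 * α ^ 2 * P * radius ε t ^ (-1 / 2 : ℝ)) {s : ℝ}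
    (hs : s ∈ Icc (-T) 0) (ht : t ∈ Icc (-T) 0) (hst : s ≤ t) :
    ‖amplitude α ε U t - amplitude α ε U s‖ ≤
      amplitudeMajorant |c| α ε (1 + h) A P ν L t
        - amplitudeMajorant |c| α ε (1 + h) A P ν L s :=
  norm_sub_le_of_norm_deriv_le hst
    ((H.continuousOn_amplitude (α := α) hp.ε_pos).mono (Icc_subset_Icc hs.1 ht.2))
    (fun _ hr => H.hasDerivAt_amplitude hp.ε_pos (Ioo_subset_Ioo hs.1 ht.2 hr))
    (fun r => hasDerivAt_amplitudeMajorant hp.ε_pos |c| α (1 + h) A P ν L r)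
    (fun r hr => by
      have hr' := Ioo_subset_Icc_self (Ioo_subset_Ioo hs.1 ht.2 hr)
      exact amplitude_deriv_bound_before hp hT hA hP0 hν hL hr' (hd r hr') (hΛ r hr'))

theorem others_bound_before (hp : Params c α ε h)
    (H : ResonantSystem c ε h (-T) 0 U um up fm fp v) (hT0 : 0 ≤ T) (hT : T ≤ 1 / 2)
    (hA : 0 ≤ A) (hP0 : 0 ≤ P) (hV0 : 0 ≤ V) (hV : ∀ t ∈ Icc (-T) 0, ∀ i, ‖v i t‖ ≤ V)
    (hm : ∀ t ∈ Icc (-T) 0,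
      ‖um t‖ ≤ A + α / |c| * P * (radius ε t ^ α / (radius ε t - t)))
    (hu : ∀ t ∈ Icc (-T) 0,
      ‖up t‖ ≤ A + α / |c| * P * (radius ε t ^ α / (radius ε t - t)))
    (ht : t ∈ Icc (-T) 0) (i : ι) :
    ‖v i t‖ ≤ ‖v i (-T)‖ + 2 * |c| * A + 4 * P * (1 + α) + 9 / 16 * |c| * V := by
  have hc := hp.c_pos
  have hα := hp.α_pos
  have hε := hp.ε_pos
  have hB : ∀ s, HasDerivAt (fun s => (4 * |c| * A + 9 / 8 * |c| * V) * s
      + 4 * P * (α * (s / radius ε s) - radius ε s ^ α))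
      ((4 * |c| * A + 9 / 8 * |c| * V)
        + 4 * P * (α * (ε ^ 2 / radius ε s ^ 3) - α * s * radius ε s ^ (α - 2))) s := fun s =>
    (((hasDerivAt_id s).const_mul (4 * |c| * A + 9 / 8 * |c| * V)).add
      ((((hasDerivAt_div_radius hε s).const_mul α).sub
        (hasDerivAt_radius_rpow hε α s)).const_mul (4 * P))).congr_deriv (by simp)
  choose! d hd hd' using fun s hs => H.deriv_v s hs i
  have key := norm_sub_le_of_norm_deriv_le ht.1
    ((H.cont_v i).mono (Icc_subset_Icc le_rfl ht.2))
    (fun s hs => hd s (Ioo_subset_Ioo le_rfl ht.2 hs)) hB (by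
      intro s hs
      have hs' : s ∈ Ioo (-T) 0 := Ioo_subset_Ioo le_rfl ht.2 hs
      have hs'' := Ioo_subset_Icc_self hs'
      refine (hd' s hs' _ V (hm s hs'') (hu s hs'') (hV s hs'')).trans ?_
      have hr := radius_pos hε s
      have hq := radius_sub_pos hε s
      have hw := Real.rpow_pos_of_pos hr α
      have hr1 : radius ε s ≤ 1 :=
        radius_le_one hε hp.ε_le (abs_le.2 ⟨by linarith [hs'.1], by linarith [hs'.2]⟩)
      have hw1 : radius ε s ^ α ≤ 1 := Real.rpow_le_one hr.le hr1 hα.le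
      rw [radius_rpow_sub_two hε]
      set R := radius ε s with hR
      set w := R ^ α
      have h1 : w / (R - s) ≤ ε ^ 2 / R ^ 3 - s * (w / R ^ 2) := by
        have h2 : ε ^ 2 / R ^ 3 * w ≤ ε ^ 2 / R ^ 3 * 1 := by gcongr
        have h3 : w / (R - s) ≤ w * (ε ^ 2 / R ^ 3 - s / R ^ 2) := by
          rw [div_eq_mul_inv]
          gcongr
          rw [inv_le_iff_one_le_mul₀ hq]
          have h4 : (ε ^ 2 / R ^ 3 - s / R ^ 2) = (R ^ 2 - s ^ 2 - s * R) / R ^ 3 := by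
            field_simp
            linarith [radius_sq ε s]
          rw [h4, div_mul_eq_mul_div, le_div_iff₀ (by positivity), one_mul]
          have h5 : -s ≤ R := neg_le_radius ε s
          have h6 : 0 ≤ -s := by linarith [hs'.2]
          nlinarith [mul_nonneg h6 hr.le, mul_nonneg (mul_nonneg h6 hr.le) (sub_nonneg.2 h5)]
        have h7 : s * (w / R ^ 2) = w * (s / R ^ 2) := by ring
        rw [h7]
        linarith
      have h8 : 4 * |c| * (A + α / |c| * P * (w / (R - s))) + 9 / 8 * |c| * V
          = 4 * |c| * A + 9 / 8 * |c| * V + 4 * P * α * (w / (R - s)) := by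
        field_simp
        ring
      rw [h8]
      have h9 : 4 * P * α * (w / (R - s)) ≤ 4 * P * α * (ε ^ 2 / R ^ 3 - s * (w / R ^ 2)) := by
        gcongr
      linarith)
  have h1 := norm_sub_norm_le (v i t) (v i (-T))
  have hw1 : radius ε (-T) ^ α ≤ 1 := Real.rpow_le_one (radius_pos hε _).le
    (radius_le_one hε hp.ε_le (by rw [abs_neg, abs_of_nonneg hT0]; exact hT)) hα.le
  have hw0 : 0 ≤ radius ε t ^ α := Real.rpow_nonneg (radius_pos hε _).le _
  have h2 : (4 * |c| * A + 9 / 8 * |c| * V) * (t + T)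
      ≤ (4 * |c| * A + 9 / 8 * |c| * V) * (1 / 2) :=
    mul_le_mul_of_nonneg_left (by linarith [ht.2]) (by positivity)
  have h3 : 4 * P * (α * (t / radius ε t) - radius ε t ^ α
      - (α * (-T / radius ε (-T)) - radius ε (-T) ^ α)) ≤ 4 * P * (1 + α) := by
    have h4 : α * (t / radius ε t) ≤ 0 := mul_nonpos_of_nonneg_of_nonpos hα.le
      (div_nonpos_of_nonpos_of_nonneg ht.2 (radius_pos hε t).le)
    have h5 : α * -1 ≤ α * (-T / radius ε (-T)) := by
      have := one_add_div_radius_nonneg hε (-T)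
      gcongr
      linarith
    gcongr
    linarith
  linarith

end ResonantSystem

end EchoChain

namespace EchoChain

/-- The total coupling of the amplitude to the Wronskian up to time `t`. -/
noncomputable def couplingMass (α ε t : ℝ) : ℝ := ∫ s in (0 : ℝ)..t, couplingDensity α ε s

theorem continuous_couplingDensity {ε : ℝ} (hε : 0 < ε) (α : ℝ) :
    Continuous (couplingDensity α ε) :=
  continuous_const.mul
    ((continuous_radius ε).rpow_const fun t => Or.inl (radius_pos hε t).ne')

theorem hasDerivAt_couplingMass {ε : ℝ} (hε : 0 < ε) (α t : ℝ) :
    HasDerivAt (couplingMass α ε) (couplingDensity α ε t) t :=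
  (continuous_couplingDensity hε α).integral_hasStrictDerivAt 0 t |>.hasDerivAt

theorem couplingMass_zero (α ε : ℝ) : couplingMass α ε 0 = 0 := by simp [couplingMass]

theorem couplingMass_neg (α ε t : ℝ) : couplingMass α ε (-t) = -couplingMass α ε t := by
  have h := intervalIntegral.integral_comp_neg (a := 0) (b := t) (couplingDensity α ε)
  have h2 : ∀ s, couplingDensity α ε (-s) = couplingDensity α ε s := fun s => by
    simp [couplingDensity, radius_neg]
  simp only [h2, neg_zero] at h
  rw [couplingMass, couplingMass, h, intervalIntegral.integral_symm]

theorem couplingMass_mono {α ε : ℝ} (hε : 0 < ε) (hα : 0 ≤ α) (hα' : α ≤ 2) :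
    Monotone (couplingMass α ε) :=
  monotone_of_deriv_nonneg (fun t => (hasDerivAt_couplingMass hε α t).differentiableAt)
    (fun t => by
      rw [(hasDerivAt_couplingMass hε α t).deriv]
      exact couplingDensity_nonneg hε hα hα' t)

theorem couplingDensity_mul_le {α ε : ℝ} (hε : 0 < ε) (hε' : ε ≤ 1) (hα : 0 ≤ α)
    (hα' : α ≤ 1 / 4) (t : ℝ) :
    couplingDensity α ε t * radius ε t ^ (1 / 4 : ℝ)
      ≤ 2 * α * ε ^ (-(3 / 4) : ℝ) * (ε ^ 2 / radius ε t ^ 3) := by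
  have hr := radius_pos hε t
  have h1 : radius ε t ^ (2 * α - 1) * radius ε t ^ (1 / 4 : ℝ) ≤ ε ^ (-(3 / 4) : ℝ) := by
    rw [← Real.rpow_add hr]
    calc radius ε t ^ (2 * α - 1 + 1 / 4) ≤ ε ^ (2 * α - 1 + 1 / 4) :=
          Real.rpow_le_rpow_of_nonpos hε (eps_le_radius ε t) (by linarith)
      _ ≤ ε ^ (-(3 / 4) : ℝ) := Real.rpow_le_rpow_of_exponent_ge hε hε' (by linarith)
  have h2 : 0 < radius ε t ^ (1 / 4 : ℝ) := Real.rpow_pos_of_pos hr _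
  calc couplingDensity α ε t * radius ε t ^ (1 / 4 : ℝ)
      ≤ 2 * α * (radius ε t ^ (2 * α - 1) * (ε ^ 2 / radius ε t ^ 3)) * radius ε t ^ (1 / 4 : ℝ) := by
        gcongr; exact couplingDensity_le hε hα t
    _ = 2 * α * (radius ε t ^ (2 * α - 1) * radius ε t ^ (1 / 4 : ℝ)) * (ε ^ 2 / radius ε t ^ 3) := by
        ring
    _ ≤ _ := by gcongr

theorem couplingMass_le {α ε t : ℝ} (hε : 0 < ε) (hα : 0 ≤ α) (hα' : α ≤ 1 / 2) (ht : 0 ≤ t) :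
    couplingMass α ε t ≤ 2 * α * ε ^ (2 * α - 1) := by
  have hB : ∀ s, HasDerivAt (fun s => 2 * α * ε ^ (2 * α - 1) * (s / radius ε s)
      - couplingMass α ε s) (2 * α * ε ^ (2 * α - 1) * (ε ^ 2 / radius ε s ^ 3)
      - couplingDensity α ε s) s := fun s =>
    ((hasDerivAt_div_radius hε s).const_mul _).sub (hasDerivAt_couplingMass hε α s)
  have hmono : Monotone (fun s => 2 * α * ε ^ (2 * α - 1) * (s / radius ε s)
      - couplingMass α ε s) := by
    refine monotone_of_deriv_nonneg (fun s => (hB s).differentiableAt) (fun s => ?_)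
    rw [(hB s).deriv, sub_nonneg]
    refine (couplingDensity_le hε hα s).trans ?_
    have hr := radius_pos hε s
    have h1 : radius ε s ^ (2 * α - 1) ≤ ε ^ (2 * α - 1) :=
      Real.rpow_le_rpow_of_nonpos hε (eps_le_radius ε s) (by linarith)
    calc 2 * α * (radius ε s ^ (2 * α - 1) * (ε ^ 2 / radius ε s ^ 3))
        ≤ 2 * α * (ε ^ (2 * α - 1) * (ε ^ 2 / radius ε s ^ 3)) := by gcongr
      _ = _ := by ring
  have h2 := hmono ht
  simp only [zero_div, mul_zero, couplingMass_zero, sub_zero] at h2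
  have h3 : t / radius ε t ≤ 1 := by
    rw [div_le_one (radius_pos hε t)]; exact le_radius ε t
  have h4 : 2 * α * ε ^ (2 * α - 1) * (t / radius ε t) ≤ 2 * α * ε ^ (2 * α - 1) * 1 := by
    gcongr
  linarith

theorem le_couplingMass {α ε t : ℝ} (hε : 0 < ε) (hα : 0 ≤ α) (hα' : α ≤ 1 / 2) (ht : ε ≤ t) :
    α / 4 * ε ^ (2 * α - 1) ≤ couplingMass α ε t := by
  have hmono : MonotoneOn (fun s => couplingMass α ε s - α / 4 * ε ^ (2 * α - 2) * s)
      (Icc 0 ε) := by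
    have hB : ∀ s, HasDerivAt (fun s => couplingMass α ε s - α / 4 * ε ^ (2 * α - 2) * s)
        (couplingDensity α ε s - α / 4 * ε ^ (2 * α - 2)) s := fun s =>
      ((hasDerivAt_couplingMass hε α s).sub
        ((hasDerivAt_id s).const_mul (α / 4 * ε ^ (2 * α - 2)))).congr_deriv (by simp)
    refine monotoneOn_of_deriv_nonneg (convex_Icc 0 ε)
      (fun s _ => (hB s).continuousAt.continuousWithinAt)
      (fun s _ => (hB s).differentiableAt.differentiableWithinAt) (fun s hs => ?_)
    rw [interior_Icc] at hs
    rw [(hB s).deriv, sub_nonneg]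
    have hr := radius_pos hε s
    have h1 : radius ε s ^ 2 ≤ 2 * ε ^ 2 := by
      rw [radius_sq]; nlinarith [hs.1, hs.2]
    have h2 : radius ε s ^ 4 ≤ 4 * ε ^ 4 := by nlinarith [sq_nonneg (radius ε s)]
    have h3 : ε ^ (2 * α) ≤ radius ε s ^ (2 * α) :=
      Real.rpow_le_rpow hε.le (eps_le_radius ε s) (by linarith)
    have h4 : 0 < ε ^ (2 * α) := Real.rpow_pos_of_pos hε _
    have h5 : ε ^ (2 * α - 2) = ε ^ (2 * α) / ε ^ 2 := by
      rw [Real.rpow_sub hε]; norm_cast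
    rw [couplingDensity, radius_rpow_sub_four hε, h5]
    have h6 : ε ^ (2 * α) / (4 * ε ^ 4) ≤ radius ε s ^ (2 * α) / radius ε s ^ 4 := by gcongr
    calc α / 4 * (ε ^ (2 * α) / ε ^ 2) = α * 1 * ε ^ 2 * (ε ^ (2 * α) / (4 * ε ^ 4)) := by
          field_simp
      _ ≤ α * (2 - α) * ε ^ 2 * (radius ε s ^ (2 * α) / radius ε s ^ 4) := by
          have h7 : 0 ≤ α * (2 - α) * ε ^ 2 :=
            mul_nonneg (mul_nonneg hα (by linarith)) (sq_nonneg ε)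
          gcongr
          linarith
  have h := hmono (left_mem_Icc.2 hε.le) (right_mem_Icc.2 hε.le) hε.le
  simp only [couplingMass_zero, mul_zero, sub_zero] at h
  have h7 : ε ^ (2 * α - 2) * ε = ε ^ (2 * α - 1) := by
    rw [← Real.rpow_add_one hε.ne']; ring_nf
  have h8 := couplingMass_mono (α := α) hε hα (by linarith) ht
  rw [mul_assoc, h7] at h
  linarith

theorem log_radius_sub_le {ε t : ℝ} (hε : 0 < ε) :
    Real.log (radius ε t - t) - Real.log (radius ε t) ≤ Real.log 2 := by
  have hr := radius_pos hε t
  rw [sub_le_iff_le_add, ← Real.log_mul (by norm_num) hr.ne']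
  refine Real.log_le_log (radius_sub_pos hε t) ?_
  linarith [neg_le_radius ε t]

theorem amplitudeMajorant_nonpos {κ α ε m A P ν L t : ℝ} (hε : 0 < ε) (hκ : 0 ≤ κ) (hα : 0 ≤ α)
    (hα' : α < 1 / 2) (hA : 0 ≤ A) (hP : 0 ≤ P) (hν : 0 ≤ ν) (hL : 0 ≤ L) (ht : t ≤ 0) :
    amplitudeMajorant κ α ε m A P ν L t ≤ 0 := by
  have hr := radius_pos hε t
  have h1 : t * radius ε t ^ (-(2 * α)) ≤ 0 :=
    mul_nonpos_of_nonpos_of_nonneg ht (Real.rpow_nonneg hr.le _)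
  have h2 : t * radius ε t ^ (-(11 / 20) : ℝ) ≤ 0 :=
    mul_nonpos_of_nonpos_of_nonneg ht (Real.rpow_nonneg hr.le _)
  have h3 : Real.log (radius ε t) - Real.log (radius ε t - t) ≤ 0 := by
    rw [sub_nonpos]
    exact Real.log_le_log hr (by linarith)
  have h4 : -2 * t ^ 2 + 8 / 3 * m ^ 2 * t ^ 3 ≤ 0 := by
    have : 0 ≤ m ^ 2 * t ^ 2 * (-t) := mul_nonneg (by positivity) (by linarith)
    nlinarith [sq_nonneg t]
  have h5 : 4 * t - 4 * m ^ 2 * t ^ 2 ≤ 0 := by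
    have : 0 ≤ m ^ 2 * t ^ 2 := by positivity
    linarith
  have h6 : 0 ≤ L / (1 - 2 * α) := div_nonneg hL (by linarith)
  have k1 := mul_nonpos_of_nonneg_of_nonpos h6 h1
  have k2 := mul_nonpos_of_nonneg_of_nonpos (by positivity : 0 ≤ 2 * α * P) h3
  have k3 := mul_nonpos_of_nonneg_of_nonpos
    (by positivity : 0 ≤ (10 * α ^ 2 * P + ν) * (20 / 9)) h2
  have k4 := mul_nonpos_of_nonneg_of_nonpos (mul_nonneg hκ hA) h4
  have k5 := mul_nonpos_of_nonneg_of_nonpos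
    (by positivity : 0 ≤ α * κ * A + 1 / 2 * α * P) h5
  unfold amplitudeMajorant
  linarith

theorem neg_amplitudeMajorant_start_le {κ α ε m A P ν L T : ℝ} (hε : 0 < ε) (hκ : 0 ≤ κ)
    (hα : 0 ≤ α) (hα' : α < 1 / 2) (hA : 0 ≤ A) (hP : 0 ≤ P) (hν : 0 ≤ ν) (hL : 0 ≤ L)
    (hT0 : 0 ≤ T) (hT : T ≤ 1 / 2) (hm : m * T = 1 / 2) :
    -amplitudeMajorant κ α ε m A P ν L (-T) ≤ L * (T + 2 * α / (1 - 2 * α))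
      + 2 * α * P * Real.log 2 + (10 * α ^ 2 * P + ν) * (20 / 9) + κ * A * (5 / 6)
      + (α * κ * A + 1 / 2 * α * P) * 3 := by
  have hγ : 0 < 1 - 2 * α := by linarith
  have h1 : T * radius ε (-T) ^ (-(2 * α)) ≤ (1 - 2 * α) * T + 2 * α := by
    rw [radius_neg]
    exact (mul_radius_rpow_neg_le hT0 (by linarith)).trans
      (rpow_one_sub_le hT0 (by linarith) (by linarith))
  have h2 : T * radius ε (-T) ^ (-(11 / 20) : ℝ) ≤ 1 := by
    rw [radius_neg]
    refine (mul_radius_rpow_neg_le hT0 (by norm_num)).trans ?_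
    exact Real.rpow_le_one hT0 (by linarith) (by norm_num)
  have h3 := log_radius_sub_le (t := -T) hε
  have hmT : m ^ 2 * T ^ 2 = 1 / 4 := by rw [← mul_pow, hm]; norm_num
  have h4 : 2 * T ^ 2 + 8 / 3 * m ^ 2 * T ^ 3 ≤ 5 / 6 := by
    have : m ^ 2 * T ^ 3 = 1 / 4 * T := by rw [← hmT]; ring
    nlinarith
  have h5 : 4 * T + 4 * m ^ 2 * T ^ 2 ≤ 3 := by linarith
  have k1 : L / (1 - 2 * α) * (T * radius ε (-T) ^ (-(2 * α)))
      ≤ L * (T + 2 * α / (1 - 2 * α)) := by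
    calc _ ≤ L / (1 - 2 * α) * ((1 - 2 * α) * T + 2 * α) := by gcongr
      _ = _ := by field_simp
  have k2 : 2 * α * P * (Real.log (radius ε (-T) - -T) - Real.log (radius ε (-T)))
      ≤ 2 * α * P * Real.log 2 := by gcongr
  have k3 : (10 * α ^ 2 * P + ν) * (20 / 9) * (T * radius ε (-T) ^ (-(11 / 20) : ℝ))
      ≤ (10 * α ^ 2 * P + ν) * (20 / 9) * 1 := by gcongr
  have k4 : κ * A * (2 * T ^ 2 + 8 / 3 * m ^ 2 * T ^ 3) ≤ κ * A * (5 / 6) := by gcongr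
  have k5 : (α * κ * A + 1 / 2 * α * P) * (4 * T + 4 * m ^ 2 * T ^ 2)
      ≤ (α * κ * A + 1 / 2 * α * P) * 3 := by gcongr
  unfold amplitudeMajorant
  rw [neg_sq, Odd.neg_pow (by decide : Odd 3)]
  linarith

theorem neg_amplitudeMajorant_le {κ α ε m A P ν L T t : ℝ} (hε : 0 < ε) (hκ : 0 ≤ κ)
    (hα : 0 ≤ α) (hα' : α ≤ 1 / 16) (hA : 0 ≤ A) (hP : 0 ≤ P) (hν : 0 ≤ ν) (hL : 0 ≤ L)
    (hT : T ≤ 1 / 2) (hm0 : 0 ≤ m) (hm1 : m ≤ 3 / 2) (hm : m * T = 1 / 2)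
    (ht : t ∈ Icc (-T) 0) (hr1 : radius ε t ≤ 1) :
    -amplitudeMajorant κ α ε m A P ν L t ≤ 2 * α * P * Real.log 2
      + (L / (1 - 2 * α) + (10 * α ^ 2 * P + ν) * (20 / 9) + κ * A * (5 / 3)
        + (α * κ * A + 1 / 2 * α * P) * 7) * radius ε t ^ (1 / 4 : ℝ) := by
  have hγ : 0 < 1 - 2 * α := by linarith
  have hr := radius_pos hε t
  have htr := neg_le_radius ε t
  have ht0 : 0 ≤ -t := by linarith [ht.2]
  have hx : ∀ x : ℝ, x ≤ 3 / 4 → -t * radius ε t ^ (-x) ≤ radius ε t ^ (1 / 4 : ℝ) := by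
    intro x hx
    have h0 : 0 < radius ε t ^ (-x) := Real.rpow_pos_of_pos hr _
    calc -t * radius ε t ^ (-x) ≤ radius ε t * radius ε t ^ (-x) := by gcongr
      _ = radius ε t ^ (1 + -x) := by rw [Real.rpow_add hr, Real.rpow_one]
      _ ≤ _ := Real.rpow_le_rpow_of_exponent_ge hr hr1 (by linarith)
  have h1 := hx (2 * α) (by linarith)
  have h2 := hx (11 / 20) (by norm_num)
  have h0 : -t ≤ radius ε t ^ (1 / 4 : ℝ) := by simpa using hx 0 (by norm_num)
  have h3 := log_radius_sub_le (t := t) hε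
  have hmt : m * -t ≤ 1 / 2 := by
    rw [← hm]; exact mul_le_mul_of_nonneg_left (by linarith [ht.1]) hm0
  have hmt0 : 0 ≤ m * -t := mul_nonneg hm0 ht0
  have hmt2 : (m * -t) ^ 2 ≤ 1 / 4 := by nlinarith
  have h4 : 2 * t ^ 2 - 8 / 3 * m ^ 2 * t ^ 3 ≤ 5 / 3 * radius ε t ^ (1 / 4 : ℝ) := by
    have : 2 * t ^ 2 - 8 / 3 * m ^ 2 * t ^ 3 = -t * (2 * -t + 8 / 3 * (m * -t) ^ 2) := by ring
    rw [this]
    calc _ ≤ -t * (5 / 3) := by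
          apply mul_le_mul_of_nonneg_left _ ht0
          linarith [ht.1]
      _ ≤ _ := by linarith
  have h5 : -(4 * t) + 4 * m ^ 2 * t ^ 2 ≤ 7 * radius ε t ^ (1 / 4 : ℝ) := by
    have : -(4 * t) + 4 * m ^ 2 * t ^ 2 = -t * (4 + 4 * (m * (m * -t))) := by ring
    rw [this]
    calc _ ≤ -t * 7 := by
          apply mul_le_mul_of_nonneg_left _ ht0
          nlinarith
      _ ≤ _ := by linarith
  have k1 : L / (1 - 2 * α) * (-t * radius ε t ^ (-(2 * α)))
      ≤ L / (1 - 2 * α) * radius ε t ^ (1 / 4 : ℝ) := by gcongr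
  have k2 : 2 * α * P * (Real.log (radius ε t - t) - Real.log (radius ε t))
      ≤ 2 * α * P * Real.log 2 := by gcongr
  have k3 : (10 * α ^ 2 * P + ν) * (20 / 9) * (-t * radius ε t ^ (-(11 / 20) : ℝ))
      ≤ (10 * α ^ 2 * P + ν) * (20 / 9) * radius ε t ^ (1 / 4 : ℝ) := by gcongr
  have k4 : κ * A * (2 * t ^ 2 - 8 / 3 * m ^ 2 * t ^ 3)
      ≤ κ * A * (5 / 3 * radius ε t ^ (1 / 4 : ℝ)) := by gcongr
  have k5 : (α * κ * A + 1 / 2 * α * P) * (-(4 * t) + 4 * m ^ 2 * t ^ 2)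
      ≤ (α * κ * A + 1 / 2 * α * P) * (7 * radius ε t ^ (1 / 4 : ℝ)) := by gcongr
  unfold amplitudeMajorant
  linarith

end EchoChain

namespace EchoChain

/-- The numerical closure of the estimates before the resonant time. -/
theorem closure_before {κ α ε θ T P V A ν L L₀ E : ℝ} (hκ : 0 < κ) (hκ' : κ < 1 / 10)
    (hα : 0 < α) (hα' : α < 41 / 2000) (hε : 0 < ε) (hε' : ε ≤ 1 / 10000) (hθ : 0 ≤ θ)
    (hP : 0 ≤ P) (hV : 0 ≤ V) (hT : 1 / 3 ≤ T) (hT' : T ≤ 1 / 2)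
    (hA : A = θ + 9 / 32 * κ * V) (hν : ν = 9 / 2 * ε * (κ * A + α * P))
    (hL₀ : L₀ ≤ 2 * κ * θ + α * θ / T)
    (hL : L = L₀ + 9 / 16 * κ ^ 2 * V + 3 * α * κ * A + ν)
    (hE : E ≤ L * (T + 2 * α / (1 - 2 * α))
      + 2 * α * P * Real.log 2 + (10 * α ^ 2 * P + ν) * (20 / 9) + κ * A * (5 / 6)
      + (α * κ * A + 1 / 2 * α * P) * 3)
    (hPE : P ≤ (1 + 2 * α) * θ + E)
    (hVV : V ≤ θ + 2 * κ * A + 4 * P * (1 + α) + 9 / 16 * κ * V) :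
    P ≤ 141 / 100 * θ ∧ V ≤ 15 / 2 * θ ∧ E ≤ 37 / 100 * θ ∧ L ≤ 2 / 5 * θ ∧
      L / (1 - 2 * α) + (10 * α ^ 2 * P + ν) * (20 / 9) + κ * A * (5 / 3)
        + (α * κ * A + 1 / 2 * α * P) * 7 ≤ θ := by
  have hA0 : 0 ≤ A := by rw [hA]; positivity
  have hγ : 0 < 1 - 2 * α := by linarith
  have hν0 : 0 ≤ ν := by rw [hν]; positivity
  set q := 2 * α / (1 - 2 * α) with hq
  have hq0 : 0 ≤ q := by positivity
  have hq1 : q ≤ 43 / 1000 := by rw [hq, div_le_iff₀ hγ]; linarith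
  have hinv : 1 / (1 - 2 * α) = 1 + q := by rw [hq]; field_simp; ring
  have hLq : L / (1 - 2 * α) = L * (1 + q) := by rw [← hinv]; ring
  have m1 : κ * A ≤ 1 / 10 * A := by gcongr
  have m2 : α * P ≤ 41 / 2000 * P := by gcongr
  have m3 : κ * V ≤ 1 / 10 * V := by gcongr
  have m4 : κ ^ 2 * V ≤ 1 / 100 * V := by
    have : κ ^ 2 ≤ 1 / 100 := (pow_le_pow_left₀ hκ.le hκ'.le 2).trans_eq (by norm_num)
    gcongr
  have m5 : α * κ * A ≤ 41 / 20000 * A := by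
    have : α * κ ≤ 41 / 20000 :=
      (mul_le_mul hα'.le hκ'.le hκ.le (by norm_num)).trans_eq (by norm_num)
    gcongr
  have m6 : α ^ 2 * P ≤ 1681 / 4000000 * P := by
    have : α ^ 2 ≤ 1681 / 4000000 :=
      (pow_le_pow_left₀ hα.le hα'.le 2).trans_eq (by norm_num)
    gcongr
  have m7 : ν ≤ 45 / 100000 * (1 / 10 * A + 41 / 2000 * P) := by
    rw [hν]
    have : 9 / 2 * ε ≤ 45 / 100000 := by linarith only [hε']
    gcongr
  have m8 : α * P * Real.log 2 ≤ 41 / 2000 * P * (6932 / 10000) := by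
    have h1 : Real.log 2 ≤ 6932 / 10000 := by linarith [Real.log_two_lt_d9]
    have h2 : 0 ≤ Real.log 2 := Real.log_nonneg (by norm_num)
    gcongr
  have hdiv : α * θ / T ≤ 3 * α * θ := by
    rw [div_le_iff₀ (by linarith only [hT])]
    have := mul_le_mul_of_nonneg_left hT (by positivity : 0 ≤ 3 * α * θ)
    linarith only [this]
  have hκθ : κ * θ ≤ 1 / 10 * θ := by gcongr
  have hαθ : α * θ ≤ 41 / 2000 * θ := by gcongr
  have hL₀T : L₀ * (T + q) ≤ 133 / 1000 * θ := by
    calc L₀ * (T + q) ≤ (2 * κ * θ + α * θ / T) * (T + q) := by gcongr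
      _ = 2 * (κ * θ) * T + α * θ + (2 * (κ * θ) + α * θ / T) * q := by
        rw [mul_add, add_mul, div_mul_cancel₀ _ (by linarith : T ≠ 0)]
        ring
      _ ≤ 2 * (1 / 10 * θ) * (1 / 2) + 41 / 2000 * θ
          + (2 * (1 / 10 * θ) + 3 * (41 / 2000 * θ)) * (43 / 1000) := by
        have : α * θ / T ≤ 3 * (41 / 2000 * θ) := by linarith only [hdiv, hαθ]
        gcongr
      _ ≤ _ := by linarith only [hθ]
  set M := 9 / 16 * κ ^ 2 * V + 3 * α * κ * A + ν with hM
  have hM0 : 0 ≤ M := by positivity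
  have hMb : M ≤ 9 / 1600 * V + 123 / 20000 * A + ν := by
    rw [hM]; linarith only [m4, m5]
  have hLM : L = L₀ + M := by rw [hL, hM]; ring
  have hMT : M * (T + q) ≤ 543 / 1000 * M := by
    have : T + q ≤ 543 / 1000 := by linarith only [hT', hq1]
    rw [mul_comm]
    gcongr
  have hLT : L * (T + q) ≤ 133 / 1000 * θ + 543 / 1000 * M := by
    rw [hLM, add_mul]; linarith only [hL₀T, hMT]
  have hA' : A ≤ θ + 9 / 320 * V := by rw [hA]; linarith only [m3]
  have hE' : E ≤ 133 / 1000 * θ + 543 / 1000 * (9 / 1600 * V + 123 / 20000 * A + ν)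
      + 284212 / 10000000 * P + (1681 / 400000 * P + ν) * (20 / 9) + 1 / 12 * A
      + (41 / 20000 * A + 41 / 4000 * P) * 3 := by
    linarith only [hE, hLT, hMb, m8, m6, m1, m5, m2]
  have hPE' : P ≤ 1041 / 1000 * θ + E := by linarith only [hPE, hαθ]
  have hVV' : V ≤ θ + 1 / 5 * A + 4 * P + 82 / 1000 * P + 9 / 160 * V := by
    linarith only [hVV, m1, m2, m3]
  have hPb : P ≤ 141 / 100 * θ := by linarith only [hA', hE', hPE', hVV', m7, hθ, hP, hV]
  have hVb : V ≤ 15 / 2 * θ := by linarith only [hA', hVV', hPb, hθ, hP, hV]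
  have hAb : A ≤ 122 / 100 * θ := by linarith only [hA', hVb, hθ]
  have hνb : ν ≤ 1 / 1000 * θ := by linarith only [m7, hPb, hAb, hθ]
  have hEb : E ≤ 37 / 100 * θ := by linarith only [hE', hPb, hVb, hAb, hνb, hθ]
  have hLb : L ≤ 2 / 5 * θ := by
    linarith only [hLM, hMb, hVb, hAb, hνb, hL₀, hdiv, hκθ, hαθ, hθ]
  refine ⟨hPb, hVb, hEb, hLb, ?_⟩
  have hLq' : L * (1 + q) ≤ 2 / 5 * θ * (1043 / 1000) := by
    gcongr
    linarith only [hq1]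
  rw [hLq]
  linarith only [hLq', m6, m1, m5, m2, hPb, hAb, hνb, hθ]

namespace ResonantSystem

variable {ι : Type*} {c α ε h a b T θ t : ℝ} {U um up fm fp : ℝ → ℂ} {v : ι → ℝ → ℂ}

theorem norm_amplitude_start_le (hε : 0 < ε) (hα : 0 ≤ α) (hα' : α ≤ 1) (hT : 1 / 3 ≤ T)
    (hU : ‖U (-T)‖ ≤ θ) : ‖amplitude α ε U (-T)‖ ≤ (1 + 2 * α) * θ := by
  have h1 : radius ε (-T) ^ (-α) ≤ 1 + 2 * α := by
    have h2 : (1 / 3 : ℝ) ≤ radius ε (-T) := by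
      have := neg_le_radius ε (-T); linarith
    calc radius ε (-T) ^ (-α) ≤ (1 / 3 : ℝ) ^ (-α) :=
          Real.rpow_le_rpow_of_nonpos (by norm_num) h2 (by linarith)
      _ = (1 + 2 : ℝ) ^ α := by
          rw [Real.rpow_neg (by norm_num), one_div, Real.inv_rpow (by norm_num), inv_inv]
          norm_num
      _ ≤ 1 + α * 2 := rpow_one_add_le_one_add_mul_self (by norm_num) hα hα'
      _ = _ := by ring
  have h0 : 0 ≤ radius ε (-T) ^ (-α) := Real.rpow_nonneg (radius_pos hε _).le _
  rw [amplitude, norm_mul, Complex.norm_real, Real.norm_of_nonneg h0]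
  gcongr

theorem le_norm_amplitude_start (hε : 0 < ε) (hα : 0 ≤ α) (hr : radius ε (-T) ≤ 1) :
    ‖U (-T)‖ ≤ ‖amplitude α ε U (-T)‖ := by
  have h1 : 1 ≤ radius ε (-T) ^ (-α) :=
    Real.one_le_rpow_of_pos_of_le_one_of_nonpos (radius_pos hε _) hr (by linarith)
  rw [amplitude, norm_mul, Complex.norm_real, Real.norm_of_nonneg (by linarith)]
  exact le_mul_of_one_le_left (norm_nonneg _) h1

theorem norm_wronskian_start_le (hε : 0 < ε) (hα : 0 ≤ α) (hT : 0 < T) (hr : radius ε (-T) ≤ 1)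
    (hU : ‖U (-T)‖ ≤ θ) (hm : ‖um (-T)‖ ≤ θ) (hu : ‖up (-T)‖ ≤ θ) :
    ‖wronskian c α ε U um up (-T)‖ ≤ 2 * |c| * θ + α * θ / T := by
  have hr0 := radius_pos hε (-T)
  have hw := Real.rpow_pos_of_pos hr0 α
  have hw1 : radius ε (-T) ^ α ≤ 1 := Real.rpow_le_one hr0.le hr hα
  have hθ : 0 ≤ θ := (norm_nonneg _).trans hU
  refine (norm_sub_le _ _).trans (add_le_add ?_ ?_)
  · rw [norm_mul, norm_mul, Complex.norm_real, Complex.norm_real, Real.norm_of_nonneg hw.le,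
      Real.norm_eq_abs]
    have h1 : ‖um (-T) - up (-T)‖ ≤ 2 * θ := (norm_sub_le _ _).trans (by linarith)
    calc _ ≤ 1 * (|c| * (2 * θ)) := by gcongr
      _ = _ := by ring
  · rw [norm_mul, Complex.norm_real, Real.norm_eq_abs, abs_mul, abs_mul, abs_of_nonneg hα,
      abs_neg, abs_of_pos hT, radius_rpow_sub_two hε, abs_of_pos (by positivity)]
    have h2 : T * (radius ε (-T) ^ α / radius ε (-T) ^ 2) ≤ 1 / T := by
      rw [le_div_iff₀ hT]
      calc T * (radius ε (-T) ^ α / radius ε (-T) ^ 2) * T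
          = radius ε (-T) ^ α * (T ^ 2 / radius ε (-T) ^ 2) := by ring
        _ ≤ 1 * 1 := by
          gcongr
          rw [radius_neg]
          exact sq_div_radius_sq_le_one hε T
        _ = 1 := one_mul 1
    calc _ = α * (T * (radius ε (-T) ^ α / radius ε (-T) ^ 2)) * ‖U (-T)‖ := by ring
      _ ≤ α * (1 / T) * θ := by gcongr
      _ = _ := by ring

theorem norm_add_bound {V : ℝ} (H : ResonantSystem c ε h a b U um up fm fp v)
    (hV : ∀ t ∈ Icc a b, ∀ i, ‖v i t‖ ≤ V) (ht : t ∈ Icc a b) :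
    ‖um t + up t‖ ≤ ‖um a + up a‖ + 9 / 8 * |c| * V * (t - a) := by
  have key := norm_sub_le_of_norm_deriv_le (f := fun s => um s + up s)
    (f' := fun s => fm s - fp s) (B := fun s => 9 / 8 * |c| * V * s)
    (B' := fun _ => 9 / 8 * |c| * V) ht.1
    ((H.cont_um.add H.cont_up).mono (Icc_subset_Icc le_rfl ht.2))
    (fun s hs => by
      have hs' := Ioo_subset_Ioo le_rfl ht.2 hs
      exact ((H.deriv_um s hs').add (H.deriv_up s hs')).congr_deriv (by ring))
    (fun s => by simpa using (hasDerivAt_id s).const_mul (9 / 8 * |c| * V))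
    (fun s hs => by
      have hs' := Ioo_subset_Ioo le_rfl ht.2 hs
      have h1 := H.fm_le s hs' V (hV s (Ioo_subset_Icc_self hs'))
      have h2 := H.fp_le s hs' V (hV s (Ioo_subset_Icc_self hs'))
      have := norm_sub_le (fm s) (fp s)
      linarith)
  have := norm_sub_norm_le (um t + up t) (um a + up a)
  linarith

/-- The state at the resonant time, in terms of the initial state. -/
theorem estimates_before (hp : Params c α ε h)
    (H : ResonantSystem c ε h (-T) 0 U um up fm fp v) (hTm : (1 + h) * T = 1 / 2)
    (hU : ‖U (-T)‖ ≤ θ) (hU' : θ / 2 ≤ ‖U (-T)‖) (hm : ‖um (-T)‖ ≤ θ) (hu : ‖up (-T)‖ ≤ θ)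
    (hv : ∀ i, ‖v i (-T)‖ ≤ θ) :
    13 / 100 * θ ≤ ‖amplitude α ε U 0‖ ∧ ‖amplitude α ε U 0‖ ≤ 141 / 100 * θ ∧
      (∀ i, ‖v i 0‖ ≤ 15 / 2 * θ) ∧ ‖um 0 + up 0‖ ≤ 13 / 5 * θ ∧
      ‖wronskian c α ε U um up 0 + amplitude α ε U 0 * couplingMass α ε T‖
        ≤ 41 / 1000 * θ * couplingMass α ε T + θ * ε ^ (-(3 / 4) : ℝ) := by
  have hc := hp.c_pos
  have hα := hp.α_pos
  have hα' := hp.α_lt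
  have hε := hp.ε_pos
  have hh := hp.h_pos
  have hh' := hp.h_le
  have hθ : 0 ≤ θ := (norm_nonneg _).trans hU
  have hT3 : 1 / 3 ≤ T := by nlinarith
  have hT0 : 0 ≤ T := by linarith
  have hT2 : T ≤ 1 / 2 := by nlinarith
  have hr1 : ∀ s ∈ Icc (-T) 0, radius ε s ≤ 1 := fun s hs =>
    radius_le_one hε hp.ε_le (abs_le.2 ⟨by linarith [hs.1], by linarith [hs.2]⟩)
  have hstart : -T ∈ Icc (-T) 0 := ⟨le_rfl, by linarith⟩
  have hzero : (0 : ℝ) ∈ Icc (-T) 0 := ⟨by linarith, le_rfl⟩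
  -- the suprema of the amplitude and of the other modes
  obtain ⟨tm, htm, htmax⟩ := isCompact_Icc.exists_isMaxOn ⟨_, hstart⟩
    (H.continuousOn_amplitude (α := α) hε).norm
  obtain ⟨P, hPdef⟩ : ∃ P, P = ‖amplitude α ε U tm‖ := ⟨_, rfl⟩
  have hP : ∀ t ∈ Icc (-T) 0, ‖amplitude α ε U t‖ ≤ P := fun t ht => hPdef ▸ htmax ht
  have hP0 : 0 ≤ P := hPdef ▸ norm_nonneg _
  obtain ⟨B, hB⟩ := H.bounded
  obtain ⟨V, hVdef⟩ : ∃ V, V = ⨆ x : ι × Icc (-T) (0 : ℝ), ‖v x.1 x.2‖ := ⟨_, rfl⟩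
  have hbdd : BddAbove (range fun x : ι × Icc (-T) (0 : ℝ) => ‖v x.1 x.2‖) :=
    ⟨B, by rintro _ ⟨x, rfl⟩; exact hB x.2 x.2.2 x.1⟩
  have hV : ∀ t ∈ Icc (-T) 0, ∀ i, ‖v i t‖ ≤ V := fun t ht i =>
    hVdef ▸ le_ciSup hbdd (i, ⟨t, ht⟩)
  have hV0 : 0 ≤ V := hVdef ▸ Real.iSup_nonneg fun _ => norm_nonneg _
  obtain ⟨A, hA⟩ : ∃ A, A = θ + 9 / 32 * |c| * V := ⟨_, rfl⟩
  obtain ⟨ν, hν⟩ : ∃ ν, ν = 9 / 2 * ε * (|c| * A + α * P) := ⟨_, rfl⟩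
  obtain ⟨L, hL⟩ : ∃ L, L = ‖wronskian c α ε U um up (-T)‖ + 9 / 16 * |c| ^ 2 * V
    + 3 * α * |c| * A + ν := ⟨_, rfl⟩
  have hA0 : 0 ≤ A := by rw [hA]; positivity
  have hν0 : 0 ≤ ν := by rw [hν]; positivity
  have hL0 : 0 ≤ L := by rw [hL]; positivity
  have hn := fun t ht => H.neighbour_bound_before (θ := θ) (t := t) hp hT2 hP hV hP0 hV0 hm hu ht
  rw [← hA] at hn
  have hd : ∀ t ∈ Icc (-T) 0, ‖defect c ε h um up t‖ ≤
      (4 - 8 * (1 + h) ^ 2 * t) * (|c| * A * (-t) + 1 / 2 * α * P * radius ε t ^ α) + ν :=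
    fun t ht => hν ▸ defect_bound_before hp hA0 hP0 hTm hT2 ht (hn t ht).1 (hn t ht).2
  have hΛ : ∀ t ∈ Icc (-T) 0, ‖wronskian c α ε U um up t‖ ≤ L
      + 2 * α * P * (radius ε t ^ (2 * α - 1) * (1 + t / radius ε t))
      + 10 * α ^ 2 * P * radius ε t ^ (-1 / 2 : ℝ) := fun t ht =>
    hL ▸ H.wronskian_bound_before hp hTm hT0 hT2 hA0 hP0 hV0 hν0 hP hV hd ht
  have hsub := fun s t hs ht hst => H.amplitude_sub_bound_before (s := s) (t := t) hp hT2 hA0 hP0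
    hν0 hL0 hd hΛ hs ht hst
  obtain ⟨E, hEdef⟩ : ∃ E, E = -amplitudeMajorant |c| α ε (1 + h) A P ν L (-T) := ⟨_, rfl⟩
  have hE := neg_amplitudeMajorant_start_le (m := 1 + h) hε hc.le hα.le (by linarith) hA0 hP0 hν0
    hL0 hT0 hT2 hTm
  rw [← hEdef] at hE
  have hdist : ∀ t ∈ Icc (-T) 0, ‖amplitude α ε U t - amplitude α ε U (-T)‖ ≤ E := by
    intro t ht
    have h1 := hsub (-T) t hstart ht ht.1
    have h2 := amplitudeMajorant_nonpos (m := 1 + h) hε hc.le hα.le (by linarith) hA0 hP0 hν0 hL0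
      ht.2
    linarith
  have hPE : P ≤ (1 + 2 * α) * θ + E := by
    have h1 := norm_sub_norm_le (amplitude α ε U tm) (amplitude α ε U (-T))
    have h2 := norm_amplitude_start_le hε hα.le (by linarith) hT3 hU
    have h3 := hdist tm htm
    rw [hPdef]
    linarith
  have hVV : V ≤ θ + 2 * |c| * A + 4 * P * (1 + α) + 9 / 16 * |c| * V := by
    conv_lhs => rw [hVdef]
    refine Real.iSup_le (fun x => ?_) (by positivity)
    have h1 := H.others_bound_before hp hT0 hT2 hA0 hP0 hV0 hV (fun t ht => (hn t ht).1)
      (fun t ht => (hn t ht).2) x.2.2 x.1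
    have h2 := hv x.1
    linarith
  have hL₀ := norm_wronskian_start_le (c := c) hε hα.le (by linarith) (hr1 _ hstart) hU hm hu
  obtain ⟨r1, r2, r3, r4, r5⟩ := closure_before hc hp.c_lt hα hα' hε hp.ε_le hθ hP0 hV0 hT3 hT2
    hA hν hL₀ hL hE hPE hVV
  refine ⟨?_, (hP 0 hzero).trans r1, fun i => (hV 0 hzero i).trans r2, ?_, ?_⟩
  · have h1 := norm_sub_norm_le (amplitude α ε U (-T)) (amplitude α ε U 0)
    rw [norm_sub_rev] at h1
    have h2 := hdist 0 hzero
    have h3 := le_norm_amplitude_start (U := U) hε hα.le (hr1 _ hstart)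
    linarith
  · have h1 := H.norm_add_bound hV hzero
    have h2 := norm_add_le (um (-T)) (up (-T))
    have h3 : |c| * V * T ≤ 1 / 10 * (15 / 2 * θ) * (1 / 2) := by
      have := hp.c_lt
      gcongr
    linarith
  · obtain ⟨C, hC⟩ : ∃ C, C = L / (1 - 2 * α) + (10 * α ^ 2 * P + ν) * (20 / 9)
      + |c| * A * (5 / 3) + (α * |c| * A + 1 / 2 * α * P) * 7 := ⟨_, rfl⟩
    rw [← hC] at r5
    have hε34 : 0 < ε ^ (-(3 / 4) : ℝ) := Real.rpow_pos_of_pos hε _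
    have hmaj : ∀ s, HasDerivAt (fun s => 2 * α * P * Real.log 2 * couplingMass α ε s
        + θ * (2 * α * ε ^ (-(3 / 4) : ℝ)) * (s / radius ε s)
        + forcingMajorant |c| α ε (1 + h) A P V ν s) _ s := fun s =>
      (((hasDerivAt_couplingMass hε α s).const_mul (2 * α * P * Real.log 2)).add
        ((hasDerivAt_div_radius hε s).const_mul (θ * (2 * α * ε ^ (-(3 / 4) : ℝ))))).add
        (hasDerivAt_forcingMajorant hε |c| α (1 + h) A P V ν s)
    have hder : ∀ s ∈ Ioo (-T) 0, HasDerivAt (fun s => wronskian c α ε U um up s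
        + amplitude α ε U 0 * couplingMass α ε s) _ s := fun s hs =>
      (H.hasDerivAt_wronskian hε hp.root hs).add
        ((hasDerivAt_couplingMass hε α s).ofReal_comp.const_mul (amplitude α ε U 0))
    have hcont : ContinuousOn (fun s => wronskian c α ε U um up s
        + amplitude α ε U 0 * couplingMass α ε s) (Icc (-T) 0) :=
      (H.continuousOn_wronskian hε).add (continuousOn_const.mul
        (fun s _ => (hasDerivAt_couplingMass hε α s).ofReal_comp.continuousAt.continuousWithinAt))
    have key := norm_sub_le_of_norm_deriv_le (by linarith : -T ≤ 0) hcont hder hmaj (by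
      intro s hs
      have hs' := Ioo_subset_Icc_self hs
      have h1 := H.forcing_bound_before hp hTm hT2 hs hA0 hP0 (hV s hs') (hd s hs')
      have h2 : ‖((couplingDensity α ε s : ℝ) : ℂ) * (amplitude α ε U 0 - amplitude α ε U s)‖
          ≤ 2 * α * P * Real.log 2 * couplingDensity α ε s
            + θ * (2 * α * ε ^ (-(3 / 4) : ℝ)) * (ε ^ 2 / radius ε s ^ 3) := by
        have h3 := couplingDensity_nonneg hε hα.le (by linarith) s
        have h4 := hsub s 0 hs' hzero hs.2.le
        rw [amplitudeMajorant_zero, zero_sub] at h4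
        have h5 := neg_amplitudeMajorant_le (m := 1 + h) (P := P) (A := A) (ν := ν) (L := L) hε
          hc.le hα.le (by linarith) hA0 hP0 hν0 hL0 hT2 (by linarith) (by linarith) hTm hs'
          (hr1 s hs')
        rw [← hC] at h5
        have h6 := couplingDensity_mul_le hε (by linarith [hp.ε_le]) hα.le (by linarith) s
        have h7 : 0 < radius ε s ^ (1 / 4 : ℝ) := Real.rpow_pos_of_pos (radius_pos hε s) _
        rw [norm_mul, Complex.norm_real, Real.norm_of_nonneg h3]
        calc couplingDensity α ε s * ‖amplitude α ε U 0 - amplitude α ε U s‖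
            ≤ couplingDensity α ε s
              * (2 * α * P * Real.log 2 + θ * radius ε s ^ (1 / 4 : ℝ)) := by
              gcongr
              refine (h4.trans h5).trans ?_
              gcongr
          _ = 2 * α * P * Real.log 2 * couplingDensity α ε s
              + θ * (couplingDensity α ε s * radius ε s ^ (1 / 4 : ℝ)) := by ring
          _ ≤ 2 * α * P * Real.log 2 * couplingDensity α ε s
              + θ * (2 * α * ε ^ (-(3 / 4) : ℝ) * (ε ^ 2 / radius ε s ^ 3)) := by gcongr
          _ = _ := by ring
      refine le_trans (le_of_eq ?_) ((norm_add_le _ _).trans (add_le_add h2 h1))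
      congr 1
      ring)
    have hF := forcingMajorant_sub_le (m := 1 + h) (t := 0) hε hc.le hα.le hA0 hP0 hV0 hν0 hT2 hTm
      (hr1 _ hstart) le_rfl
    rw [radius_zero hε] at hF
    simp only [couplingMass_zero, couplingMass_neg, zero_div, mul_zero, Complex.ofReal_zero,
      add_zero, zero_add, Complex.ofReal_neg] at key
    have h8 : ‖wronskian c α ε U um up 0 + amplitude α ε U 0 * couplingMass α ε T‖
        ≤ ‖wronskian c α ε U um up 0 - (wronskian c α ε U um up (-T)
          + amplitude α ε U 0 * -(couplingMass α ε T : ℂ))‖ + ‖wronskian c α ε U um up (-T)‖ := by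
      refine le_trans (le_of_eq ?_) (norm_add_le _ _)
      congr 1
      ring
    have h9 : 2 * α * P * Real.log 2 ≤ 41 / 1000 * θ := by
      have h9 : Real.log 2 ≤ 6932 / 10000 := by linarith [Real.log_two_lt_d9]
      calc 2 * α * P * Real.log 2 ≤ 2 * (41 / 2000) * (141 / 100 * θ) * (6932 / 10000) := by
            gcongr
        _ ≤ _ := by linarith
    have h10 : 0 ≤ couplingMass α ε T := by
      have := couplingMass_mono (α := α) hε hα.le (by linarith) hT0
      rwa [couplingMass_zero] at this
    have h11 : 2 * α * P * Real.log 2 * couplingMass α ε T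
        ≤ 41 / 1000 * θ * couplingMass α ε T := by gcongr
    have h12 : (1 : ℝ) ≤ ε ^ (-(3 / 4) : ℝ) :=
      Real.one_le_rpow_of_pos_of_le_one_of_nonpos hε (by linarith [hp.ε_le]) (by norm_num)
    have h13 : ε ^ (-1 / 2 : ℝ) ≤ ε ^ (-(3 / 4) : ℝ) :=
      Real.rpow_le_rpow_of_exponent_ge hε (by linarith [hp.ε_le]) (by norm_num)
    have h14 : 10 * α ^ 2 * P * ε ^ (-1 / 2 : ℝ) ≤ 1 / 100 * θ * ε ^ (-(3 / 4) : ℝ) := by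
      have : 10 * α ^ 2 * P ≤ 1 / 100 * θ := by
        calc 10 * α ^ 2 * P ≤ 10 * (41 / 2000) ^ 2 * (141 / 100 * θ) := by gcongr
          _ ≤ _ := by linarith
      gcongr
    have h15 : θ * (2 * α * ε ^ (-(3 / 4) : ℝ)) * (-T / radius ε (-T))
        ≥ -(1 / 10 * θ * ε ^ (-(3 / 4) : ℝ)) := by
      have h16 : -1 ≤ -T / radius ε (-T) := by
        have := one_add_div_radius_nonneg hε (-T); linarith
      have h17 : θ * (2 * α * ε ^ (-(3 / 4) : ℝ)) * -1
          ≤ θ * (2 * α * ε ^ (-(3 / 4) : ℝ)) * (-T / radius ε (-T)) := by gcongr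
      have h18 : α * (θ * ε ^ (-(3 / 4) : ℝ)) ≤ 41 / 2000 * (θ * ε ^ (-(3 / 4) : ℝ)) := by gcongr
      have h19 : 0 ≤ θ * ε ^ (-(3 / 4) : ℝ) := by positivity
      linarith
    have h20 : L ≤ 2 / 5 * θ * ε ^ (-(3 / 4) : ℝ) := r4.trans (le_mul_of_one_le_right
      (by positivity) h12)
    have h21 : 0 ≤ θ * ε ^ (-(3 / 4) : ℝ) := by positivity
    rw [hL] at h20
    linarith

end ResonantSystem

end EchoChain

namespace EchoChain

theorem radius_rpow_le {ε x t : ℝ} (hε : 0 < ε) (hε' : ε ≤ 1 / 10000) (ht : |t| ≤ 1)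
    (hx : 0 ≤ x) (hx1 : x ≤ 1) : radius ε t ^ x ≤ 1001 / 1000 := by
  have hr := radius_pos hε t
  have h1 : radius ε t ≤ 1001 / 1000 := by
    have h2 : t ^ 2 ≤ 1 := by rw [← sq_abs]; nlinarith [abs_nonneg t]
    have h3 := radius_sq ε t
    nlinarith
  calc radius ε t ^ x ≤ (1001 / 1000 : ℝ) ^ x := Real.rpow_le_rpow hr.le h1 hx
    _ ≤ (1001 / 1000 : ℝ) ^ (1 : ℝ) := Real.rpow_le_rpow_of_exponent_le (by norm_num) hx1
    _ = _ := Real.rpow_one _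

theorem eps_mul_div_radius_sq_le {ε t : ℝ} (hε : 0 < ε) : ε * t / radius ε t ^ 2 ≤ 1 := by
  rw [div_le_one (pow_pos (radius_pos hε t) 2), radius_sq]
  nlinarith [sq_nonneg (ε - t), sq_nonneg ε, sq_nonneg t]

theorem coeff_weight_after {ε h t : ℝ} (hε : 0 < ε) (hε' : ε ≤ 1 / 10000) (hh : 0 < h)
    (hh' : h ≤ 1 / 2) (ht : 0 ≤ t) (ht' : (1 - h) * t ≤ 1 / 2) :
    |lowerCoeff ε h t - 1| + |upperCoeff ε h t - 1| ≤ 4002 / 1000 ∧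
      (|lowerCoeff ε h t - 1| + |upperCoeff ε h t - 1|) * (t / radius ε t ^ 2) ≤ 8002 / 1000 := by
  obtain ⟨b1, b2, -, -⟩ := coeff_bounds_after (ε := ε) hh hh' ht ht'
  set β := |lowerCoeff ε h t - 1| + |upperCoeff ε h t - 1|
  have hεsq : ε ^ 2 ≤ 1 / 10000 * ε := by
    rw [sq]; gcongr
  refine ⟨by linarith only [b2, hεsq, hε'], ?_⟩
  have e1 := sq_div_radius_sq_le_one hε t
  have e2 := eps_mul_div_radius_sq_le (t := t) hε
  have e3 : 0 ≤ t / radius ε t ^ 2 := div_nonneg ht (sq_nonneg _)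
  have h1 : 0 ≤ 1 - h := by linarith only [hh']
  have h2 : (1 - h) * ((1 - h) * t) ≤ 1 * (1 / 2) :=
    mul_le_mul (by linarith only [hh]) ht' (mul_nonneg h1 ht) zero_le_one
  have e4 : 8 * (1 - h) ^ 2 * t ^ 2 ≤ 4 * t := by
    calc 8 * (1 - h) ^ 2 * t ^ 2 = 8 * t * ((1 - h) * ((1 - h) * t)) := by ring
      _ ≤ 8 * t * (1 * (1 / 2)) := by gcongr
      _ = 4 * t := by ring
  have e5 : β ≤ 8 * t + 9 / 20000 * ε := by linarith only [b1, e4, hεsq]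
  calc β * (t / radius ε t ^ 2) ≤ (8 * t + 9 / 20000 * ε) * (t / radius ε t ^ 2) := by gcongr
    _ = 8 * (t ^ 2 / radius ε t ^ 2) + 9 / 20000 * (ε * t / radius ε t ^ 2) := by ring
    _ ≤ _ := by linarith only [e1, e2]

namespace ResonantSystem

variable {ι : Type*} {c α ε h a b T θ R S V P Q M p₀ t : ℝ} {U um up fm fp : ℝ → ℂ}
  {v : ι → ℝ → ℂ}

theorem mul_sub_eq (hε : 0 < ε) (t : ℝ) :
    (c : ℂ) * (um t - up t) = ((radius ε t ^ (-α) : ℝ) : ℂ) * wronskian c α ε U um up t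
      + ((α * t * radius ε t ^ (α - 2) : ℝ) : ℂ) * amplitude α ε U t := by
  have hw : ((radius ε t ^ α : ℝ) : ℂ) ≠ 0 :=
    Complex.ofReal_ne_zero.2 (Real.rpow_pos_of_pos (radius_pos hε t) α).ne'
  rw [wronskian, amplitude, radius_rpow_neg]
  push_cast
  field_simp
  ring

theorem norm_shear_le (hε : 0 < ε) (hα : 0 ≤ α) (ht : 0 ≤ t) {x : ℂ} (hx : ‖x‖ ≤ P) :
    ‖((α * t * radius ε t ^ (α - 2) : ℝ) : ℂ) * x‖
      ≤ α * t * (radius ε t ^ α / radius ε t ^ 2) * P := by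
  have hr := radius_pos hε t
  have hw := Real.rpow_pos_of_pos hr α
  rw [norm_mul, Complex.norm_real, radius_rpow_sub_two hε, Real.norm_of_nonneg (by positivity)]
  gcongr

theorem norm_neighbours_le (hε : 0 < ε) (hα : 0 ≤ α) (ht : 0 ≤ t)
    (hS : ‖um t + up t‖ ≤ S) (hΛ : ‖wronskian c α ε U um up t‖ ≤ R)
    (hP : ‖amplitude α ε U t‖ ≤ P) :
    |c| * ‖um t‖ ≤ 1 / 2 * (|c| * S + R / radius ε t ^ α
      + α * t * (radius ε t ^ α / radius ε t ^ 2) * P) ∧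
    |c| * ‖up t‖ ≤ 1 / 2 * (|c| * S + R / radius ε t ^ α
      + α * t * (radius ε t ^ α / radius ε t ^ 2) * P) := by
  have hr := radius_pos hε t
  have hw := Real.rpow_pos_of_pos hr α
  have h1 : |c| * ‖um t - up t‖ ≤ R / radius ε t ^ α
      + α * t * (radius ε t ^ α / radius ε t ^ 2) * P := by
    rw [← Real.norm_eq_abs, ← Complex.norm_real, ← norm_mul,
      mul_sub_eq (α := α) (U := U) hε t]
    refine (norm_add_le _ _).trans (add_le_add ?_ (norm_shear_le hε hα ht hP))
    rw [norm_mul, Complex.norm_real, radius_rpow_neg, Real.norm_of_nonneg (by positivity),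
      inv_mul_eq_div]
    gcongr
  have h2 : |c| * ‖um t + up t‖ ≤ |c| * S := by gcongr
  have h3 : ‖um t‖ ≤ 1 / 2 * (‖um t + up t‖ + ‖um t - up t‖) := by
    have h4 := norm_add_le (um t + up t) (um t - up t)
    rw [show um t + up t + (um t - up t) = 2 * um t by ring, norm_mul, Complex.norm_two] at h4
    linarith
  have h3' : ‖up t‖ ≤ 1 / 2 * (‖um t + up t‖ + ‖um t - up t‖) := by
    have h4 := norm_sub_le (um t + up t) (um t - up t)
    rw [show um t + up t - (um t - up t) = 2 * up t by ring, norm_mul, Complex.norm_two] at h4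
    linarith
  constructor
  · calc |c| * ‖um t‖ ≤ |c| * (1 / 2 * (‖um t + up t‖ + ‖um t - up t‖)) := by gcongr
      _ ≤ _ := by linarith
  · calc |c| * ‖up t‖ ≤ |c| * (1 / 2 * (‖um t + up t‖ + ‖um t - up t‖)) := by gcongr
      _ ≤ _ := by linarith

theorem defect_bound_after (hp : Params c α ε h) (ht : 0 ≤ t)
    (hS : ‖um t + up t‖ ≤ S) (hΛ : ‖wronskian c α ε U um up t‖ ≤ R)
    (hP : ‖amplitude α ε U t‖ ≤ P) :
    ‖defect c ε h um up t‖ ≤ (|lowerCoeff ε h t - 1| + |upperCoeff ε h t - 1|)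
      * (1 / 2 * (|c| * S + R / radius ε t ^ α
        + α * t * (radius ε t ^ α / radius ε t ^ 2) * P)) := by
  have hc := hp.c_pos
  obtain ⟨h1, h2⟩ := norm_neighbours_le hp.ε_pos hp.α_pos.le ht hS hΛ hP
  refine (norm_defect_le c ε h t ((le_div_iff₀' hc).2 h1) ((le_div_iff₀' hc).2 h2)).trans_eq ?_
  field_simp

theorem amplitude_sub_bound_after (hp : Params c α ε h)
    (H : ResonantSystem c ε h 0 T U um up fm fp v) (hTm : (1 - h) * T = 1 / 2)
    (hT1 : T ≤ 1) (hR0 : 0 ≤ R) (hS0 : 0 ≤ S) (hP0 : 0 ≤ P)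
    (hS : ∀ t ∈ Icc 0 T, ‖um t + up t‖ ≤ S)
    (hΛ : ∀ t ∈ Icc 0 T, ‖wronskian c α ε U um up t‖ ≤ R)
    (hP : ∀ t ∈ Icc 0 T, ‖amplitude α ε U t‖ ≤ P) (ht : t ∈ Icc 0 T) :
    ‖amplitude α ε U t - amplitude α ε U 0‖ ≤
      (3001 / 1000 * R + 203 / 100 * |c| * S + 41 / 10 * α * P) / (1 - 2 * α)
        * (t * radius ε t ^ (-(2 * α))) := by
  have hα := hp.α_pos
  have hα' := hp.α_lt
  have hε := hp.ε_pos
  have hε' := hp.ε_le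
  have hc := hp.c_pos
  have hγ : 0 < 1 - 2 * α := by linarith
  set N := 3001 / 1000 * R + 203 / 100 * |c| * S + 41 / 10 * α * P with hN
  have hN0 : 0 ≤ N := by positivity
  have key := norm_sub_le_of_norm_deriv_le ht.1
    ((H.continuousOn_amplitude (α := α) hε).mono (Icc_subset_Icc le_rfl ht.2))
    (fun s hs => H.hasDerivAt_amplitude hε (Ioo_subset_Ioo le_rfl ht.2 hs))
    (fun s => (hasDerivAt_mul_radius_rpow hε (-(2 * α)) s).const_mul (N / (1 - 2 * α))) (by
      intro s hs
      have hs' : s ∈ Icc 0 T := Ioo_subset_Icc_self (Ioo_subset_Ioo le_rfl ht.2 hs)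
      have hr := radius_pos hε s
      have hw := Real.rpow_pos_of_pos hr α
      have hg := defect_bound_after hp hs'.1 (hS s hs') (hΛ s hs') (hP s hs')
      have hms : (1 - h) * s ≤ 1 / 2 := by
        rw [← hTm]; exact mul_le_mul_of_nonneg_left hs'.2 (by linarith [hp.h_le])
      obtain ⟨hβ2, hβs⟩ := coeff_weight_after hε hε' hp.h_pos hp.h_le hs'.1 hms
      set β := |lowerCoeff ε h s - 1| + |upperCoeff ε h s - 1|
      have hβ0 : 0 ≤ β := by positivity
      have habs : |s| ≤ 1 := abs_le.2 ⟨by linarith [hs'.1], by linarith [hs'.2]⟩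
      have hw1 : radius ε s ^ α ≤ 1001 / 1000 := radius_rpow_le hε hε' habs hα.le (by linarith)
      have hw2 : radius ε s ^ (2 * α) ≤ 1001 / 1000 :=
        radius_rpow_le hε hε' habs (by linarith) (by linarith)
      rw [radius_rpow_two_mul] at hw2
      have hlow := mul_radius_rpow_deriv_ge (x := 2 * α) hε (by linarith) s
      have hfin : N * radius ε s ^ (-(2 * α)) ≤ N / (1 - 2 * α) * (radius ε s ^ (-(2 * α))
          * (1 + -(2 * α) * s ^ 2 / radius ε s ^ 2)) := by
        calc N * radius ε s ^ (-(2 * α))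
            = N / (1 - 2 * α) * ((1 - 2 * α) * radius ε s ^ (-(2 * α))) := by field_simp
          _ ≤ _ := by gcongr
      refine le_trans ?_ hfin
      refine (norm_add_le _ _).trans ?_
      rw [norm_mul, norm_mul, Complex.norm_real, Complex.norm_real, radius_rpow_neg,
        radius_rpow_neg, radius_rpow_two_mul, Real.norm_of_nonneg (by positivity),
        Real.norm_of_nonneg (by positivity)]
      set w := radius ε s ^ α with hwdef
      have g1 : (w ^ 2)⁻¹ * ‖wronskian c α ε U um up s‖ ≤ (w ^ 2)⁻¹ * R := by
        have := hΛ s hs'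
        gcongr
      have g2 : w⁻¹ * ‖defect c ε h um up s‖ ≤ (w ^ 2)⁻¹ * (β * 1 / 2 * (|c| * S * w + R)
          + 1 / 2 * α * P * (β * (s / radius ε s ^ 2)) * w ^ 2) := by
        calc _ ≤ w⁻¹ * (β * (1 / 2 * (|c| * S + R / w
              + α * s * (w / radius ε s ^ 2) * P))) := by gcongr
          _ = _ := by field_simp
      have g3 : β * 1 / 2 * (|c| * S * w + R)
          + 1 / 2 * α * P * (β * (s / radius ε s ^ 2)) * w ^ 2
          ≤ 4002 / 1000 * 1 / 2 * (|c| * S * (1001 / 1000) + R)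
            + 1 / 2 * α * P * (8002 / 1000) * (1001 / 1000) := by
        gcongr
      have g4 : (w ^ 2)⁻¹ * (β * 1 / 2 * (|c| * S * w + R)
          + 1 / 2 * α * P * (β * (s / radius ε s ^ 2)) * w ^ 2)
          ≤ (w ^ 2)⁻¹ * (4002 / 1000 * 1 / 2 * (|c| * S * (1001 / 1000) + R)
            + 1 / 2 * α * P * (8002 / 1000) * (1001 / 1000)) := by gcongr
      have g5 : R + (4002 / 1000 * 1 / 2 * (|c| * S * (1001 / 1000) + R)
            + 1 / 2 * α * P * (8002 / 1000) * (1001 / 1000)) ≤ N := by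
        have k1 : 0 ≤ |c| * S := by positivity
        have k2 : 0 ≤ α * P := by positivity
        rw [hN]
        linarith
      calc _ ≤ (w ^ 2)⁻¹ * R + (w ^ 2)⁻¹ * (4002 / 1000 * 1 / 2 * (|c| * S * (1001 / 1000) + R)
            + 1 / 2 * α * P * (8002 / 1000) * (1001 / 1000)) := by linarith
        _ = (w ^ 2)⁻¹ * (R + (4002 / 1000 * 1 / 2 * (|c| * S * (1001 / 1000) + R)
            + 1 / 2 * α * P * (8002 / 1000) * (1001 / 1000))) := by ring
        _ ≤ (w ^ 2)⁻¹ * N := by gcongr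
        _ = _ := mul_comm _ _)
  simpa using key

theorem others_bound_after (hp : Params c α ε h)
    (H : ResonantSystem c ε h 0 T U um up fm fp v) (hT1 : T ≤ 1)
    (hR0 : 0 ≤ R) (hS0 : 0 ≤ S) (hV0 : 0 ≤ V) (hQ0 : 0 ≤ Q) (hp₀ : 0 ≤ p₀)
    (hS : ∀ t ∈ Icc 0 T, ‖um t + up t‖ ≤ S)
    (hΛ : ∀ t ∈ Icc 0 T, ‖wronskian c α ε U um up t‖ ≤ R)
    (hV : ∀ t ∈ Icc 0 T, ∀ i, ‖v i t‖ ≤ V)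
    (hP : ∀ t ∈ Icc 0 T, ‖amplitude α ε U t‖ ≤ p₀ + Q * (t * radius ε t ^ (-(2 * α))))
    (ht : t ∈ Icc 0 T) (i : ι) :
    ‖v i t‖ ≤ ‖v i 0‖ + 2 * |c| * S + 2 * (R + α * Q) / (1 - α) + 201 / 100 * p₀
      + 9 / 8 * |c| * V := by
  have hc := hp.c_pos
  have hα := hp.α_pos
  have hα' := hp.α_lt
  have hε := hp.ε_pos
  have hγ : 0 < 1 - α := by linarith
  have hB : ∀ s, HasDerivAt (fun s => (2 * |c| * S + 9 / 8 * |c| * V) * s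
      + 2 * (R + α * Q) / (1 - α) * (s * radius ε s ^ (-α)) + 2 * p₀ * radius ε s ^ α)
      ((2 * |c| * S + 9 / 8 * |c| * V) + 2 * (R + α * Q) / (1 - α)
        * (radius ε s ^ (-α) * (1 + -α * s ^ 2 / radius ε s ^ 2))
        + 2 * p₀ * (α * s * radius ε s ^ (α - 2))) s := fun s =>
    ((((hasDerivAt_id s).const_mul (2 * |c| * S + 9 / 8 * |c| * V)).add
      ((hasDerivAt_mul_radius_rpow hε (-α) s).const_mul (2 * (R + α * Q) / (1 - α)))).add
      ((hasDerivAt_radius_rpow hε α s).const_mul (2 * p₀))).congr_deriv (by simp)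
  choose! d hd hd' using fun s hs => H.deriv_v s hs i
  have key := norm_sub_le_of_norm_deriv_le ht.1
    ((H.cont_v i).mono (Icc_subset_Icc le_rfl ht.2))
    (fun s hs => hd s (Ioo_subset_Ioo le_rfl ht.2 hs)) hB (by
      intro s hs
      have hs' : s ∈ Ioo 0 T := Ioo_subset_Ioo le_rfl ht.2 hs
      have hs'' := Ioo_subset_Icc_self hs'
      have hr := radius_pos hε s
      have hw := Real.rpow_pos_of_pos hr α
      obtain ⟨n1, n2⟩ := norm_neighbours_le hε hα.le hs''.1 (hS s hs'') (hΛ s hs'') (hP s hs'')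
      refine (hd' s hs' _ V ((le_div_iff₀' hc).2 n1) ((le_div_iff₀' hc).2 n2)
        (hV s hs'')).trans ?_
      have hlow := mul_radius_rpow_deriv_ge (x := α) hε hα.le s
      have hfin : 2 * (R + α * Q) * radius ε s ^ (-α) ≤ 2 * (R + α * Q) / (1 - α)
          * (radius ε s ^ (-α) * (1 + -α * s ^ 2 / radius ε s ^ 2)) := by
        calc 2 * (R + α * Q) * radius ε s ^ (-α)
            = 2 * (R + α * Q) / (1 - α) * ((1 - α) * radius ε s ^ (-α)) := by field_simp
          _ ≤ _ := by gcongr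
      rw [radius_rpow_sub_two hε]
      rw [radius_rpow_neg] at hfin ⊢
      rw [radius_rpow_neg, radius_rpow_two_mul]
      set w := radius ε s ^ α with hwdef
      have e1 : 2 * α * Q * w⁻¹ * (s ^ 2 / radius ε s ^ 2) ≤ 2 * α * Q * w⁻¹ * 1 := by
        have := sq_div_radius_sq_le_one hε s
        gcongr
      have e2 : 4 * |c| * (1 / 2 * (|c| * S + R / w + α * s * (w / radius ε s ^ 2)
          * (p₀ + Q * (s * (w ^ 2)⁻¹))) / |c|)
          = 2 * |c| * S + 2 * R * w⁻¹ + 2 * p₀ * (α * s * (w / radius ε s ^ 2))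
            + 2 * α * Q * w⁻¹ * (s ^ 2 / radius ε s ^ 2) := by
        field_simp
        ring
      rw [e2]
      linarith)
  have h1 := norm_sub_norm_le (v i t) (v i 0)
  have ht1 : t ≤ 1 := ht.2.trans hT1
  have h2 : t * radius ε t ^ (-α) ≤ 1 := (mul_radius_rpow_neg_le ht.1 hα.le).trans
    (Real.rpow_le_one ht.1 ht1 hγ.le)
  have h3 : radius ε t ^ α ≤ 1001 / 1000 :=
    radius_rpow_le hε hp.ε_le (abs_le.2 ⟨by linarith [ht.1], ht1⟩) hα.le (by linarith)
  have h4 : (2 * |c| * S + 9 / 8 * |c| * V) * t ≤ (2 * |c| * S + 9 / 8 * |c| * V) * 1 := by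
    gcongr
  have h5 : 2 * (R + α * Q) / (1 - α) * (t * radius ε t ^ (-α))
      ≤ 2 * (R + α * Q) / (1 - α) * 1 := by gcongr
  have h6 : 2 * p₀ * radius ε t ^ α ≤ 2 * p₀ * (1001 / 1000) := by gcongr
  have h7 : 0 ≤ 2 * p₀ * radius ε 0 ^ α := by
    have := Real.rpow_nonneg (radius_pos hε 0).le α
    positivity
  simp only [zero_mul, mul_zero, zero_add] at key
  linarith

end ResonantSystem

end EchoChain

namespace EchoChain

namespace ResonantSystem

variable {ι : Type*} {c α ε h a b T θ R S V P Q M p₀ X t : ℝ} {U um up fm fp : ℝ → ℂ}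
  {v : ι → ℝ → ℂ}

theorem norm_shear_defect_le (hp : Params c α ε h) (hR : 0 ≤ R) (hS0 : 0 ≤ S) (hQ : 0 ≤ Q)
    (hp₀ : 0 ≤ p₀) (ht : 0 ≤ t) (ht1 : t ≤ 1) (ht' : (1 - h) * t ≤ 1 / 2)
    (hS : ‖um t + up t‖ ≤ S) (hΛ : ‖wronskian c α ε U um up t‖ ≤ R)
    (hP : ‖amplitude α ε U t‖ ≤ p₀ + Q * (t * radius ε t ^ (-(2 * α)))) :
    ‖((α * t * radius ε t ^ (α - 2) : ℝ) : ℂ) * defect c ε h um up t‖ ≤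
      α * (1001 / 1000 * |c| * S + R) * (2 + 4 * (1 - h) ^ 2 * t + 9 / 4 * ε)
        + 4001 / 1000 * α ^ 2 * Q
        + 802 / 100 * α ^ 2 * p₀ * ε ^ (-(1 / 2) : ℝ)
          * (1 / 2 * t * radius ε t ^ (1 / 2 - 2 : ℝ)) := by
  have hα := hp.α_pos
  have hα' := hp.α_lt
  have hε := hp.ε_pos
  have hε' := hp.ε_le
  have hr := radius_pos hε t
  have hw := Real.rpow_pos_of_pos hr α
  have habs : |t| ≤ 1 := abs_le.2 ⟨by linarith, ht1⟩
  have hw1 : radius ε t ^ α ≤ 1001 / 1000 := radius_rpow_le hε hε' habs hα.le (by linarith)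
  have hw2 : radius ε t ^ (2 * α) ≤ 1001 / 1000 :=
    radius_rpow_le hε hε' habs (by linarith) (by linarith)
  rw [radius_rpow_two_mul] at hw2
  have hg := defect_bound_after hp ht hS hΛ hP
  obtain ⟨b1, -, -, -⟩ := coeff_bounds_after (ε := ε) hp.h_pos hp.h_le ht ht'
  obtain ⟨-, b2⟩ := coeff_weight_after hε hε' hp.h_pos hp.h_le ht ht'
  rw [radius_rpow_neg, radius_rpow_two_mul] at hg
  refine (norm_shear_le hε hα.le ht hg).trans ?_
  set β := |lowerCoeff ε h t - 1| + |upperCoeff ε h t - 1|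
  have hβ0 : 0 ≤ β := by positivity
  have hρ : t / radius ε t ^ 2 ≤ ε ^ (-(1 / 2) : ℝ) * (t * radius ε t ^ (1 / 2 - 2 : ℝ)) := by
    rw [radius_rpow_sub_two hε]
    have h1 : 1 ≤ ε ^ (-(1 / 2) : ℝ) * radius ε t ^ (1 / 2 : ℝ) := by
      have h2 : ε ^ (1 / 2 : ℝ) ≤ radius ε t ^ (1 / 2 : ℝ) :=
        Real.rpow_le_rpow hε.le (eps_le_radius ε t) (by norm_num)
      have h3 : 0 < ε ^ (1 / 2 : ℝ) := Real.rpow_pos_of_pos hε _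
      rw [Real.rpow_neg hε.le, inv_mul_eq_div, le_div_iff₀ h3, one_mul]
      exact h2
    calc t / radius ε t ^ 2 = 1 * (t / radius ε t ^ 2) := (one_mul _).symm
      _ ≤ ε ^ (-(1 / 2) : ℝ) * radius ε t ^ (1 / 2 : ℝ) * (t / radius ε t ^ 2) := by
        have : 0 ≤ t / radius ε t ^ 2 := by positivity
        gcongr
      _ = _ := by ring
  have e1 := sq_div_radius_sq_le_one hε t
  have e2 := eps_mul_div_radius_sq_le (t := t) hε
  set w := radius ε t ^ α with hwdef
  have hm0 : 0 ≤ (1 - h) ^ 2 * t := by positivity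
  have x1 : β * (t / radius ε t ^ 2) ≤ 2 * (2 + 4 * (1 - h) ^ 2 * t + 9 / 4 * ε) := by
    calc β * (t / radius ε t ^ 2)
        ≤ (4 * t + 8 * (1 - h) ^ 2 * t ^ 2 + 9 / 2 * ε ^ 2) * (t / radius ε t ^ 2) := by
          gcongr
      _ = (4 + 8 * ((1 - h) ^ 2 * t)) * (t ^ 2 / radius ε t ^ 2)
          + 9 / 2 * ε * (ε * t / radius ε t ^ 2) := by ring
      _ ≤ (4 + 8 * ((1 - h) ^ 2 * t)) * 1 + 9 / 2 * ε * 1 := by gcongr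
      _ = _ := by ring
  have hcS : 0 ≤ |c| * S := by positivity
  calc α * t * (w / radius ε t ^ 2) * (β * (1 / 2 * (|c| * S + R / w
        + α * t * (w / radius ε t ^ 2) * (p₀ + Q * (t * (w ^ 2)⁻¹)))))
      = α * (|c| * S * w + R) * (1 / 2 * (β * (t / radius ε t ^ 2)))
        + 1 / 2 * α ^ 2 * Q * (β * (t / radius ε t ^ 2)) * (t ^ 2 / radius ε t ^ 2)
        + 1 / 2 * α ^ 2 * p₀ * (β * (t / radius ε t ^ 2)) * w ^ 2 * (t / radius ε t ^ 2) := by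
        field_simp
        ring
    _ ≤ α * (|c| * S * (1001 / 1000) + R)
          * (1 / 2 * (2 * (2 + 4 * (1 - h) ^ 2 * t + 9 / 4 * ε)))
        + 1 / 2 * α ^ 2 * Q * (8002 / 1000) * 1
        + 1 / 2 * α ^ 2 * p₀ * (8002 / 1000) * (1001 / 1000)
          * (ε ^ (-(1 / 2) : ℝ) * (t * radius ε t ^ (1 / 2 - 2 : ℝ))) := by
        gcongr
    _ ≤ _ := by
        have : 0 ≤ α ^ 2 * p₀ * (ε ^ (-(1 / 2) : ℝ) * (t * radius ε t ^ (1 / 2 - 2 : ℝ))) := by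
          have h1 := Real.rpow_nonneg hε.le (-(1 / 2))
          have h2 := Real.rpow_nonneg hr.le (1 / 2 - 2)
          positivity
        linarith only [this]

theorem wronskian_bound_after (hp : Params c α ε h)
    (H : ResonantSystem c ε h 0 T U um up fm fp v) (hTm : (1 - h) * T = 1 / 2)
    (hT1 : T ≤ 1) (hR : 0 ≤ R) (hS0 : 0 ≤ S) (hV0 : 0 ≤ V) (hQ : 0 ≤ Q) (hp₀ : 0 ≤ p₀)
    (hS : ∀ t ∈ Icc 0 T, ‖um t + up t‖ ≤ S)
    (hΛ : ∀ t ∈ Icc 0 T, ‖wronskian c α ε U um up t‖ ≤ R)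
    (hV : ∀ t ∈ Icc 0 T, ∀ i, ‖v i t‖ ≤ V) (hP₀ : ‖amplitude α ε U 0‖ ≤ p₀)
    (hP : ∀ t ∈ Icc 0 T,
      ‖amplitude α ε U t - amplitude α ε U 0‖ ≤ Q * (t * radius ε t ^ (-(2 * α))))
    (ht : t ∈ Icc 0 T) :
    ‖wronskian c α ε U um up t
        - (wronskian c α ε U um up 0 - amplitude α ε U 0 * couplingMass α ε t)‖ ≤
      α * Q + 113 / 100 * |c| ^ 2 * V + 251 / 100 * α * (1001 / 1000 * |c| * S + R)
        + 4001 / 1000 * α ^ 2 * Q + 9 * α ^ 2 * p₀ * ε ^ (-(1 / 2) : ℝ) := by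
  have hc := hp.c_pos
  have hα := hp.α_pos
  have hα' := hp.α_lt
  have hε := hp.ε_pos
  have hε' := hp.ε_le
  have hε12 : 0 < ε ^ (-(1 / 2) : ℝ) := Real.rpow_pos_of_pos hε _
  set m := 1 - h with hm
  set D := α * (1001 / 1000 * |c| * S + R) with hD
  have hD0 : 0 ≤ D := by positivity
  set K := 802 / 100 * α ^ 2 * p₀ * ε ^ (-(1 / 2) : ℝ) with hK
  have hK0 : 0 ≤ K := by positivity
  have hquad : ∀ s : ℝ, HasDerivAt (fun s : ℝ => 2 * s + 2 * m ^ 2 * s ^ 2 + 9 / 4 * ε * s)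
      (2 + 4 * m ^ 2 * s + 9 / 4 * ε) s := fun s => by
    refine ((((hasDerivAt_id s).const_mul 2).add
      ((hasDerivAt_pow 2 s).const_mul (2 * m ^ 2))).add
      ((hasDerivAt_id s).const_mul (9 / 4 * ε))).congr_deriv ?_
    simp; ring
  have hB : ∀ s, HasDerivAt (fun s => -(α * Q * ε ^ 2) * radius ε s ^ (-2 : ℝ)
      + (113 / 100 * |c| ^ 2 * V + 4001 / 1000 * α ^ 2 * Q) * s
      + D * (2 * s + 2 * m ^ 2 * s ^ 2 + 9 / 4 * ε * s) + K * radius ε s ^ (1 / 2 : ℝ))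
      (-(α * Q * ε ^ 2) * (-2 * s * radius ε s ^ (-2 - 2 : ℝ))
        + (113 / 100 * |c| ^ 2 * V + 4001 / 1000 * α ^ 2 * Q)
        + D * (2 + 4 * m ^ 2 * s + 9 / 4 * ε)
        + K * (1 / 2 * s * radius ε s ^ (1 / 2 - 2 : ℝ))) s := fun s =>
    (((((hasDerivAt_radius_rpow hε (-2) s).const_mul (-(α * Q * ε ^ 2))).add
      ((hasDerivAt_id s).const_mul (113 / 100 * |c| ^ 2 * V + 4001 / 1000 * α ^ 2 * Q))).add
      ((hquad s).const_mul D)).add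
      ((hasDerivAt_radius_rpow hε (1 / 2) s).const_mul K)).congr_deriv (by simp)
  have hder : ∀ s ∈ Ioo 0 T, HasDerivAt (fun s => wronskian c α ε U um up s
      + amplitude α ε U 0 * couplingMass α ε s) _ s := fun s hs =>
    (H.hasDerivAt_wronskian hε hp.root hs).add
      ((hasDerivAt_couplingMass hε α s).ofReal_comp.const_mul (amplitude α ε U 0))
  have hcont : ContinuousOn (fun s => wronskian c α ε U um up s
      + amplitude α ε U 0 * couplingMass α ε s) (Icc 0 T) :=
    (H.continuousOn_wronskian hε).add (continuousOn_const.mul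
      (fun s _ => (hasDerivAt_couplingMass hε α s).ofReal_comp.continuousAt.continuousWithinAt))
  have key := norm_sub_le_of_norm_deriv_le ht.1 (hcont.mono (Icc_subset_Icc le_rfl ht.2))
    (fun s hs => hder s (Ioo_subset_Ioo le_rfl ht.2 hs)) hB (by
      intro s hs
      have hs' : s ∈ Ioo 0 T := Ioo_subset_Ioo le_rfl ht.2 hs
      have hs'' := Ioo_subset_Icc_self hs'
      have hr := radius_pos hε s
      have hw := Real.rpow_pos_of_pos hr α
      have habs : |s| ≤ 1 := abs_le.2 ⟨by linarith [hs'.1], by linarith [hs'.2]⟩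
      have hms : (1 - h) * s ≤ 1 / 2 := by
        rw [← hTm]; exact mul_le_mul_of_nonneg_left hs''.2 (by linarith [hp.h_le])
      have h1 : ‖((couplingDensity α ε s : ℝ) : ℂ) * (amplitude α ε U 0 - amplitude α ε U s)‖
          ≤ -(α * Q * ε ^ 2) * (-2 * s * radius ε s ^ (-2 - 2 : ℝ)) := by
        have h3 := couplingDensity_nonneg hε hα.le (by linarith) s
        have h4 := hP s hs''
        rw [norm_sub_rev] at h4
        have h5 : radius ε s ^ (-2 - 2 : ℝ) = (radius ε s ^ 4)⁻¹ := by
          rw [show (-2 - 2 : ℝ) = -(4 : ℕ) by norm_num, Real.rpow_neg hr.le, Real.rpow_natCast]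
        rw [norm_mul, Complex.norm_real, Real.norm_of_nonneg h3, h5]
        have hs0 := hs'.1
        calc couplingDensity α ε s * ‖amplitude α ε U 0 - amplitude α ε U s‖
            ≤ couplingDensity α ε s * (Q * (s * radius ε s ^ (-(2 * α)))) := by gcongr
          _ = α * (2 - α) * (Q * s * (ε ^ 2 / radius ε s ^ 4)) := by
            rw [couplingDensity, radius_rpow_sub_four hε, radius_rpow_neg, radius_rpow_two_mul]
            field_simp
          _ ≤ α * 2 * (Q * s * (ε ^ 2 / radius ε s ^ 4)) := by
            gcongr
            linarith only [hα]
          _ = _ := by ring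
      have h2 : ‖(c * (radius ε s ^ α : ℝ) : ℂ) * (fm s + fp s)‖ ≤ 113 / 100 * |c| ^ 2 * V := by
        have hw1 : radius ε s ^ α ≤ 1001 / 1000 :=
          radius_rpow_le hε hε' habs hα.le (by linarith)
        have hf : ‖fm s + fp s‖ ≤ 9 / 8 * |c| * V := by
          have := norm_add_le (fm s) (fp s)
          have := H.fm_le s hs' V (hV s hs'')
          have := H.fp_le s hs' V (hV s hs'')
          linarith
        rw [norm_mul, norm_mul, Complex.norm_real, Complex.norm_real, Real.norm_eq_abs,
          Real.norm_of_nonneg hw.le]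
        have : 0 ≤ |c| ^ 2 * V := by positivity
        calc |c| * radius ε s ^ α * ‖fm s + fp s‖
            ≤ |c| * (1001 / 1000) * (9 / 8 * |c| * V) := by gcongr
          _ ≤ _ := by linarith only [this]
      have h3 := norm_shear_defect_le hp hR hS0 hQ hp₀ hs''.1 (hs''.2.trans hT1) hms (hS s hs'')
        (hΛ s hs'') (by
          have h4 := hP s hs''
          have h5 := norm_sub_norm_le (amplitude α ε U s) (amplitude α ε U 0)
          linarith)
      rw [← hm, ← hD, ← hK] at h3
      have h4 := norm_sub_le (((couplingDensity α ε s : ℝ) : ℂ)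
          * (amplitude α ε U 0 - amplitude α ε U s) + (c * (radius ε s ^ α : ℝ) : ℂ) * (fm s + fp s))
        (((α * s * radius ε s ^ (α - 2) : ℝ) : ℂ) * defect c ε h um up s)
      have h5 := norm_add_le (((couplingDensity α ε s : ℝ) : ℂ)
          * (amplitude α ε U 0 - amplitude α ε U s)) ((c * (radius ε s ^ α : ℝ) : ℂ) * (fm s + fp s))
      refine le_trans (le_of_eq ?_) (h4.trans ?_)
      · congr 1
        ring
      · exact ((add_le_add_left h5 _).trans (add_le_add (add_le_add h1 h2) h3)).trans_eq (by ring))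
  have hr := radius_pos hε t
  have ht0 := ht.1
  have ht1 : t ≤ 1 := ht.2.trans hT1
  have habs : |t| ≤ 1 := abs_le.2 ⟨by linarith, ht1⟩
  have f1 : 0 ≤ α * Q * ε ^ 2 * radius ε t ^ (-2 : ℝ) := by
    have := Real.rpow_nonneg hr.le (-2)
    positivity
  have f2 : α * Q * ε ^ 2 * radius ε 0 ^ (-2 : ℝ) = α * Q := by
    rw [radius_zero hε, Real.rpow_neg hε.le, Real.rpow_two]
    field_simp
  have f3 : (113 / 100 * |c| ^ 2 * V + 4001 / 1000 * α ^ 2 * Q) * t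
      ≤ (113 / 100 * |c| ^ 2 * V + 4001 / 1000 * α ^ 2 * Q) * 1 := by gcongr
  have f4 : D * (2 * t + 2 * m ^ 2 * t ^ 2 + 9 / 4 * ε * t) ≤ D * (251 / 100) := by
    have hmt : m * t ≤ 1 / 2 := by
      rw [← hTm]; exact mul_le_mul_of_nonneg_left ht.2 (by linarith [hp.h_le])
    have hmt0 : 0 ≤ m * t := mul_nonneg (by linarith [hp.h_le]) ht0
    have hmt2 : (m * t) ^ 2 ≤ (1 / 2) ^ 2 := pow_le_pow_left₀ hmt0 hmt 2
    have hεt : ε * t ≤ 1 / 10000 * 1 := by gcongr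
    gcongr
    linarith
  have f5 : K * radius ε t ^ (1 / 2 : ℝ) ≤ K * (1001 / 1000) := by
    have := radius_rpow_le (x := 1 / 2) hε hε' habs (by norm_num) (by norm_num)
    gcongr
  have f6 : 0 ≤ K * radius ε 0 ^ (1 / 2 : ℝ) := by
    have := Real.rpow_nonneg (radius_pos hε 0).le (1 / 2)
    positivity
  have f7 : K * (1001 / 1000) ≤ 9 * α ^ 2 * p₀ * ε ^ (-(1 / 2) : ℝ) := by
    have : 0 ≤ α ^ 2 * p₀ * ε ^ (-(1 / 2) : ℝ) := by positivity
    rw [hK]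
    linarith only [this]
  have heq : wronskian c α ε U um up t
      - (wronskian c α ε U um up 0 - amplitude α ε U 0 * couplingMass α ε t)
      = wronskian c α ε U um up t + amplitude α ε U 0 * couplingMass α ε t
        - (wronskian c α ε U um up 0 + amplitude α ε U 0 * couplingMass α ε 0) := by
    rw [couplingMass_zero]; push_cast; ring
  rw [heq]
  refine key.trans ?_
  have f8 : 251 / 100 * α * (1001 / 1000 * |c| * S + R) = D * (251 / 100) := by rw [hD]; ring
  rw [f8]
  simp only [mul_zero, ne_eq, OfNat.ofNat_ne_zero, not_false_eq_true, zero_pow, add_zero]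
  linarith only [f1, f2, f3, f4, f5, f6, f7]

end ResonantSystem

/-- The numerical closure of the estimates after the resonant time. -/
theorem closure_after {κ α θ τ R S S₀ V V₀ P Q p₀ X E : ℝ} (hκ : 0 < κ) (hκ' : κ < 1 / 10)
    (hα : 0 < α) (hα' : α < 41 / 2000) (hR : 0 ≤ R) (hS : 0 ≤ S) (hV : 0 ≤ V) (hP : 0 ≤ P)
    (hθ : 0 ≤ θ) (hp0 : 0 ≤ p₀)
    (hp₀ : p₀ ≤ 141 / 100 * θ) (hS₀ : S₀ ≤ 13 / 5 * θ) (hV₀ : V₀ ≤ 15 / 2 * θ)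
    (hθX : θ ≤ X / 1000) (hτ : 0 ≤ τ) (hτX : θ * τ ≤ X / 1000)
    (hSS : S = S₀ + 9 / 8 * κ * V)
    (hQ : Q = (3001 / 1000 * R + 203 / 100 * κ * S + 41 / 10 * α * P) / (1 - 2 * α))
    (hPQ : P ≤ p₀ + Q)
    (hE : E = α * Q + 113 / 100 * κ ^ 2 * V + 251 / 100 * α * (1001 / 1000 * κ * S + R)
        + 4001 / 1000 * α ^ 2 * Q + 9 * α ^ 2 * p₀ * τ)
    (hRE : R ≤ X + E)
    (hVV : V ≤ V₀ + 2 * κ * S + 2 * (R + α * Q) / (1 - α) + 201 / 100 * p₀ + 9 / 8 * κ * V) :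
    R ≤ 122 / 100 * X ∧ E ≤ 22 / 100 * X ∧ V ≤ 7 / 2 * X ∧ S ≤ 2 / 5 * X ∧ P ≤ 9 / 2 * X := by
  have hγ : 0 < 1 - 2 * α := by linarith
  have hγ' : 0 < 1 - α := by linarith
  have hQ0 : 0 ≤ Q := by rw [hQ]; positivity
  have hX : 0 ≤ X := by linarith
  have m1 : κ * S ≤ 1 / 10 * S := by gcongr
  have m2 : α * P ≤ 41 / 2000 * P := by gcongr
  have m3 : κ * V ≤ 1 / 10 * V := by gcongr
  have m4 : κ ^ 2 * V ≤ 1 / 100 * V := by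
    have : κ ^ 2 ≤ 1 / 100 := (pow_le_pow_left₀ hκ.le hκ'.le 2).trans_eq (by norm_num)
    gcongr
  have m5 : α * Q ≤ 41 / 2000 * Q := by gcongr
  have hα2 : α ^ 2 ≤ 1681 / 4000000 :=
    (pow_le_pow_left₀ hα.le hα'.le 2).trans_eq (by norm_num)
  have m6 : α ^ 2 * Q ≤ 1681 / 4000000 * Q := by gcongr
  have m7 : α * (1001 / 1000 * κ * S + R) ≤ 41 / 2000 * (1001 / 10000 * S + R) := by
    gcongr
    linarith only [hκ']
  have m8 : α ^ 2 * p₀ * τ ≤ 1 / 1000000 * X := by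
    calc α ^ 2 * p₀ * τ ≤ 1681 / 4000000 * (141 / 100 * θ) * τ := by gcongr
      _ ≤ _ := by linarith only [hτX, hX]
  have hQ' : Q ≤ (3001 / 1000 * R + 203 / 1000 * S + 1681 / 20000 * P) * (1043 / 1000) := by
    rw [hQ, div_le_iff₀ hγ]
    set N := 3001 / 1000 * R + 203 / 1000 * S + 1681 / 20000 * P with hN
    have hN0 : 0 ≤ N := by positivity
    have h1 : N * 1 ≤ N * ((1043 / 1000) * (1 - 2 * α)) := by
      gcongr
      linarith only [hα']
    linarith only [h1, m1, m2, hN]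
  have hdiv : 2 * (R + α * Q) / (1 - α) ≤ 2 * (R + 41 / 2000 * Q) * (1021 / 1000) := by
    rw [div_le_iff₀ hγ']
    set N := 2 * (R + 41 / 2000 * Q) with hN
    have hN0 : 0 ≤ N := by positivity
    have h1 : N * 1 ≤ N * ((1021 / 1000) * (1 - α)) := by
      gcongr
      linarith only [hα']
    linarith only [h1, m5, hN]
  have hS' : S ≤ 26 / 10000 * X + 9 / 80 * V := by
    rw [hSS]; linarith only [m3, hS₀, hθX]
  have hp₀' : p₀ ≤ 2 / 1000 * X := by linarith only [hp₀, hθX, hX]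
  have hE' : E ≤ 41 / 2000 * Q + 113 / 10000 * V
      + 251 / 100 * (41 / 2000 * (1001 / 10000 * S + R))
      + 4001 / 1000 * (1681 / 4000000 * Q) + 9 / 1000000 * X := by
    rw [hE]; linarith only [m5, m4, m7, m6, m8]
  have hVV' : V ≤ 8 / 1000 * X + 1 / 5 * S + 2 * (R + 41 / 2000 * Q) * (1021 / 1000)
      + 5 / 1000 * X + 9 / 80 * V := by
    linarith only [hVV, hV₀, m1, hdiv, hp₀', m3, hθX, hX]
  have hPQ' : P ≤ 2 / 1000 * X + Q := hPQ.trans (by linarith only [hp₀'])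
  -- eliminate in the order `P`, `V`, `S`, `R`
  have s1 : Q ≤ 345 / 100 * R + 24 / 100 * S + 1 / 1000 * X := by
    linarith only [hQ', hPQ', hR, hS, hX]
  have s2 : V ≤ 265 / 100 * R + 2 / 100 * X := by
    linarith only [hVV', hS', s1, hR, hX]
  have s3 : S ≤ 3 / 10 * R + 1 / 100 * X := by
    linarith only [hS', s2, hR, hX]
  have s4 : E ≤ 178 / 1000 * R + 2 / 1000 * X := by
    linarith only [hE', s1, s2, s3, hR, hX]
  have s5 : R ≤ 122 / 100 * X := by linarith only [s4, hRE, hX]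
  exact ⟨s5, by linarith only [s4, s5, hX], by linarith only [s2, s5, hX],
    by linarith only [s3, s5, hX], by linarith only [hPQ', s1, s3, s5, hX]⟩

end EchoChain

namespace EchoChain

namespace ResonantSystem

variable {ι : Type*} {c α ε h a b T T₀ θ X t : ℝ} {U um up fm fp : ℝ → ℂ} {v : ι → ℝ → ℂ}

/-- The rescaled unknowns at the end time, in terms of the state at the resonant time. -/
theorem bounds_after (hp : Params c α ε h)
    (H : ResonantSystem c ε h 0 T U um up fm fp v) (hTm : (1 - h) * T = 1 / 2) (hθ : 0 ≤ θ)
    (hU : ‖amplitude α ε U 0‖ ≤ 141 / 100 * θ) (hS₀ : ‖um 0 + up 0‖ ≤ 13 / 5 * θ)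
    (hv : ∀ i, ‖v i 0‖ ≤ 15 / 2 * θ)
    (hX : ∀ t ∈ Icc 0 T,
      ‖wronskian c α ε U um up 0 - amplitude α ε U 0 * couplingMass α ε t‖ ≤ X)
    (hX' : X ≤ ‖wronskian c α ε U um up 0 - amplitude α ε U 0 * couplingMass α ε T‖)
    (hθX : θ ≤ X / 1000) (hτX : θ * ε ^ (-(1 / 2) : ℝ) ≤ X / 1000) :
    ‖wronskian c α ε U um up T‖ ≤ 122 / 100 * X ∧ 78 / 100 * X ≤ ‖wronskian c α ε U um up T‖ ∧
      ‖um T + up T‖ ≤ 2 / 5 * X ∧ ‖amplitude α ε U T‖ ≤ 9 / 2 * X ∧ ∀ i, ‖v i T‖ ≤ 7 / 2 * X := by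
  have hc := hp.c_pos
  have hc' := hp.c_lt
  have hα := hp.α_pos
  have hα' := hp.α_lt
  have hε := hp.ε_pos
  have hε' := hp.ε_le
  have hh := hp.h_pos
  have hh' := hp.h_le
  have hT1 : T ≤ 1 := by nlinarith
  have hT2 : 1 / 2 ≤ T := by nlinarith
  have hT0 : 0 ≤ T := by linarith
  have hX0 : 0 ≤ X := by linarith
  have hstart : (0 : ℝ) ∈ Icc 0 T := ⟨le_rfl, hT0⟩
  have hend : T ∈ Icc 0 T := ⟨hT0, le_rfl⟩
  -- the suprema of the amplitude, of the Wronskian and of the other modes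
  obtain ⟨tp, htp, hpmax⟩ := isCompact_Icc.exists_isMaxOn ⟨_, hstart⟩
    (H.continuousOn_amplitude (α := α) hε).norm
  obtain ⟨P, hPdef⟩ : ∃ P, P = ‖amplitude α ε U tp‖ := ⟨_, rfl⟩
  have hP : ∀ t ∈ Icc 0 T, ‖amplitude α ε U t‖ ≤ P := fun t ht => hPdef ▸ hpmax ht
  have hP0 : 0 ≤ P := hPdef ▸ norm_nonneg _
  obtain ⟨tr, htr, hrmax⟩ := isCompact_Icc.exists_isMaxOn ⟨_, hstart⟩
    (H.continuousOn_wronskian (α := α) hε).norm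
  obtain ⟨R, hRdef⟩ : ∃ R, R = ‖wronskian c α ε U um up tr‖ := ⟨_, rfl⟩
  have hR : ∀ t ∈ Icc 0 T, ‖wronskian c α ε U um up t‖ ≤ R := fun t ht => hRdef ▸ hrmax ht
  have hR0 : 0 ≤ R := hRdef ▸ norm_nonneg _
  obtain ⟨B, hB⟩ := H.bounded
  obtain ⟨V, hVdef⟩ : ∃ V, V = ⨆ x : ι × Icc (0 : ℝ) T, ‖v x.1 x.2‖ := ⟨_, rfl⟩
  have hbdd : BddAbove (range fun x : ι × Icc (0 : ℝ) T => ‖v x.1 x.2‖) :=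
    ⟨B, by rintro _ ⟨x, rfl⟩; exact hB x.2 x.2.2 x.1⟩
  have hV : ∀ t ∈ Icc 0 T, ∀ i, ‖v i t‖ ≤ V := fun t ht i =>
    hVdef ▸ le_ciSup hbdd (i, ⟨t, ht⟩)
  have hV0 : 0 ≤ V := hVdef ▸ Real.iSup_nonneg fun _ => norm_nonneg _
  obtain ⟨S, hSdef⟩ : ∃ S, S = ‖um 0 + up 0‖ + 9 / 8 * |c| * V := ⟨_, rfl⟩
  have hS0 : 0 ≤ S := by rw [hSdef]; positivity
  have hS : ∀ t ∈ Icc 0 T, ‖um t + up t‖ ≤ S := fun t ht => by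
    have h1 := H.norm_add_bound hV ht
    have h2 : 9 / 8 * |c| * V * (t - 0) ≤ 9 / 8 * |c| * V * 1 := by
      have := ht.2
      gcongr
      linarith
    linarith
  obtain ⟨Q, hQdef⟩ : ∃ Q, Q = (3001 / 1000 * R + 203 / 100 * |c| * S + 41 / 10 * α * P)
    / (1 - 2 * α) := ⟨_, rfl⟩
  have hγ : 0 < 1 - 2 * α := by linarith
  have hγ' : 0 < 1 - α := by linarith
  have hQ0 : 0 ≤ Q := by rw [hQdef]; positivity
  have hsub : ∀ t ∈ Icc 0 T,
      ‖amplitude α ε U t - amplitude α ε U 0‖ ≤ Q * (t * radius ε t ^ (-(2 * α))) :=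
    fun t ht => hQdef ▸ H.amplitude_sub_bound_after hp hTm hT1 hR0 hS0 hP0 hS hR hP ht
  have hle : ∀ t ∈ Icc 0 T, ‖amplitude α ε U t‖ ≤
      ‖amplitude α ε U 0‖ + Q * (t * radius ε t ^ (-(2 * α))) := fun t ht => by
    have := norm_sub_norm_le (amplitude α ε U t) (amplitude α ε U 0)
    linarith [hsub t ht]
  have hPQ : P ≤ ‖amplitude α ε U 0‖ + Q := by
    have h1 := hle tp htp
    have h2 : Q * (tp * radius ε tp ^ (-(2 * α))) ≤ Q * 1 := by
      gcongr
      exact (mul_radius_rpow_neg_le htp.1 (by linarith)).trans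
        (Real.rpow_le_one htp.1 (htp.2.trans hT1) hγ.le)
    rw [hPdef]
    linarith
  obtain ⟨E, hEdef⟩ : ∃ E, E = α * Q + 113 / 100 * |c| ^ 2 * V
    + 251 / 100 * α * (1001 / 1000 * |c| * S + R) + 4001 / 1000 * α ^ 2 * Q
    + 9 * α ^ 2 * ‖amplitude α ε U 0‖ * ε ^ (-(1 / 2) : ℝ) := ⟨_, rfl⟩
  have hE : ∀ t ∈ Icc 0 T, ‖wronskian c α ε U um up t
      - (wronskian c α ε U um up 0 - amplitude α ε U 0 * couplingMass α ε t)‖ ≤ E :=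
    fun t ht => hEdef ▸ H.wronskian_bound_after hp hTm hT1 hR0 hS0 hV0 hQ0 (norm_nonneg _) hS hR hV
      le_rfl hsub ht
  have hRE : R ≤ X + E := by
    have h1 := hE tr htr
    have h2 := hX tr htr
    have h3 := norm_sub_norm_le (wronskian c α ε U um up tr)
      (wronskian c α ε U um up 0 - amplitude α ε U 0 * couplingMass α ε tr)
    rw [hRdef]
    linarith
  have hVV : V ≤ 15 / 2 * θ + 2 * |c| * S + 2 * (R + α * Q) / (1 - α)
      + 201 / 100 * ‖amplitude α ε U 0‖ + 9 / 8 * |c| * V := by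
    conv_lhs => rw [hVdef]
    refine Real.iSup_le (fun x => ?_) (by positivity)
    have h1 := H.others_bound_after hp hT1 hR0 hS0 hV0 hQ0 (norm_nonneg _) hS hR hV hle x.2.2 x.1
    have h2 := hv x.1
    linarith
  obtain ⟨r1, r2, r3, r4, r5⟩ := closure_after hc hc' hα hα' hR0 hS0 hV0 hP0 hθ (norm_nonneg _) hU
    hS₀ le_rfl hθX (Real.rpow_nonneg hε.le _) hτX hSdef hQdef hPQ hEdef hRE hVV
  refine ⟨(hR T hend).trans r1, ?_, (hS T hend).trans r4, (hP T hend).trans r5,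
    fun i => (hV T hend i).trans r3⟩
  have h1 := hE T hend
  rw [norm_sub_rev] at h1
  have h2 := norm_sub_norm_le
    (wronskian c α ε U um up 0 - amplitude α ε U 0 * couplingMass α ε T)
    (wronskian c α ε U um up T)
  linarith only [h1, h2, hX', r2]

/-- The state at the end time, in terms of the state at the resonant time. -/
theorem estimates_after (hp : Params c α ε h)
    (H : ResonantSystem c ε h 0 T U um up fm fp v) (hTm : (1 - h) * T = 1 / 2) (hθ : 0 ≤ θ)
    (hU : ‖amplitude α ε U 0‖ ≤ 141 / 100 * θ) (hS₀ : ‖um 0 + up 0‖ ≤ 13 / 5 * θ)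
    (hv : ∀ i, ‖v i 0‖ ≤ 15 / 2 * θ)
    (hX : ∀ t ∈ Icc 0 T,
      ‖wronskian c α ε U um up 0 - amplitude α ε U 0 * couplingMass α ε t‖ ≤ X)
    (hX' : X ≤ ‖wronskian c α ε U um up 0 - amplitude α ε U 0 * couplingMass α ε T‖)
    (hθX : θ ≤ X / 1000) (hτX : θ * ε ^ (-(1 / 2) : ℝ) ≤ X / 1000) :
    2 * X ≤ ‖um T‖ ∧ |c| * ‖um T‖ ≤ 2 * X ∧ ‖U T‖ ≤ 2 * ‖um T‖ ∧ ‖up T‖ ≤ 2 * ‖um T‖ ∧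
      ∀ i, ‖v i T‖ ≤ 2 * ‖um T‖ := by
  have hα := hp.α_pos
  have hα' := hp.α_lt
  have hε := hp.ε_pos
  have hε' := hp.ε_le
  have hh := hp.h_pos
  have hh' := hp.h_le
  have hT1 : T ≤ 1 := by nlinarith
  have hT2 : 1 / 2 ≤ T := by nlinarith
  have hT0 : 0 ≤ T := by linarith
  have hX0 : 0 ≤ X := by linarith
  have hc := hp.c_pos
  have hc' := hp.c_lt
  obtain ⟨hRT, hΛT, hST, hPT, hVT⟩ := H.bounds_after hp hTm hθ hU hS₀ hv hX hX' hθX hτX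
  have hr := radius_pos hε T
  have hw := Real.rpow_pos_of_pos hr α
  have hw1 : radius ε T ^ α ≤ 1001 / 1000 :=
    radius_rpow_le hε hε' (abs_le.2 ⟨by linarith, hT1⟩) hα.le (by linarith)
  have hw2 : 1 / 2 ≤ radius ε T ^ α := by
    calc (1 / 2 : ℝ) = (1 / 2 : ℝ) ^ (1 : ℝ) := (Real.rpow_one _).symm
      _ ≤ (1 / 2 : ℝ) ^ α :=
        Real.rpow_le_rpow_of_exponent_ge (by norm_num) (by norm_num) (by linarith)
      _ ≤ radius ε T ^ α :=
        Real.rpow_le_rpow (by norm_num) (hT2.trans (le_radius ε T)) hα.le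
  have hshear : α * T * (radius ε T ^ α / radius ε T ^ 2) * (9 / 2 * X) ≤ 19 / 100 * X := by
    have h1 : T / radius ε T ^ 2 ≤ 2 := by
      rw [div_le_iff₀ (by positivity), radius_sq]
      nlinarith [sq_nonneg ε]
    calc α * T * (radius ε T ^ α / radius ε T ^ 2) * (9 / 2 * X)
        = α * radius ε T ^ α * (T / radius ε T ^ 2) * (9 / 2 * X) := by ring
      _ ≤ 41 / 2000 * (1001 / 1000) * 2 * (9 / 2 * X) := by gcongr
      _ ≤ _ := by linarith
  have hshear' := (norm_shear_le hε hα.le hT0 hPT).trans hshear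
  have hdiff : 58 / 100 * X ≤ |c| * ‖um T - up T‖ := by
    rw [← Real.norm_eq_abs, ← Complex.norm_real, ← norm_mul, mul_sub_eq (α := α) (U := U) hε T]
    have h1 := norm_sub_le (((radius ε T ^ (-α) : ℝ) : ℂ) * wronskian c α ε U um up T
      + ((α * T * radius ε T ^ (α - 2) : ℝ) : ℂ) * amplitude α ε U T)
      (((α * T * radius ε T ^ (α - 2) : ℝ) : ℂ) * amplitude α ε U T)
    rw [add_sub_cancel_right, norm_mul, Complex.norm_real, radius_rpow_neg,
      Real.norm_of_nonneg (by positivity)] at h1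
    have h2 : (1000 / 1001 : ℝ) ≤ (radius ε T ^ α)⁻¹ := by
      rw [le_inv_comm₀ (by norm_num) hw]; norm_num; linarith
    have h3 : 1000 / 1001 * (78 / 100 * X)
        ≤ (radius ε T ^ α)⁻¹ * ‖wronskian c α ε U um up T‖ := by gcongr
    rw [radius_rpow_neg]
    linarith
  have hdiff' : 58 / 10 * X ≤ ‖um T - up T‖ := by
    have : |c| * ‖um T - up T‖ ≤ 1 / 10 * ‖um T - up T‖ := by gcongr
    linarith
  have hum : 27 / 10 * X ≤ ‖um T‖ := by
    have h1 := norm_add_le (um T + up T) (-(um T))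
    have h2 := norm_sub_le (um T) (up T)
    rw [norm_neg, show um T + up T + -um T = up T by ring] at h1
    linarith
  refine ⟨by linarith, ?_, ?_, ?_, fun i => ?_⟩
  · have h1 := (norm_neighbours_le hε hα.le hT0 hST hRT hPT).1
    have h3 : 122 / 100 * X / radius ε T ^ α ≤ 122 / 100 * X / (1 / 2) := by gcongr
    have h4 : |c| * (2 / 5 * X) ≤ 1 / 10 * (2 / 5 * X) := by gcongr
    linarith
  · rw [norm_eq_rpow_mul (α := α) hε]
    have h1 : radius ε T ^ α * ‖amplitude α ε U T‖ ≤ 1001 / 1000 * (9 / 2 * X) := by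
      gcongr
    linarith
  · have h1 := norm_add_le (um T + up T) (-(um T))
    rw [norm_neg, show um T + up T + -um T = up T by ring] at h1
    linarith
  · have := hVT i
    linarith

/-- The passage through the resonance. -/
theorem passage (hp : Params c α ε h) (hsmall : ε ^ (1 / 5 : ℝ) ≤ α / 100000)
    (H₀ : ResonantSystem c ε h (-T₀) 0 U um up fm fp v) (hT₀ : (1 + h) * T₀ = 1 / 2)
    (H₁ : ResonantSystem c ε h 0 T U um up fm fp v) (hT : (1 - h) * T = 1 / 2)
    (hU : ‖U (-T₀)‖ ≤ θ) (hU' : θ / 2 ≤ ‖U (-T₀)‖) (hm : ‖um (-T₀)‖ ≤ θ) (hu : ‖up (-T₀)‖ ≤ θ)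
    (hv : ∀ i, ‖v i (-T₀)‖ ≤ θ) :
    α / 10 * (θ * ε ^ (2 * α - 1)) ≤ ‖um T‖ ∧ |c| * ‖um T‖ ≤ 2 * (θ * ε ^ (2 * α - 1)) ∧
      ‖U T‖ ≤ 2 * ‖um T‖ ∧ ‖up T‖ ≤ 2 * ‖um T‖ ∧ ∀ i, ‖v i T‖ ≤ 2 * ‖um T‖ := by
  have hα := hp.α_pos
  have hα' := hp.α_lt
  have hε := hp.ε_pos
  have hε' := hp.ε_le
  have hh := hp.h_pos
  have hh' := hp.h_le
  have hθ : 0 ≤ θ := (norm_nonneg _).trans hU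
  have hT₀1 : 1 / 3 ≤ T₀ := by nlinarith
  have hT₀2 : T₀ ≤ 1 / 2 := by nlinarith
  have hT2 : 1 / 2 ≤ T := by nlinarith
  obtain ⟨b1, b2, b3, b4, b5⟩ := H₀.estimates_before hp hT₀ hU hU' hm hu hv
  have hmono := couplingMass_mono (α := α) hε hα.le (by linarith)
  have hG : 0 < ε ^ (2 * α - 1) := Real.rpow_pos_of_pos hε _
  obtain ⟨m, hm_def⟩ : ∃ m, m = couplingMass α ε T₀ := ⟨_, rfl⟩
  obtain ⟨M, hM_def⟩ : ∃ M, M = couplingMass α ε T := ⟨_, rfl⟩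
  rw [← hm_def] at b5
  have hm_low : α / 4 * ε ^ (2 * α - 1) ≤ m :=
    hm_def ▸ le_couplingMass hε hα.le (by linarith) (by linarith)
  have hm_up : m ≤ 2 * α * ε ^ (2 * α - 1) :=
    hm_def ▸ couplingMass_le hε hα.le (by linarith) (by linarith)
  have hM_up : M ≤ 2 * α * ε ^ (2 * α - 1) :=
    hM_def ▸ couplingMass_le hε hα.le (by linarith) (by linarith)
  have hmM : m ≤ M := by rw [hm_def, hM_def]; exact hmono (by linarith)
  have hm0 : 0 < m := lt_of_lt_of_le (by positivity) hm_low
  -- negligible quantities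
  have hτ : ε ^ (-(3 / 4) : ℝ) ≤ m / 25000 := by
    have h1 : ε ^ (-(3 / 4) : ℝ) ≤ ε ^ (2 * α - 1) * ε ^ (1 / 5 : ℝ) := by
      rw [← Real.rpow_add hε]
      exact Real.rpow_le_rpow_of_exponent_ge hε (by linarith) (by linarith)
    have h2 : ε ^ (2 * α - 1) * ε ^ (1 / 5 : ℝ) ≤ ε ^ (2 * α - 1) * (α / 100000) := by gcongr
    linarith
  have hτ1 : (1 : ℝ) ≤ ε ^ (-(3 / 4) : ℝ) :=
    Real.one_le_rpow_of_pos_of_le_one_of_nonpos hε (by linarith) (by norm_num)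
  have hτ2 : ε ^ (-(1 / 2) : ℝ) ≤ ε ^ (-(3 / 4) : ℝ) :=
    Real.rpow_le_rpow_of_exponent_ge hε (by linarith) (by norm_num)
  set p := amplitude α ε U 0 with hp_def
  set L := wronskian c α ε U um up 0 with hL_def
  have hθm : 0 ≤ θ * m := by positivity
  have hθτ : θ * ε ^ (-(3 / 4) : ℝ) ≤ θ * (m / 25000) := by gcongr
  have hδ : ‖L + p * m‖ ≤ 42 / 1000 * (θ * m) := by linarith
  have hpm : 13 / 100 * θ * m ≤ ‖p‖ * m := by gcongr
  have hpM : ‖p‖ * m ≤ ‖p‖ * M := by gcongr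
  have hM0 : 0 ≤ M := hm0.le.trans hmM
  have hpmul : ∀ x : ℝ, 0 ≤ x → ‖p * (x : ℂ)‖ = ‖p‖ * x := fun x hx => by
    rw [norm_mul, Complex.norm_real, Real.norm_of_nonneg hx]
  obtain ⟨X, hX_def⟩ : ∃ X, X = ‖L - p * M‖ := ⟨_, rfl⟩
  have hX_low : ‖p‖ * (m + M) - 42 / 1000 * (θ * m) ≤ X := by
    have h1 := norm_sub_norm_le (p * ((m + M : ℝ) : ℂ)) (L + p * m)
    rw [hpmul _ (by linarith), norm_sub_rev,
      show L + p * m - p * ((m + M : ℝ) : ℂ) = L - p * M by push_cast; ring, ← hX_def] at h1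
    linarith
  have hX_up : X ≤ ‖p‖ * (m + M) + 42 / 1000 * (θ * m) := by
    have h1 := norm_sub_le (L + p * m) (p * ((m + M : ℝ) : ℂ))
    rw [hpmul _ (by linarith),
      show L + p * m - p * ((m + M : ℝ) : ℂ) = L - p * M by push_cast; ring, ← hX_def] at h1
    linarith
  have hL_up : ‖L‖ ≤ X := by
    have h1 := norm_sub_le (L + p * m) (p * m)
    rw [add_sub_cancel_right, hpmul _ hm0.le] at h1
    linarith
  have hXm : 2 / 10 * (θ * m) ≤ X := by linarith
  have hX : ∀ t ∈ Icc 0 T, ‖L - p * couplingMass α ε t‖ ≤ X := by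
    intro t ht
    have h1 : 0 ≤ couplingMass α ε t := by
      have := hmono ht.1; rwa [couplingMass_zero] at this
    have h2 : couplingMass α ε t ≤ M := hM_def ▸ hmono ht.2
    have hMpos : 0 < M := hm0.trans_le hmM
    set s := couplingMass α ε t / M with hs
    have hs0 : 0 ≤ s := by positivity
    have hs1 : s ≤ 1 := by rw [hs, div_le_one hMpos]; exact h2
    have h3 : L - p * couplingMass α ε t = ((1 - s : ℝ) : ℂ) * L + (s : ℂ) * (L - p * M) := by
      have : (couplingMass α ε t : ℂ) = s * M := by
        rw [hs]; push_cast
        rw [div_mul_cancel₀]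
        exact_mod_cast hMpos.ne'
      rw [this]; push_cast; ring
    rw [h3]
    refine (norm_add_le _ _).trans ?_
    rw [norm_mul, norm_mul, Complex.norm_real, Complex.norm_real, Real.norm_of_nonneg hs0,
      Real.norm_of_nonneg (by linarith), ← hX_def]
    have h4 : (1 - s) * ‖L‖ ≤ (1 - s) * X :=
      mul_le_mul_of_nonneg_left hL_up (by linarith)
    linarith
  obtain ⟨e1, e2, e3⟩ := H₁.estimates_after (θ := θ) (X := X) hp hT hθ b2 b4 b3 hX
    (by rw [hX_def, hM_def])
    (by
      have : θ * 1 ≤ θ * ε ^ (-(3 / 4) : ℝ) := by gcongr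
      linarith)
    (by
      have : θ * ε ^ (-(1 / 2) : ℝ) ≤ θ * ε ^ (-(3 / 4) : ℝ) := by gcongr
      linarith)
  refine ⟨?_, ?_, e3⟩
  · have h1 : θ * (α / 4 * ε ^ (2 * α - 1)) ≤ θ * m := by gcongr
    linarith
  · have h1 : ‖p‖ * (m + M) ≤ 141 / 100 * θ * (2 * α * ε ^ (2 * α - 1) + 2 * α * ε ^ (2 * α - 1)) := by
      gcongr
    have h2 : θ * m ≤ θ * (2 * α * ε ^ (2 * α - 1)) := by gcongr
    have h3 : α * (θ * ε ^ (2 * α - 1)) ≤ 41 / 2000 * (θ * ε ^ (2 * α - 1)) := by gcongr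
    have h4 : 0 ≤ θ * ε ^ (2 * α - 1) := by positivity
    linarith

end ResonantSystem

end EchoChain

namespace EchoChain

variable {c η ξ ε t : ℝ} {k₀ : ℕ} {k : ℤ} {u : ℝ → ℤ → ℂ}

theorem coeff_self (hk : 2 ≤ k₀) : coeff c η k₀ k₀ t = c / (t ^ 2 + ((k₀ : ℝ) ^ 2 / η) ^ 2) := by
  have hK : (k₀ : ℝ) ≠ 0 := by positivity
  rw [coeff]
  congr 1
  push_cast
  rw [div_self hK]
  ring

theorem coeff_pred (hk : 2 ≤ k₀) :
    coeff c η k₀ (k₀ - 1) t = c * lowerCoeff ((k₀ : ℝ) ^ 2 / η) (1 / k₀) t := by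
  have hK : (k₀ : ℝ) ≠ 0 := by positivity
  rw [coeff, lowerCoeff, mul_one_div]
  congr 1
  push_cast
  have h1 : ((k₀ : ℝ) - 1) / k₀ = 1 - 1 / k₀ := by field_simp
  have h2 : (k₀ : ℝ) * (1 - 1 / k₀) = k₀ - 1 := by field_simp
  rw [h1, sub_sub_cancel, ← h2]
  generalize 1 - 1 / (k₀ : ℝ) = s
  ring

theorem coeff_succ (hk : 2 ≤ k₀) :
    coeff c η k₀ (k₀ + 1) t = c * upperCoeff ((k₀ : ℝ) ^ 2 / η) (1 / k₀) t := by
  have hK : (k₀ : ℝ) ≠ 0 := by positivity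
  rw [coeff, upperCoeff, mul_one_div]
  congr 1
  push_cast
  have h1 : ((k₀ : ℝ) + 1) / k₀ = 1 + 1 / k₀ := by field_simp
  have h2 : (k₀ : ℝ) * (1 + 1 / k₀) = k₀ + 1 := by field_simp
  rw [h1, sub_add_cancel_left, ← h2]
  generalize 1 + 1 / (k₀ : ℝ) = s
  ring

theorem startTime_eq (hk : 2 ≤ k₀) : (1 + 1 / (k₀ : ℝ)) * (-startTime k₀) = 1 / 2 := by
  have hK : (2 : ℝ) ≤ k₀ := by exact_mod_cast hk
  rw [startTime]
  field_simp

theorem endTime_eq (hk : 2 ≤ k₀) : (1 - 1 / (k₀ : ℝ)) * endTime k₀ = 1 / 2 := by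
  have hK : (2 : ℝ) ≤ k₀ := by exact_mod_cast hk
  have : (k₀ : ℝ) - 1 ≠ 0 := by linarith
  rw [endTime]
  field_simp

theorem startTime_neg (hk : 2 ≤ k₀) : startTime k₀ < 0 := by
  have hK : (2 : ℝ) ≤ k₀ := by exact_mod_cast hk
  rw [startTime, neg_lt_zero]
  positivity

theorem endTime_pos (hk : 2 ≤ k₀) : 0 < endTime k₀ := by
  have hK : (2 : ℝ) ≤ k₀ := by exact_mod_cast hk
  have : 0 < (k₀ : ℝ) - 1 := by linarith
  rw [endTime]
  positivity

/-- Modes at distance at least two from the resonant one are far from resonance. -/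
theorem four_thirds_le_abs (hk : 2 ≤ k₀) (ht : t ∈ Icc (startTime k₀) (endTime k₀))
    (hfar : 2 ≤ |(k₀ : ℤ) - k|) : 4 / 3 ≤ |(k₀ : ℝ) - k - k / k₀ * t| := by
  have hK : (2 : ℝ) ≤ k₀ := by exact_mod_cast hk
  have hK0 : (0 : ℝ) < k₀ := by linarith
  have hK1 : (0 : ℝ) < (k₀ : ℝ) - 1 := by linarith
  obtain ⟨ht1, ht2⟩ := ht
  rw [startTime, neg_le, le_div_iff₀ (by linarith)] at ht1
  rw [endTime, le_div_iff₀ (by linarith)] at ht2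
  obtain ⟨s, hs⟩ : ∃ s, s = t / k₀ := ⟨_, rfl⟩
  have hts : t = s * k₀ := by rw [hs]; field_simp
  have h1 : -1 / 2 ≤ s * (k₀ + 1) := by
    by_contra! h
    have := mul_lt_mul_of_pos_right h hK0
    rw [hts] at ht1; nlinarith
  have h2 : s * (k₀ - 1) ≤ 1 / 2 := by
    by_contra! h
    have := mul_lt_mul_of_pos_right h hK0
    rw [hts] at ht2; nlinarith
  have hD : (k₀ : ℝ) - k - k / k₀ * t = ((k₀ : ℝ) - k) * (1 + s) - s * k₀ := by
    rw [hts]; field_simp; ring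
  have hs1 : 0 ≤ 1 + s := by
    by_contra! h; nlinarith
  have hfar' : (2 : ℝ) ≤ |(k₀ : ℝ) - k| := by exact_mod_cast hfar
  have hmain : 4 / 3 ≤ 2 * (1 + s) - |s * k₀| := by
    rcases le_total 0 s with h0 | h0
    · rw [abs_of_nonneg (by positivity)]; nlinarith
    · rw [abs_of_nonpos (by nlinarith)]
      have : -1 / 6 ≤ s := by
        by_contra! h; nlinarith
      linarith
  rw [hD]
  have h3 := abs_sub_abs_le_abs_sub (((k₀ : ℝ) - k) * (1 + s)) (s * k₀)
  rw [abs_mul, abs_of_nonneg hs1] at h3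
  have h4 : 2 * (1 + s) ≤ |(k₀ : ℝ) - k| * (1 + s) := by gcongr
  linarith

theorem abs_coeff_le_of_far (hk : 2 ≤ k₀) (ht : t ∈ Icc (startTime k₀) (endTime k₀))
    (hfar : 2 ≤ |(k₀ : ℤ) - k|) : |coeff c η k₀ k t| ≤ 9 / 16 * |c| := by
  have h1 := four_thirds_le_abs hk ht hfar
  have h2 : (16 / 9 : ℝ) ≤ ((k₀ : ℝ) - k - k / k₀ * t) ^ 2 := by
    rw [← sq_abs]
    calc (16 / 9 : ℝ) = (4 / 3) ^ 2 := by norm_num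
      _ ≤ _ := by gcongr
  have h3 : 0 ≤ (η ^ 2)⁻¹ * (k₀ : ℝ) ^ 2 * (k : ℝ) ^ 2 := by positivity
  rw [coeff, abs_div, abs_of_pos (by linarith : 0 < (η ^ 2)⁻¹ * (k₀ : ℝ) ^ 2 * (k : ℝ) ^ 2
    + ((k₀ : ℝ) - k - k / k₀ * t) ^ 2), div_le_iff₀ (by linarith)]
  nlinarith [abs_nonneg c]

theorem abs_coeff_neighbours_le (hk : 2 ≤ k₀) (ht : t ∈ Icc (startTime k₀) (endTime k₀)) :
    |coeff c η k₀ (k₀ - 1) t| ≤ 4 * |c| ∧ |coeff c η k₀ (k₀ + 1) t| ≤ 4 * |c| := by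
  have hK : (2 : ℝ) ≤ k₀ := by exact_mod_cast hk
  have hh : 0 < 1 / (k₀ : ℝ) := by positivity
  have hh' : 1 / (k₀ : ℝ) ≤ 1 / 2 := one_div_le_one_div_of_le (by norm_num) hK
  rw [coeff_pred hk, coeff_succ hk, abs_mul, abs_mul, mul_comm 4 |c|]
  suffices h : |lowerCoeff ((k₀ : ℝ) ^ 2 / η) (1 / k₀) t| ≤ 4 ∧
      |upperCoeff ((k₀ : ℝ) ^ 2 / η) (1 / k₀) t| ≤ 4 from
    ⟨mul_le_mul_of_nonneg_left h.1 (abs_nonneg c), mul_le_mul_of_nonneg_left h.2 (abs_nonneg c)⟩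
  rcases le_total 0 t with h0 | h0
  · refine (coeff_bounds_after hh hh' h0 ?_).2.2
    rw [← endTime_eq hk]
    exact mul_le_mul_of_nonneg_left ht.2 (by linarith)
  · have := (coeff_bounds_before (ε := (k₀ : ℝ) ^ 2 / η) (r := -t) hh hh' (by linarith) (by
      rw [← startTime_eq hk]
      exact mul_le_mul_of_nonneg_left (neg_le_neg ht.1) (by linarith))).2
    rwa [neg_neg] at this

/-- The modes other than the resonant one and its neighbours. -/
abbrev FarMode (k₀ : ℕ) : Type := {k : ℤ // 2 ≤ |(k₀ : ℤ) - k|}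

theorem eq_or_eq_or_eq_or_far (k₀ : ℕ) (k : ℤ) :
    k = k₀ ∨ k = k₀ - 1 ∨ k = k₀ + 1 ∨ 2 ≤ |(k₀ : ℤ) - k| := by
  rcases abs_cases ((k₀ : ℤ) - k) with h | h <;> omega

theorem norm_coeff_mul_le_of_far (hk : 2 ≤ k₀) (ht : t ∈ Icc (startTime k₀) (endTime k₀)) {V : ℝ}
    (hV : ∀ j : FarMode k₀, ‖u t j‖ ≤ V) (hfar : 2 ≤ |(k₀ : ℤ) - k|) :
    ‖(coeff c η k₀ k t : ℂ) * u t k‖ ≤ 9 / 16 * |c| * V := by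
  rw [norm_mul, Complex.norm_real, Real.norm_eq_abs]
  exact mul_le_mul (abs_coeff_le_of_far hk ht hfar) (hV ⟨k, hfar⟩) (norm_nonneg _) (by positivity)

/-- A solution of the full system is a resonant system on every subinterval. -/
theorem IsSolution.resonantSystem (hu : IsSolution c η k₀ u) (hk : 2 ≤ k₀) {a b : ℝ}
    (ha : startTime k₀ ≤ a) (hb : b ≤ endTime k₀) :
    ResonantSystem c ((k₀ : ℝ) ^ 2 / η) (1 / k₀) a b (fun t => u t k₀) (fun t => u t (k₀ - 1))
      (fun t => u t (k₀ + 1)) (fun t => (coeff c η k₀ (k₀ - 2) t : ℂ) * u t (k₀ - 2))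
      (fun t => (coeff c η k₀ (k₀ + 2) t : ℂ) * u t (k₀ + 2))
      (fun (k : FarMode k₀) t => u t k) := by
  have hI : Icc a b ⊆ Icc (startTime k₀) (endTime k₀) := Icc_subset_Icc ha hb
  have hI' : Ioo a b ⊆ Ioo (startTime k₀) (endTime k₀) := Ioo_subset_Ioo ha hb
  refine ⟨(hu.continuousOn _).mono hI, (hu.continuousOn _).mono hI, (hu.continuousOn _).mono hI,
    fun i => (hu.continuousOn _).mono hI, fun t ht => ?_, fun t ht => ?_, fun t ht => ?_,
    fun t ht i => ?_, fun t ht V hV => ?_, fun t ht V hV => ?_, ?_⟩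
  · refine (hu.hasDerivAt t (hI' ht) k₀).congr_deriv ?_
    rw [coeff_pred hk, coeff_succ hk]
    push_cast
    ring
  · refine (hu.hasDerivAt t (hI' ht) (k₀ - 1)).congr_deriv ?_
    rw [show (k₀ : ℤ) - 1 - 1 = k₀ - 2 by ring, show (k₀ : ℤ) - 1 + 1 = k₀ by ring, coeff_self hk]
    push_cast
    ring
  · refine (hu.hasDerivAt t (hI' ht) (k₀ + 1)).congr_deriv ?_
    rw [show (k₀ : ℤ) + 1 + 1 = k₀ + 2 by ring, show (k₀ : ℤ) + 1 - 1 = k₀ by ring, coeff_self hk]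
    push_cast
    ring
  · refine ⟨_, hu.hasDerivAt t (hI' ht) i, fun w V hm hp hV => ?_⟩
    have ht' := Ioo_subset_Icc_self (hI' ht)
    have hw : 0 ≤ |c| * w := mul_nonneg (abs_nonneg c) ((norm_nonneg _).trans hm)
    have hV0 : 0 ≤ |c| * V := mul_nonneg (abs_nonneg c) ((norm_nonneg _).trans (hV i))
    have hnear : ∀ k, k = (k₀ : ℤ) - 1 ∨ k = (k₀ : ℤ) + 1 →
        ‖(coeff c η k₀ k t : ℂ) * u t k‖ ≤ 4 * |c| * w := by
      have h := abs_coeff_neighbours_le (c := c) (η := η) hk ht'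
      rintro k (rfl | rfl) <;> rw [norm_mul, Complex.norm_real, Real.norm_eq_abs]
      · exact mul_le_mul h.1 hm (norm_nonneg _) (by positivity)
      · exact mul_le_mul h.2 hp (norm_nonneg _) (by positivity)
    have hfar : ∀ k, 2 ≤ |(k₀ : ℤ) - k| →
        ‖(coeff c η k₀ k t : ℂ) * u t k‖ ≤ 9 / 16 * |c| * V :=
      fun k => norm_coeff_mul_le_of_far hk ht' hV
    refine (norm_sub_le _ _).trans ?_
    have hi := i.2
    have hcase : ∀ k : ℤ, k ≠ k₀ → (k = (k₀ : ℤ) - 1 ∨ k = (k₀ : ℤ) + 1) ∨ 2 ≤ |(k₀ : ℤ) - k| := by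
      intro k hne
      rcases eq_or_eq_or_eq_or_far k₀ k with h | h | h | h
      exacts [absurd h hne, .inl (.inl h), .inl (.inr h), .inr h]
    rw [le_abs] at hi
    have hne1 : (i : ℤ) - 1 ≠ k₀ := by omega
    have hne2 : (i : ℤ) + 1 ≠ k₀ := by omega
    rcases hcase _ hne1 with h1 | h1 <;> rcases hcase _ hne2 with h2 | h2
    · exfalso; omega
    · linarith [hnear _ h1, hfar _ h2]
    · linarith [hfar _ h1, hnear _ h2]
    · linarith [hfar _ h1, hfar _ h2]
  · exact norm_coeff_mul_le_of_far hk (Ioo_subset_Icc_self (hI' ht)) hV (by norm_num)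
  · exact norm_coeff_mul_le_of_far hk (Ioo_subset_Icc_self (hI' ht)) hV (by norm_num)
  · obtain ⟨B, hB⟩ := hu.bounded
    exact ⟨B, fun t ht i => hB t (hI ht) i⟩

/-- The smaller root of `α (1 - α) = 2 c²`. -/
noncomputable def rootExponent (c : ℝ) : ℝ := (1 - Real.sqrt (1 - 8 * c ^ 2)) / 2

theorem rootExponent_spec (hc : 0 < |c|) (hc' : |c| < 1 / 10) :
    0 < rootExponent c ∧ rootExponent c < 41 / 2000 ∧
      rootExponent c * (1 - rootExponent c) = 2 * c ^ 2 := by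
  have h0 : 0 < c ^ 2 := sq_pos_of_pos hc |>.trans_eq (sq_abs c)
  have h1 : c ^ 2 < 1 / 100 := by
    rw [← sq_abs]
    calc |c| ^ 2 < (1 / 10) ^ 2 := by gcongr
      _ = _ := by norm_num
  have hs := Real.sq_sqrt (by linarith : 0 ≤ 1 - 8 * c ^ 2)
  have h2 : Real.sqrt (1 - 8 * c ^ 2) < 1 := by
    rw [Real.sqrt_lt' one_pos]; linarith
  have h3 : 959 / 1000 < Real.sqrt (1 - 8 * c ^ 2) := by
    rw [Real.lt_sqrt (by norm_num)]; norm_num; linarith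
  refine ⟨?_, ?_, ?_⟩ <;> rw [rootExponent]
  · linarith
  · linarith
  · linarith

theorem norm_le_maxMode {v : ℤ → ℂ} {B : ℝ} (hB : ∀ k, ‖v k‖ ≤ B) (k : ℤ) : ‖v k‖ ≤ maxMode v :=
  le_ciSup (f := fun k => ‖v k‖) ⟨B, by rintro _ ⟨k, rfl⟩; exact hB k⟩ k

/-- One step of the echo chain, with the frequency `ξ` above an explicit threshold. -/
theorem IsSolution.echo (hc : 0 < |c|) (hc' : |c| < 1 / 10) (hk : 2 ≤ k₀)
    (hξ : ξ = η / (k₀ : ℝ) ^ 2) (hξ₁ : 10000 ≤ ξ) (hξ₂ : (100000 / rootExponent c) ^ 5 ≤ ξ)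
    (hu : IsSolution c η k₀ u) (hdom : ModeDominates k₀ (u (startTime k₀))) :
    rootExponent c / 10 * (ξ ^ Real.sqrt (1 - 8 * c ^ 2) * maxMode (u (startTime k₀)))
        ≤ ‖u (endTime k₀) (k₀ - 1)‖ ∧
      |c| * ‖u (endTime k₀) (k₀ - 1)‖
        ≤ 2 * (ξ ^ Real.sqrt (1 - 8 * c ^ 2) * maxMode (u (startTime k₀))) ∧
      ∀ k, ‖u (endTime k₀) k‖ ≤ 2 * ‖u (endTime k₀) (k₀ - 1)‖ := by
  obtain ⟨hα, hα', hroot⟩ := rootExponent_spec hc hc'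
  have hK : (2 : ℝ) ≤ k₀ := by exact_mod_cast hk
  have hξ0 : 0 < ξ := by linarith
  have hεξ : (k₀ : ℝ) ^ 2 / η = ξ⁻¹ := by rw [hξ, inv_div]
  have hp : Params c (rootExponent c) ((k₀ : ℝ) ^ 2 / η) (1 / k₀) :=
    ⟨hc, hc', hα, hα', hroot, by rw [hεξ]; positivity,
      by rw [hεξ, inv_le_comm₀ hξ0 (by norm_num)]; norm_num; exact hξ₁,
      by positivity, one_div_le_one_div_of_le (by norm_num) hK⟩
  have hsmall : ((k₀ : ℝ) ^ 2 / η) ^ (1 / 5 : ℝ) ≤ rootExponent c / 100000 := by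
    have h5 : (((rootExponent c / 100000) ^ 5 : ℝ)) ^ (1 / 5 : ℝ) = rootExponent c / 100000 := by
      rw [← Real.rpow_natCast, ← Real.rpow_mul (by positivity)]
      norm_num
    rw [← h5, hεξ]
    refine Real.rpow_le_rpow (by positivity) ?_ (by norm_num)
    rw [inv_le_comm₀ hξ0 (by positivity), ← inv_pow, inv_div]
    exact hξ₂
  have hpow : ((k₀ : ℝ) ^ 2 / η) ^ (2 * rootExponent c - 1) = ξ ^ Real.sqrt (1 - 8 * c ^ 2) := by
    rw [hεξ, Real.inv_rpow hξ0.le, ← Real.rpow_neg hξ0.le]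
    congr 1
    rw [rootExponent]
    ring
  obtain ⟨B, hB⟩ := hu.bounded
  have hs := startTime_neg hk
  have he := endTime_pos hk
  have hmax := norm_le_maxMode (hB (startTime k₀) ⟨le_rfl, by linarith⟩)
  have hneg : -(-startTime k₀) = startTime k₀ := neg_neg _
  have H := ResonantSystem.passage (T₀ := -startTime k₀) (T := endTime k₀)
    (θ := maxMode (u (startTime k₀))) hp hsmall
    (hu.resonantSystem hk hneg.ge he.le) (startTime_eq hk)
    (hu.resonantSystem hk hs.le le_rfl) (endTime_eq hk)
  simp only [hneg, hpow] at H
  rw [ModeDominates] at hdom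
  obtain ⟨q1, q2, q3, q4, q5⟩ := H (hmax _) (by linarith) (hmax _) (hmax _) (fun i => hmax _)
  rw [mul_comm (ξ ^ Real.sqrt (1 - 8 * c ^ 2))]
  refine ⟨q1, q2, fun k => ?_⟩
  rcases eq_or_eq_or_eq_or_far k₀ k with rfl | rfl | rfl | h
  · exact q3
  · linarith [norm_nonneg (u (endTime k₀) (k₀ - 1))]
  · exact q4
  · exact q5 ⟨k, h⟩

end EchoChain

theorem mainTheorem2 (c : ℝ) (hc : 0 < |c|) (hc' : |c| < 0.1) :
    ∃ ξ₀ C₁ C₂ : ℝ, 1 ≤ ξ₀ ∧ 0 < C₁ ∧ C₁ ≤ C₂ ∧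
      ∀ (k₀ : ℕ) (η ξ : ℝ), 2 ≤ k₀ → ξ = η / (k₀ : ℝ) ^ 2 → ξ₀ ≤ ξ →
      ∀ u : ℝ → ℤ → ℂ, EchoChain.IsSolution c η k₀ u →
        EchoChain.ModeDominates (k₀ : ℤ) (u (EchoChain.startTime k₀)) →
        (∃ C : ℝ, C₁ ≤ C ∧ C ≤ C₂ ∧
          (∀ k : ℤ, ‖u (EchoChain.endTime k₀) k‖
            ≤ C * ξ ^ Real.sqrt (1 - 8 * c ^ 2)
              * EchoChain.maxMode (u (EchoChain.startTime k₀))) ∧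
          C / 2 * ξ ^ Real.sqrt (1 - 8 * c ^ 2)
              * EchoChain.maxMode (u (EchoChain.startTime k₀))
            ≤ ‖u (EchoChain.endTime k₀) ((k₀ : ℤ) - 1)‖) ∧
        -- the hypotheses hold again for `k₀ - 1` with the state at the end time as initial state
        EchoChain.ModeDominates ((k₀ : ℤ) - 1) (u (EchoChain.endTime k₀)) ∧
        ξ₀ ≤ η / ((k₀ : ℝ) - 1) ^ 2 := by
  have hc1 : |c| < 1 / 10 := by norm_num at hc' ⊢; exact hc'
  obtain ⟨hα, hα', -⟩ := EchoChain.rootExponent_spec hc hc1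
  have hC : EchoChain.rootExponent c / 10 ≤ 4 / |c| := by
    rw [le_div_iff₀ hc]; nlinarith
  refine ⟨max 10000 ((100000 / EchoChain.rootExponent c) ^ 5), EchoChain.rootExponent c / 10,
    4 / |c|, le_max_of_le_left (by norm_num), by positivity, hC, ?_⟩
  intro k₀ η ξ hk hξ hξ₀ u hu hdom
  have hK : (2 : ℝ) ≤ k₀ := by exact_mod_cast hk
  have hξ₁ := (le_max_left _ _).trans hξ₀
  have hξ0 : 0 < ξ := by linarith
  obtain ⟨q1, q2, q3⟩ := hu.echo hc hc1 hk hξ hξ₁ ((le_max_right _ _).trans hξ₀) hdom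
  obtain ⟨B, hB⟩ := hu.bounded
  have hs := EchoChain.startTime_neg hk
  have he := EchoChain.endTime_pos hk
  have hmax := EchoChain.norm_le_maxMode (hB (EchoChain.endTime k₀) ⟨by linarith, le_rfl⟩)
  have hmax2 : EchoChain.maxMode (u (EchoChain.endTime k₀))
      ≤ 2 * ‖u (EchoChain.endTime k₀) (k₀ - 1)‖ := ciSup_le q3
  have hθ : 0 ≤ EchoChain.maxMode (u (EchoChain.startTime k₀)) :=
    Real.iSup_nonneg fun _ => norm_nonneg _
  have hg : 0 < ξ ^ Real.sqrt (1 - 8 * c ^ 2) := Real.rpow_pos_of_pos hξ0 _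
  refine ⟨?_, by rw [EchoChain.ModeDominates]; linarith, hξ₀.trans ?_⟩
  · obtain ⟨M, hM⟩ : ∃ M, M = EchoChain.maxMode (u (EchoChain.endTime k₀)) := ⟨_, rfl⟩
    obtain ⟨G, hG⟩ : ∃ G, G = ξ ^ Real.sqrt (1 - 8 * c ^ 2)
      * EchoChain.maxMode (u (EchoChain.startTime k₀)) := ⟨_, rfl⟩
    simp only [mul_assoc]
    rw [← hG] at q1 q2 ⊢
    rw [← hM] at hmax2 hmax
    have hmid := hmax (k₀ - 1)
    have hG0 : 0 ≤ G := by rw [hG]; positivity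
    rcases hG0.eq_or_lt with h0 | h0
    · rw [← h0] at q2 ⊢
      have hz : ‖u (EchoChain.endTime k₀) (k₀ - 1)‖ ≤ 0 := by
        by_contra! h
        have := mul_pos hc h
        linarith
      refine ⟨_, le_rfl, hC, fun k => ?_, ?_⟩
      · linarith [q3 k]
      · rw [mul_zero]; exact norm_nonneg _
    · refine ⟨M / G, ?_, ?_, fun k => ?_, ?_⟩
      · rw [le_div_iff₀ h0]; linarith
      · rw [div_le_div_iff₀ h0 hc]
        have : M * |c| ≤ 2 * ‖u (EchoChain.endTime k₀) (k₀ - 1)‖ * |c| := by gcongr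
        linarith
      · rw [div_mul_cancel₀ _ h0.ne']; exact hmax k
      · rw [div_div, mul_comm G, ← div_div, div_mul_cancel₀ _ h0.ne']; linarith
  · have hη : 0 ≤ η := by
      rw [hξ] at hξ0
      by_contra! h
      exact absurd hξ0 (not_lt.2 (div_nonpos_of_nonpos_of_nonneg h.le (by positivity)))
    rw [hξ]
    have h1 : 0 < (k₀ : ℝ) - 1 := by linarith
    gcongr
    linarith
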